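/- Let $\Bbbk$ be a commutative ring with $1$, $\delta\in\Bbbk$ and $k\ge 0$. A partial Brauer $k$-diagram is a set partition, into blocks of size at most $2$, of a set of $2k$ vertices arranged in a top row and a bottom row of $k$ vertices each, with both rows numbered $1,\dots,k$ from left to right; blocks of size $2$ are edges. It is a Motzkin diagram if its edges can be drawn without crossings in the rectangle spanned by the two rows; an edge with both ends in the top (resp. bottom) row is a cup (resp. cap), and a Motzkin diagram is balanced if it has as many cups as caps. A Temperley--Lieb $n$-diagram is a Motzkin $n$-diagram without isolated vertices. For diagrams $d_1,d_2$, place $d_1$ above $d_2$ and identify the middle rows; $d_1\circ d_2$ is the resulting diagram on the outer rows and $N(d_1,d_2)$ the number of closed loops in the middle row. The partial Brauer algebra $\mathcal{PB}_k(\delta,1)$ has the partial Brauer $k$-diagrams as $\Bbbk$-basis and multiplication $d_1d_2=\delta^{N(d_1,d_2)}\,d_1\circ d_2$. Let $\mathrm{TL}_n(\delta)$ be the subalgebra of $\mathcal{PB}_n(\delta,1)$ spanned by the Temperley--Lieb $n$-diagrams. Let $p_i$ be the diagram whose two vertices in column $i$ are isolated, the two vertices in each other column being joined. For a diagram $d$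 put $$\tilde d=\prod_{i}(1-p_i)\; d\;\prod_{j}(1-p_j),\qquad \bar d=\sum_{d'\le d}(-1)^{\beta(d)-\beta(d')}d',$$ where $i$ (resp. $j$) runs over the endpoints of the cups (resp. caps) of $d$, $d'\le d$ means that each block of $d'$ is contained in a block of $d$, and $\beta$ is the number of blocks. Let $\mathrm{PTL}_k(\delta)$ be the subalgebra of $\mathcal{PB}_k(\delta,1)$ spanned by the $\tilde d$ with $d$ a balanced Motzkin $k$-diagram. For $0\le n\le k$ let $X(n)$ be the $\Bbbk$-span of the $\bar d$ with $d$ a balanced Motzkin $k$-diagram having exactly $n$ edges, and let $Q_n$ be the free $\Bbbk$-module on the set of $n$-element subsets of $\{1,\dots,k\}$. Then the spans $\mathrm{TL}_n(\delta-1)$ and $\mathrm{PTL}_k(\delta)$ are indeed subalgebras, $X(n)$ is a two-sided ideal of $\mathrm{PTL}_k(\delta)$, and there are isomorphisms of $\Bbbk$-algebras $$X(n)\;\cong\;\operatorname{Mat}_{\binom kn}\big(\mathrm{TL}_n(\delta-1)\big)\;\cong\;\operatorname{Mat}_{\binom kn}(\Bbbk)\otimes_\Bbbk \mathrm{TL}_n(\delta-1)\;\cong\;\operatorname{End}_\Bbbk(Q_n)\otimes_\Bbbk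 \mathrm{TL}_n(\delta-1),$$ the second sending a matrix with the single nonzero entry $t$ at $(i,j)$ to $e_{ij}\otimes t$ (where $e_{ij}$ is the matrix unit), the third identifying matrices with endomorphisms of $Q_n$ by means of its basis. Furthermore, every (unital) $X(n)$-module is isomorphic to $Q_n\otimes_\Bbbk N$ for some $\mathrm{TL}_n(\delta-1)$-module $N$, where $X(n)$ acts through these isomorphisms by $(f\otimes t)(A\otimes v)=f(A)\otimes tv$. Finally, $\mathrm{PTL}_k(\delta)$ is Morita equivalent, $\Bbbk$-linearly, to $\bigoplus_{n=0}^k\mathrm{TL}_n(\delta-1)$. -/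

import Mathlib

/-- A partial Brauer `k`-diagram: a set partition of the `2k` vertices `Fin k ⊕ Fin k` into blocks of
cardinality at most two. The vertex `.inl i` is the `i`th vertex of the top row and `.inr i` the
`i`th vertex of the bottom row. The partition is recorded by the involution `mate` that exchanges
the two endpoints of each edge and fixes each isolated vertex; the blocks are the sets
`{x, mate x}`. -/
@[ext]
structure PBDiagram (k : ℕ) where
  mate : Fin k ⊕ Fin k → Fin k ⊕ Fin k
  invol : ∀ x, mate (mate x) = x

/-- In the graph of two involutions on a finite set (each point is joined to its two images), a
component containing a point fixed by one of the involutions contains exactly two such ends, counted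
with the involution that fixes them. -/
theorem ends_aux {V : Type} [Finite V] (act : Bool → V → V) (hact : ∀ b a, act b (act b a) = a)
    (x : V) (c : Bool) (hx : act c x = x) :
    ∃ e : V × Bool, e ≠ (x, c) ∧ act e.2 e.1 = e.1 ∧
      Relation.EqvGen (fun a b => b = act true a ∨ b = act false a) x e.1 ∧
      ∀ y b, Relation.EqvGen (fun a b => b = act true a ∨ b = act false a) x y →
        act b y = y → (y, b) = (x, c) ∨ (y, b) = e := by
  classical
  have hE : ∀ b a, Relation.EqvGen (fun a b => b = act true a ∨ b = act false a) a (act b a) := by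
    intro b a
    refine Relation.EqvGen.rel _ _ ?_
    cases b <;> simp
  let S (b : Bool) : Equiv.Perm V := ⟨act b, act b, hact b, hact b⟩
  have hS : ∀ b a, S b a = act b a := fun _ _ => rfl
  have hSS : ∀ b, S b * S b = 1 := fun b => Equiv.ext (hact b)
  have hSi : ∀ b, (S b)⁻¹ = S b := fun b => inv_eq_of_mul_eq_one_left (hSS b)
  let ρ : Equiv.Perm V := S c * S (!c)
  have hinv : ρ⁻¹ = S (!c) * S c := by simp [ρ, hSi]
  have hconj : S c * ρ * (S c)⁻¹ = ρ⁻¹ := by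
    rw [hinv, hSi]; simp only [ρ]
    rw [← mul_assoc, hSS, one_mul]
  have hc : ∀ a : ℤ, act c ((ρ ^ a) x) = (ρ ^ (-a)) x := by
    intro a
    have h : S c * ρ ^ a * (S c)⁻¹ = ρ ^ (-a) := by
      rw [← conj_zpow, hconj, inv_zpow, zpow_neg]
    have h2 : S c * ρ ^ a = ρ ^ (-a) * S c := by rw [← h]; group
    calc act c ((ρ ^ a) x) = (S c * ρ ^ a) x := rfl
      _ = (ρ ^ (-a)) (act c x) := by rw [h2]; rfl
      _ = _ := by rw [hx]
  have hnc : ∀ a : ℤ, act (!c) ((ρ ^ a) x) = (ρ ^ (-a - 1)) x := by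
    intro a
    have h : S (!c) = S c * ρ := by simp only [ρ]; rw [← mul_assoc, hSS, one_mul]
    calc act (!c) ((ρ ^ a) x) = (S (!c)) ((ρ ^ a) x) := rfl
      _ = act c ((ρ ^ (1 + a)) x) := by rw [h, zpow_add, zpow_one]; rfl
      _ = _ := by rw [hc]; congr 2; ring
  have horb : ∀ y, Relation.EqvGen (fun a b => b = act true a ∨ b = act false a) x y →
      ∃ a : ℤ, y = (ρ ^ a) x := by
    have hb : ∀ b (a : ℤ), ∃ a' : ℤ, act b ((ρ ^ a) x) = (ρ ^ a') x := by
      intro b a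
      by_cases h : b = c
      · subst h; exact ⟨_, hc a⟩
      · have : b = !c := by revert h; cases b <;> cases c <;> simp
        subst this; exact ⟨_, hnc a⟩
    have key : ∀ u v, Relation.EqvGen (fun a b => b = act true a ∨ b = act false a) u v →
        ((∃ a : ℤ, u = (ρ ^ a) x) ↔ (∃ a : ℤ, v = (ρ ^ a) x)) := by
      intro u v h
      induction h with
      | rel u v h =>
        have : ∃ b, v = act b u := by rcases h with h | h <;> exact ⟨_, h⟩
        obtain ⟨b, rfl⟩ := this
        constructor
        · rintro ⟨a, rfl⟩; exact hb b a
        · rintro ⟨a, h⟩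
          obtain ⟨a', h'⟩ := hb b a
          refine ⟨a', ?_⟩
          rw [← h', ← h, hact]
      | refl => exact Iff.rfl
      | symm _ _ _ ih => exact ih.symm
      | trans _ _ _ _ _ ih1 ih2 => exact ih1.trans ih2
    intro y h
    exact (key x y h).1 ⟨0, rfl⟩
  have hreach : ∀ n : ℕ, Relation.EqvGen (fun a b => b = act true a ∨ b = act false a) x
      ((ρ ^ (n : ℤ)) x) := by
    intro n
    induction n with
    | zero => exact Relation.EqvGen.refl _
    | succ n ih =>
      have : (ρ ^ ((n + 1 : ℕ) : ℤ)) x = act c (act (!c) ((ρ ^ (n : ℤ)) x)) := by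
        push_cast
        rw [add_comm, zpow_add, zpow_one]; rfl
      rw [this]
      exact (ih.trans _ _ _ (hE _ _)).trans _ _ _ (hE _ _)
  have hper : ∀ a : ℤ, (ρ ^ a) x = x ↔ ((MulAction.period ρ x : ℕ) : ℤ) ∣ a := fun a =>
    MulAction.zpow_smul_eq_iff_period_dvd (g := ρ) (a := x)
  have heq : ∀ a b : ℤ, (ρ ^ a) x = (ρ ^ b) x ↔ ((MulAction.period ρ x : ℕ) : ℤ) ∣ a - b := by
    intro a b
    rw [← hper, sub_eq_neg_add, zpow_add, zpow_neg, Equiv.Perm.mul_apply, Equiv.Perm.inv_eq_iff_eq]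
    
  have hppos : 0 < MulAction.period ρ x :=
    MulAction.period_pos_of_orderOf_pos (orderOf_pos ρ) x
  generalize MulAction.period ρ x = p at *
  have hbc : ∀ b, b = c ∨ b = !c := by intro b; cases b <;> cases c <;> simp
  rcases Nat.even_or_odd' p with ⟨q, rfl | rfl⟩
  · refine ⟨((ρ ^ (q : ℤ)) x, c), ?_, ?_, hreach q, ?_⟩
    · intro h
      have h1 : (ρ ^ (q : ℤ)) x = x := congrArg Prod.fst h
      rw [hper] at h1
      have := Int.le_of_dvd (by omega) h1
      push_cast at this; omega
    · change act c _ = _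
      rw [hc, heq]; exact ⟨-1, by push_cast; ring⟩
    · intro y b hy hfix
      obtain ⟨a, rfl⟩ := horb y hy
      rcases hbc b with rfl | rfl
      · rw [hc, heq] at hfix
        obtain ⟨m, hm⟩ := hfix
        have ha : a = q * (-m) := by push_cast at hm; linarith
        rcases Int.even_or_odd' (-m) with ⟨r, hr | hr⟩
        · left
          rw [Prod.mk.injEq]
          refine ⟨(hper a).2 ⟨r, by rw [ha, hr]; push_cast; ring⟩, rfl⟩
        · right
          rw [Prod.mk.injEq]
          refine ⟨(heq _ _).2 ⟨r, by rw [ha, hr]; push_cast; ring⟩, rfl⟩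
      · exfalso
        rw [hnc, heq] at hfix
        obtain ⟨m, hm⟩ := hfix
        push_cast at hm
        have : 2 * (-a - q * m) = 1 := by linarith
        omega
  · refine ⟨((ρ ^ (q : ℤ)) x, !c), ?_, ?_, hreach q, ?_⟩
    · intro h
      have h1 : (!c) = c := congrArg Prod.snd h
      cases c <;> simp at h1
    · change act (!c) _ = _
      rw [hnc, heq]; exact ⟨-1, by push_cast; ring⟩
    · intro y b hy hfix
      obtain ⟨a, rfl⟩ := horb y hy
      rcases hbc b with rfl | rfl
      · left
        rw [hc, heq] at hfix
        obtain ⟨m, hm⟩ := hfix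
        rw [Prod.mk.injEq]
        refine ⟨(hper a).2 ?_, rfl⟩
        push_cast at hm ⊢
        exact ⟨a + q * m, by linear_combination (q : ℤ) * hm⟩
      · right
        rw [hnc, heq] at hfix
        obtain ⟨m, hm⟩ := hfix
        rw [Prod.mk.injEq]
        refine ⟨(heq _ _).2 ?_, rfl⟩
        push_cast at hm ⊢
        exact ⟨a + q * m, by linear_combination (q : ℤ) * hm⟩

namespace PBDiagram

variable {k : ℕ}

noncomputable instance : DecidableEq (PBDiagram k) := Classical.decEq _

instance : Finite (PBDiagram k) :=
  Finite.of_injective PBDiagram.mate fun _ _ h => PBDiagram.ext h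

noncomputable instance : Fintype (PBDiagram k) := Fintype.ofFinite _

/-- Vertices of a composite configuration of `d₁` placed above `d₂`: `.inl x` is a vertex of the outer
rows (top row of `d₁`, bottom row of `d₂`), and `.inr i` is a vertex of the middle row, where the
bottom row of `d₁` is identified with the top row of `d₂`. -/
abbrev CVertex (k : ℕ) : Type := (Fin k ⊕ Fin k) ⊕ Fin k

/-- The place of a vertex of the upper diagram in the composite configuration. -/
def upper : Fin k ⊕ Fin k → CVertex k
  | .inl i => .inl (.inl i)
  | .inr i => .inr i

/-- The place of a vertex of the lower diagram in the composite configuration. -/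
def lower : Fin k ⊕ Fin k → CVertex k
  | .inl i => .inr i
  | .inr i => .inl (.inr i)

/-- The vertex joined to a given one by the upper diagram; vertices that are isolated in the upper
diagram, and those of the bottom row, are fixed. -/
def upperMate (d₁ : PBDiagram k) : CVertex k → CVertex k
  | .inl (.inl i) => upper (d₁.mate (.inl i))
  | .inr i => upper (d₁.mate (.inr i))
  | .inl (.inr i) => .inl (.inr i)

/-- The vertex joined to a given one by the lower diagram; vertices that are isolated in the lower
diagram, and those of the top row, are fixed. -/
def lowerMate (d₂ : PBDiagram k) : CVertex k → CVertex k
  | .inr i => lower (d₂.mate (.inl i))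
  | .inl (.inr i) => lower (d₂.mate (.inr i))
  | .inl (.inl i) => .inl (.inl i)

/-- Lying in the same connected component of the composite configuration. -/
def conn (d₁ d₂ : PBDiagram k) : Setoid (CVertex k) :=
  Relation.EqvGen.setoid fun a b => b = upperMate d₁ a ∨ b = lowerMate d₂ a

/-- A component is a closed loop if each of its vertices is met by an edge of the upper diagram and by
an edge of the lower diagram. (Such a component lies in the middle row, as vertices of the outer
rows are met by edges of one diagram only.) -/
def IsLoop (d₁ d₂ : PBDiagram k) (c : Quotient (conn d₁ d₂)) : Prop :=
  ∀ v, Quotient.mk (conn d₁ d₂) v = c → upperMate d₁ v ≠ v ∧ lowerMate d₂ v ≠ v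

/-- The number of closed loops in the middle of the composite configuration. -/
noncomputable def loops (d₁ d₂ : PBDiagram k) : ℕ :=
  Nat.card {c : Quotient (conn d₁ d₂) // IsLoop d₁ d₂ c}

theorem upperMate_invol (d : PBDiagram k) (a : CVertex k) :
    upperMate d (upperMate d a) = a := by
  have key : ∀ u, upperMate d (upper u) = upper (d.mate u) := by
    rintro (i | i) <;> rfl
  rcases a with (i | i) | i
  · change upperMate d (upper (d.mate (.inl i))) = _
    rw [key, d.invol]; rfl
  · rfl
  · change upperMate d (upper (d.mate (.inr i))) = _
    rw [key, d.invol]; rfl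

theorem lowerMate_invol (d : PBDiagram k) (a : CVertex k) :
    lowerMate d (lowerMate d a) = a := by
  have key : ∀ u, lowerMate d (lower u) = lower (d.mate u) := by
    rintro (i | i) <;> rfl
  rcases a with (i | i) | i
  · rfl
  · change lowerMate d (lower (d.mate (.inr i))) = _
    rw [key, d.invol]; rfl
  · change lowerMate d (lower (d.mate (.inl i))) = _
    rw [key, d.invol]; rfl


/-- The two involutions on the vertices of the composite configuration. -/
abbrev side (d₁ d₂ : PBDiagram k) (b : Bool) : CVertex k → CVertex k :=
  if b then upperMate d₁ else lowerMate d₂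

theorem side_invol (d₁ d₂ : PBDiagram k) (b : Bool) (a : CVertex k) :
    side d₁ d₂ b (side d₁ d₂ b a) = a := by
  cases b
  · exact lowerMate_invol d₂ a
  · exact upperMate_invol d₁ a

theorem ends (d₁ d₂ : PBDiagram k) (x : CVertex k) (c : Bool) (hx : side d₁ d₂ c x = x) :
    ∃ e : CVertex k × Bool, e ≠ (x, c) ∧ side d₁ d₂ e.2 e.1 = e.1 ∧ conn d₁ d₂ x e.1 ∧
      ∀ y b, conn d₁ d₂ x y → side d₁ d₂ b y = y → (y, b) = (x, c) ∨ (y, b) = e :=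
  ends_aux (side d₁ d₂) (side_invol d₁ d₂) x c hx

/-- The diagram in whose composite configuration an outer vertex is missing an edge. -/
def outSide : Fin k ⊕ Fin k → Bool
  | .inl _ => false
  | .inr _ => true

theorem side_outer (d₁ d₂ : PBDiagram k) (x : Fin k ⊕ Fin k) :
    side d₁ d₂ (outSide x) (.inl x) = .inl x := by
  rcases x with i | i <;> rfl

theorem outer_unique (d₁ d₂ : PBDiagram k) {x y z : Fin k ⊕ Fin k}
    (hxy : conn d₁ d₂ (.inl x) (.inl y)) (hxz : conn d₁ d₂ (.inl x) (.inl z))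
    (hy : y ≠ x) (hz : z ≠ x) : y = z := by
  obtain ⟨e, -, -, -, he⟩ := ends d₁ d₂ (.inl x) _ (side_outer d₁ d₂ x)
  have h1 := he _ _ hxy (side_outer d₁ d₂ y)
  have h2 := he _ _ hxz (side_outer d₁ d₂ z)
  simp only [Prod.mk.injEq, Sum.inl.injEq, hy, hz, false_and, false_or] at h1 h2
  have := congrArg Prod.fst (h1.trans h2.symm)
  simpa using this

open Classical in
/-- The composite `d₁ ∘ d₂` (with `d₁` above `d₂`): two distinct vertices of the outer rows form an
edge if they lie in the same component of the composite configuration. -/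
noncomputable def comp (d₁ d₂ : PBDiagram k) : PBDiagram k where
  mate x := if h : ∃ y, y ≠ x ∧ conn d₁ d₂ (.inl x) (.inl y) then h.choose else x
  invol x := by
    by_cases h : ∃ y, y ≠ x ∧ conn d₁ d₂ (.inl x) (.inl y)
    · have hs := h.choose_spec
      have h' : ∃ z, z ≠ h.choose ∧ conn d₁ d₂ (.inl h.choose) (.inl z) :=
        ⟨x, hs.1.symm, Setoid.symm' _ hs.2⟩
      have hs' := h'.choose_spec
      rw [dif_pos h, dif_pos h']
      exact outer_unique d₁ d₂ hs'.2 (Setoid.symm' _ hs.2) hs'.1 hs.1.symm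
    · simp only [dif_neg h]

theorem comp_conn (d₁ d₂ : PBDiagram k) (x : Fin k ⊕ Fin k) :
    conn d₁ d₂ (.inl x) (.inl ((comp d₁ d₂).mate x)) := by
  unfold comp
  dsimp only
  split_ifs with h
  · exact h.choose_spec.2
  · exact Setoid.refl' _ _

theorem comp_mate_of_conn (d₁ d₂ : PBDiagram k) {x y : Fin k ⊕ Fin k} (hy : y ≠ x)
    (h : conn d₁ d₂ (.inl x) (.inl y)) : (comp d₁ d₂).mate x = y := by
  have h' : ∃ y, y ≠ x ∧ conn d₁ d₂ (.inl x) (.inl y) := ⟨y, hy, h⟩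
  unfold comp
  simp only [dif_pos h']
  exact outer_unique d₁ d₂ h'.choose_spec.2 h h'.choose_spec.1 hy

/-- The identity diagram: every top vertex is joined to the bottom vertex below it. -/
def one (k : ℕ) : PBDiagram k where
  mate := Sum.swap
  invol := Sum.swap_swap

/-! ### Associativity

Associativity of composition and additivity of the number of loops are read off from the matrices
counting two-colourings of the vertices that are constant on edges and vanish on isolated
vertices. -/

/-- A two-colouring of the vertices that is constant on edges and vanishes on isolated vertices. -/
def Valid (d : PBDiagram k) (c : Fin k ⊕ Fin k → Bool) : Prop :=
  ∀ x, c (d.mate x) = c x ∧ (d.mate x = x → c x = false)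

theorem valid_zero (d : PBDiagram k) : Valid d fun _ => false := fun _ => ⟨rfl, fun _ => rfl⟩

theorem valid_one {c : Fin k ⊕ Fin k → Bool} :
    Valid (one k) c ↔ ∀ i, c (.inl i) = c (.inr i) := by
  constructor
  · intro h i; exact ((h (.inl i)).1).symm
  · rintro h (i | i)
    · exact ⟨(h i).symm, fun h => by cases h⟩
    · exact ⟨h i, fun h => by cases h⟩

theorem eq_of_valid {d e : PBDiagram k} (h : ∀ c, Valid d c ↔ Valid e c) : d = e := by
  classical
  have key : ∀ {d e : PBDiagram k}, (∀ c, Valid d c ↔ Valid e c) → ∀ x, d.mate x ≠ x →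
      e.mate x = d.mate x := by
    intro d e h x hx
    have hv : Valid d fun y => decide (y = x ∨ y = d.mate x) := by
      intro y
      have h1 : (d.mate y = x ∨ d.mate y = d.mate x) ↔ (y = x ∨ y = d.mate x) := by
        constructor
        · rintro (h | h)
          · right; rw [← h, d.invol]
          · left; rw [← d.invol y, h, d.invol]
        · rintro (rfl | rfl)
          · right; rfl
          · left; exact d.invol _
      refine ⟨by simp only [h1], fun hy => ?_⟩
      simp only [decide_eq_false_iff_not]
      rintro (rfl | rfl)
      · exact hx hy
      · rw [d.invol] at hy; exact hx hy.symm
    have hv' := (h _).1 hv x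
    have hne : e.mate x ≠ x := fun h' => by simpa using hv'.2 h'
    have := hv'.1
    simp only [true_or, decide_true, decide_eq_true_eq] at this
    exact this.resolve_left hne
  refine PBDiagram.ext (funext fun x => ?_)
  by_cases hd : d.mate x = x
  · by_cases he : e.mate x = x
    · rw [hd, he]
    · exact key (fun c => (h c).symm) x he
  · exact (key h x hd).symm


/-- A compatible colouring of the vertices of the composite configuration. -/
def Good (d₁ d₂ : PBDiagram k) (f : CVertex k → Bool) : Prop :=
  ∀ b v, f (side d₁ d₂ b v) = f v ∧
    (side d₁ d₂ b v = v → (∀ x, (v, b) ≠ (.inl x, outSide x)) → f v = false)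

theorem good_iff (d₁ d₂ : PBDiagram k) (t m s : Fin k → Bool) :
    Good d₁ d₂ (Sum.elim (Sum.elim t s) m) ↔
      Valid d₁ (Sum.elim t m) ∧ Valid d₂ (Sum.elim m s) := by
  have hu : ∀ u v : Fin k ⊕ Fin k, upper u = upper v ↔ u = v := by
    rintro (i | i) (j | j) <;> simp [upper]
  have hl : ∀ u v : Fin k ⊕ Fin k, lower u = lower v ↔ u = v := by
    rintro (i | i) (j | j) <;> simp [lower]
  have hu' : ∀ u, Sum.elim (Sum.elim t s) m (upper u) = Sum.elim t m u := by
    rintro (i | i) <;> rfl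
  have hl' : ∀ u, Sum.elim (Sum.elim t s) m (lower u) = Sum.elim m s u := by
    rintro (i | i) <;> rfl
  have hum : ∀ u, upperMate d₁ (upper u) = upper (d₁.mate u) := by rintro (i | i) <;> rfl
  have hlm : ∀ u, lowerMate d₂ (lower u) = lower (d₂.mate u) := by rintro (i | i) <;> rfl
  constructor
  · intro h
    constructor
    · intro u
      have h1 := h true (upper u)
      simp only [side, if_true, hum, hu', hu] at h1
      refine ⟨h1.1, fun hx => h1.2 hx fun x => ?_⟩
      rcases u with i | i <;> rcases x with j | j <;> simp [upper, outSide]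
    · intro u
      have h1 := h false (lower u)
      simp only [side, Bool.false_eq_true, if_false, hlm, hl', hl] at h1
      refine ⟨h1.1, fun hx => h1.2 hx fun x => ?_⟩
      rcases u with i | i <;> rcases x with j | j <;> simp [lower, outSide]
  · rintro ⟨h1, h2⟩ b v
    have hupper : ∀ u, Sum.elim (Sum.elim t s) m (side d₁ d₂ true (upper u)) =
        Sum.elim (Sum.elim t s) m (upper u) ∧ (side d₁ d₂ true (upper u) = upper u →
          Sum.elim (Sum.elim t s) m (upper u) = false) := by
      intro u
      simp only [side, if_true, hum, hu', hu]
      exact h1 u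
    have hlower : ∀ u, Sum.elim (Sum.elim t s) m (side d₁ d₂ false (lower u)) =
        Sum.elim (Sum.elim t s) m (lower u) ∧ (side d₁ d₂ false (lower u) = lower u →
          Sum.elim (Sum.elim t s) m (lower u) = false) := by
      intro u
      simp only [side, Bool.false_eq_true, if_false, hlm, hl', hl]
      exact h2 u
    cases b
    · rcases v with (i | i) | i
      · exact ⟨rfl, fun _ h => absurd rfl (h (.inl i))⟩
      · exact ⟨(hlower (.inr i)).1, fun h _ => (hlower (.inr i)).2 h⟩
      · exact ⟨(hlower (.inl i)).1, fun h _ => (hlower (.inl i)).2 h⟩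
    · rcases v with (i | i) | i
      · exact ⟨(hupper (.inl i)).1, fun h _ => (hupper (.inl i)).2 h⟩
      · exact ⟨rfl, fun _ h => absurd rfl (h (.inr i))⟩
      · exact ⟨(hupper (.inr i)).1, fun h _ => (hupper (.inr i)).2 h⟩

theorem Good.const {d₁ d₂ : PBDiagram k} {f : CVertex k → Bool} (hf : Good d₁ d₂ f)
    {u v : CVertex k} (h : conn d₁ d₂ u v) : f u = f v := by
  induction h with
  | rel u v h =>
    rcases h with rfl | rfl
    · exact ((hf true u).1).symm
    · exact ((hf false u).1).symm
  | refl => rfl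
  | symm _ _ _ ih => exact ih.symm
  | trans _ _ _ _ _ ih1 ih2 => exact ih1.trans ih2

theorem Good.valid_comp {d₁ d₂ : PBDiagram k} {c : Fin k ⊕ Fin k → Bool} {m : Fin k → Bool}
    (hf : Good d₁ d₂ (Sum.elim c m)) : Valid (comp d₁ d₂) c := by
  intro x
  refine ⟨(hf.const (comp_conn d₁ d₂ x)).symm, fun hx => ?_⟩
  obtain ⟨⟨v, b⟩, hne, hfix, hconn, -⟩ := ends d₁ d₂ (.inl x) _ (side_outer d₁ d₂ x)
  have h1 : c x = Sum.elim c m v := hf.const hconn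
  rw [h1]
  refine (hf b v).2 hfix fun y hy => ?_
  rw [hy] at hne
  obtain ⟨rfl, rfl⟩ := Prod.mk.inj hy
  have hyx : y ≠ x := fun h => hne (by rw [h])
  exact hyx ((comp_mate_of_conn d₁ d₂ hyx hconn).symm.trans hx)

theorem not_isLoop_outer (d₁ d₂ : PBDiagram k) (x : Fin k ⊕ Fin k) :
    ¬ IsLoop d₁ d₂ (Quotient.mk _ (.inl x)) := by
  intro h
  have := h _ rfl
  rcases x with i | i
  · exact this.2 rfl
  · exact this.1 rfl

open Classical in
/-- The colouring with given outer colours and given colours on the loops. -/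
noncomputable def extendColour (d₁ d₂ : PBDiagram k) (c : Fin k ⊕ Fin k → Bool)
    (g : {q : Quotient (conn d₁ d₂) // IsLoop d₁ d₂ q} → Bool) (v : CVertex k) : Bool :=
  if h : IsLoop d₁ d₂ (Quotient.mk _ v) then g ⟨_, h⟩
  else decide (∃ x, conn d₁ d₂ v (.inl x) ∧ c x = true)

theorem ext_outer {d₁ d₂ : PBDiagram k} {c : Fin k ⊕ Fin k → Bool}
    (hc : Valid (comp d₁ d₂) c) (g) (y : Fin k ⊕ Fin k) :
    extendColour d₁ d₂ c g (.inl y) = c y := by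
  classical
  unfold extendColour
  rw [dif_neg (not_isLoop_outer d₁ d₂ y), Bool.eq_iff_iff, decide_eq_true_eq]
  constructor
  · rintro ⟨x, hx, hcx⟩
    by_cases h : x = y
    · rwa [← h]
    · rw [← (hc y).1, comp_mate_of_conn d₁ d₂ h hx, hcx]
  · intro h
    exact ⟨y, Setoid.refl' _ _, h⟩

theorem ext_good {d₁ d₂ : PBDiagram k} {c : Fin k ⊕ Fin k → Bool}
    (hc : Valid (comp d₁ d₂) c) (g) : Good d₁ d₂ (extendColour d₁ d₂ c g) := by
  have hconst : ∀ u v, conn d₁ d₂ u v → extendColour d₁ d₂ c g u = extendColour d₁ d₂ c g v := by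
    intro u v h
    have hq : Quotient.mk (conn d₁ d₂) u = Quotient.mk _ v := Quotient.sound h
    have hx : (∃ x, conn d₁ d₂ u (.inl x) ∧ c x = true) ↔
        (∃ x, conn d₁ d₂ v (.inl x) ∧ c x = true) :=
      exists_congr fun x => and_congr_left fun _ =>
        ⟨fun h' => Setoid.trans' _ (Setoid.symm' _ h) h', fun h' => Setoid.trans' _ h h'⟩
    unfold extendColour
    by_cases hu : IsLoop d₁ d₂ (Quotient.mk _ u)
    · have hv : IsLoop d₁ d₂ (Quotient.mk _ v) := hq ▸ hu
      rw [dif_pos hu, dif_pos hv]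
      exact congrArg g (Subtype.ext hq)
    · have hv : ¬ IsLoop d₁ d₂ (Quotient.mk _ v) := hq ▸ hu
      rw [dif_neg hu, dif_neg hv]
      exact decide_eq_decide.2 hx
  intro b v
  have hstep : conn d₁ d₂ v (side d₁ d₂ b v) := by
    refine Relation.EqvGen.rel _ _ ?_
    cases b
    · exact Or.inr rfl
    · exact Or.inl rfl
  refine ⟨(hconst _ _ hstep).symm, fun hfix hout => ?_⟩
  have hl : ¬ IsLoop d₁ d₂ (Quotient.mk _ v) := by
    intro h
    have := h v rfl
    cases b
    · exact this.2 hfix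
    · exact this.1 hfix
  unfold extendColour
  rw [dif_neg hl, decide_eq_false_iff_not]
  rintro ⟨x, hx, hcx⟩
  have hiso : (comp d₁ d₂).mate x = x := by
    by_contra hne
    obtain ⟨e, -, -, -, he⟩ := ends d₁ d₂ (.inl x) _ (side_outer d₁ d₂ x)
    have h1 := he _ _ (comp_conn d₁ d₂ x) (side_outer d₁ d₂ _)
    have h2 := he _ _ (Setoid.symm' _ hx) hfix
    have h2' := h2.resolve_left (hout x)
    rcases h1 with h1 | h1
    · have := congrArg Prod.fst h1
      exact hne (by simpa using this)
    · exact hout _ (h2'.trans h1.symm)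
  rw [(hc x).2 hiso] at hcx
  exact Bool.false_ne_true hcx

theorem card_good {d₁ d₂ : PBDiagram k} {c : Fin k ⊕ Fin k → Bool}
    (hc : Valid (comp d₁ d₂) c) :
    Nat.card {m : Fin k → Bool // Good d₁ d₂ (Sum.elim c m)} = 2 ^ loops d₁ d₂ := by
  classical
  have hglue : ∀ g, Sum.elim c (fun i => extendColour d₁ d₂ c g (.inr i)) = extendColour d₁ d₂ c g := by
    intro g
    funext v
    rcases v with y | i
    · exact (ext_outer hc g y).symm
    · rfl
  have hbij : Function.Bijective
      (fun g => (⟨fun i => extendColour d₁ d₂ c g (.inr i), by rw [hglue]; exact ext_good hc g⟩ :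
        {m : Fin k → Bool // Good d₁ d₂ (Sum.elim c m)})) := by
    constructor
    · intro g g' h
      have h' : ∀ i, extendColour d₁ d₂ c g (.inr i) = extendColour d₁ d₂ c g' (.inr i) :=
        fun i => congrFun (congrArg Subtype.val h) i
      funext ⟨q, hq⟩
      induction q using Quotient.inductionOn with
      | h v =>
        rcases v with x | i
        · exact absurd hq (not_isLoop_outer d₁ d₂ x)
        · have := h' i
          unfold extendColour at this
          rwa [dif_pos hq, dif_pos hq] at this
    · rintro ⟨m, hm⟩
      refine ⟨fun q => Sum.elim c m q.1.out, Subtype.ext (funext fun i => ?_)⟩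
      change extendColour d₁ d₂ c (fun q => Sum.elim c m q.1.out) (.inr i) = m i
      unfold extendColour
      split_ifs with h
      · exact hm.const (Quotient.exact (Quotient.out_eq (Quotient.mk (conn d₁ d₂) (.inr i))))
      · rw [Bool.eq_iff_iff, decide_eq_true_eq]
        constructor
        · rintro ⟨x, hx, hcx⟩
          have := hm.const hx
          exact this.trans hcx
        · intro hi
          unfold IsLoop at h
          push Not at h
          obtain ⟨v, hv, hv'⟩ := h
          have hv := Quotient.exact hv
          have hmv : Sum.elim c m v = true := (hm.const hv).trans hi
          have hb : ∃ b, side d₁ d₂ b v = v := by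
            by_cases h1 : upperMate d₁ v = v
            · exact ⟨true, h1⟩
            · exact ⟨false, hv' h1⟩
          obtain ⟨b, hb⟩ := hb
          by_cases hout : ∀ x, (v, b) ≠ (.inl x, outSide x)
          · rw [(hm b v).2 hb hout] at hmv
            exact absurd hmv Bool.false_ne_true
          · push Not at hout
            obtain ⟨x, hx⟩ := hout
            obtain ⟨rfl, rfl⟩ := Prod.mk.inj hx
            exact ⟨x, Setoid.symm' _ hv, hmv⟩
  rw [← Nat.card_congr (Equiv.ofBijective _ hbij), Nat.card_fun, loops]
  simp

open Classical in
/-- The matrix recording the compatible colourings of a diagram. -/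
noncomputable def mat (d : PBDiagram k) : Matrix (Fin k → Bool) (Fin k → Bool) ℕ :=
  fun t s => if Valid d (Sum.elim t s) then 1 else 0

theorem mat_mul (d₁ d₂ : PBDiagram k) :
    mat d₁ * mat d₂ = 2 ^ loops d₁ d₂ • mat (comp d₁ d₂) := by
  classical
  ext t s
  have h1 : (mat d₁ * mat d₂) t s =
      Nat.card {m : Fin k → Bool // Good d₁ d₂ (Sum.elim (Sum.elim t s) m)} := by
    simp only [Matrix.mul_apply, mat, good_iff, ← ite_and, mul_ite, mul_one, mul_zero,
      Finset.sum_boole, Nat.card_eq_fintype_card, Fintype.card_subtype, Nat.cast_id]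
    congr 1
    ext m
    simp [and_comm]
  rw [h1, Matrix.smul_apply]
  by_cases hv : Valid (comp d₁ d₂) (Sum.elim t s)
  · rw [card_good hv]; simp [mat, hv]
  · have : IsEmpty {m : Fin k → Bool // Good d₁ d₂ (Sum.elim (Sum.elim t s) m)} :=
      ⟨fun m => hv m.2.valid_comp⟩
    simp [mat, hv]

theorem mat_one : mat (one k) = 1 := by
  classical
  ext t s
  simp only [mat, valid_one, Sum.elim_inl, Sum.elim_inr, Matrix.one_apply, funext_iff]

theorem mat_injective : Function.Injective (mat (k := k)) := by
  classical
  intro d e h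
  refine eq_of_valid fun c => ?_
  have h1 := congrFun (congrFun h (fun i => c (.inl i))) (fun i => c (.inr i))
  have h2 : Sum.elim (fun i => c (.inl i)) (fun i => c (.inr i)) = c := by
    funext x; rcases x with i | i <;> rfl
  simp only [mat, h2] at h1
  by_cases hd : Valid d c <;> by_cases he : Valid e c <;> simp_all

theorem eq_of_smul_mat {a b : ℕ} {d e : PBDiagram k}
    (h : 2 ^ a • mat d = 2 ^ b • mat e) : a = b ∧ d = e := by
  have h0 : ∀ d : PBDiagram k, mat d (fun _ => false) (fun _ => false) = 1 := by
    intro d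
    have : Sum.elim (fun _ : Fin k => false) (fun _ : Fin k => false) = fun _ => false := by
      funext x; rcases x with i | i <;> rfl
    simp [mat, this, valid_zero]
  have h1 := congrFun (congrFun h (fun _ => false)) (fun _ => false)
  simp only [Matrix.smul_apply, h0, smul_eq_mul, mul_one] at h1
  have hab := Nat.pow_right_injective le_rfl h1
  refine ⟨hab, mat_injective ?_⟩
  subst hab
  ext t s
  have h2 := congrFun (congrFun h t) s
  simp only [Matrix.smul_apply, smul_eq_mul] at h2
  exact Nat.eq_of_mul_eq_mul_left (by positivity) h2

theorem comp_assoc_loops (d₁ d₂ d₃ : PBDiagram k) :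
    loops d₁ d₂ + loops (comp d₁ d₂) d₃ = loops d₂ d₃ + loops d₁ (comp d₂ d₃) ∧
      comp (comp d₁ d₂) d₃ = comp d₁ (comp d₂ d₃) := by
  apply eq_of_smul_mat
  have h := mul_assoc (mat d₁) (mat d₂) (mat d₃)
  rw [mat_mul, mat_mul, Matrix.smul_mul, Matrix.mul_smul, mat_mul, mat_mul, smul_smul, smul_smul,
    ← pow_add, ← pow_add] at h
  exact h

theorem one_comp_loops (d : PBDiagram k) : loops (one k) d = 0 ∧ comp (one k) d = d := by
  apply eq_of_smul_mat
  rw [← mat_mul, mat_one, one_mul, pow_zero, one_smul]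

theorem comp_one_loops (d : PBDiagram k) : loops d (one k) = 0 ∧ comp d (one k) = d := by
  apply eq_of_smul_mat
  rw [← mat_mul, mat_one, mul_one, pow_zero, one_smul]

end PBDiagram

/-! ### The partial Brauer algebra -/

/-- The partial Brauer algebra `PB_k(δ, 1)`: the free module on the partial Brauer `k`-diagrams, with
multiplication `d₁ d₂ = δ ^ N • (d₁ ∘ d₂)`, where `N` is the number of closed loops. -/
def PBAlgebra (𝕜 : Type*) (k : ℕ) (_δ : 𝕜) [CommRing 𝕜] : Type _ := PBDiagram k →₀ 𝕜

namespace PBAlgebra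

variable {𝕜 : Type*} [CommRing 𝕜] {k : ℕ} {δ : 𝕜}

noncomputable instance : AddCommGroup (PBAlgebra 𝕜 k δ) :=
  inferInstanceAs (AddCommGroup (PBDiagram k →₀ 𝕜))

noncomputable instance : Module 𝕜 (PBAlgebra 𝕜 k δ) :=
  inferInstanceAs (Module 𝕜 (PBDiagram k →₀ 𝕜))

/-- The basis element given by a diagram. -/
noncomputable def of (δ : 𝕜) (d : PBDiagram k) : PBAlgebra 𝕜 k δ :=
  Finsupp.single d (1 : 𝕜)

/-- Linear extension of a map defined on diagrams. -/
noncomputable def lift (δ : 𝕜) {M : Type*} [AddCommGroup M] [Module 𝕜 M]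
    (f : PBDiagram k → M) : PBAlgebra 𝕜 k δ →ₗ[𝕜] M :=
  (Finsupp.linearCombination 𝕜 f : (PBDiagram k →₀ 𝕜) →ₗ[𝕜] M)

theorem lift_of {M : Type*} [AddCommGroup M] [Module 𝕜 M] (f : PBDiagram k → M)
    (d : PBDiagram k) : lift δ f (of δ d) = f d :=
  (Finsupp.linearCombination_single 𝕜 (1 : 𝕜) d).trans (one_smul 𝕜 (f d))

theorem lin_ext {M : Type*} [AddCommGroup M] [Module 𝕜 M] {f g : PBAlgebra 𝕜 k δ →ₗ[𝕜] M}
    (h : ∀ d, f (of δ d) = g (of δ d)) : f = g :=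
  Finsupp.lhom_ext' fun d => LinearMap.ext_ring (h d)

/-- The multiplication: the bilinear extension of
`d₁ d₂ = δ ^ (number of loops) • (d₁ ∘ d₂)`. -/
noncomputable def mulBilin (𝕜 : Type*) [CommRing 𝕜] (k : ℕ) (δ : 𝕜) :
    PBAlgebra 𝕜 k δ →ₗ[𝕜] PBAlgebra 𝕜 k δ →ₗ[𝕜] PBAlgebra 𝕜 k δ :=
  lift δ fun d₁ => lift δ fun d₂ =>
    δ ^ PBDiagram.loops d₁ d₂ • of δ (PBDiagram.comp d₁ d₂)

noncomputable instance : Mul (PBAlgebra 𝕜 k δ) := ⟨fun x y => mulBilin 𝕜 k δ x y⟩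

noncomputable instance : One (PBAlgebra 𝕜 k δ) := ⟨of δ (PBDiagram.one k)⟩

theorem mul_def (x y : PBAlgebra 𝕜 k δ) : x * y = mulBilin 𝕜 k δ x y := rfl

theorem of_mul_of (d₁ d₂ : PBDiagram k) : of δ d₁ * of δ d₂ =
    δ ^ PBDiagram.loops d₁ d₂ • of δ (PBDiagram.comp d₁ d₂) := by
  rw [mul_def, mulBilin, lift_of, lift_of]

theorem mul_assoc_aux (x y z : PBAlgebra 𝕜 k δ) : x * y * z = x * (y * z) := by
  have h3 : ∀ (d₁ d₂ : PBDiagram k) (z : PBAlgebra 𝕜 k δ),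
      of δ d₁ * of δ d₂ * z = of δ d₁ * (of δ d₂ * z) := by
    intro d₁ d₂ z
    have : mulBilin 𝕜 k δ (of δ d₁ * of δ d₂) =
        (mulBilin 𝕜 k δ (of δ d₁)).comp (mulBilin 𝕜 k δ (of δ d₂)) := by
      refine lin_ext fun d₃ => ?_
      rw [LinearMap.comp_apply, ← mul_def (of δ d₂), of_mul_of, of_mul_of, map_smul, map_smul,
        LinearMap.smul_apply, ← mul_def, ← mul_def, of_mul_of, of_mul_of, smul_smul, smul_smul,
        ← pow_add, ← pow_add, (PBDiagram.comp_assoc_loops d₁ d₂ d₃).1,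
        (PBDiagram.comp_assoc_loops d₁ d₂ d₃).2]
    exact LinearMap.congr_fun this z
  have h2 : ∀ (d₁ : PBDiagram k) (y z : PBAlgebra 𝕜 k δ),
      of δ d₁ * y * z = of δ d₁ * (y * z) := by
    intro d₁ y z
    have : ((mulBilin 𝕜 k δ).flip z).comp (mulBilin 𝕜 k δ (of δ d₁)) =
        (mulBilin 𝕜 k δ (of δ d₁)).comp ((mulBilin 𝕜 k δ).flip z) :=
      lin_ext fun d₂ => h3 d₁ d₂ z
    exact LinearMap.congr_fun this y
  have h1 : ((mulBilin 𝕜 k δ).flip z).comp ((mulBilin 𝕜 k δ).flip y) =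
      (mulBilin 𝕜 k δ).flip (y * z) := lin_ext fun d₁ => h2 d₁ y z
  exact LinearMap.congr_fun h1 x

noncomputable instance : Ring (PBAlgebra 𝕜 k δ) where
  __ := (inferInstance : AddCommGroup (PBAlgebra 𝕜 k δ))
  left_distrib x y z := map_add (mulBilin 𝕜 k δ x) y z
  right_distrib x y z := by
    rw [mul_def, map_add, LinearMap.add_apply]; rfl
  zero_mul x := by
    rw [mul_def, map_zero, LinearMap.zero_apply]
  mul_zero x := map_zero (mulBilin 𝕜 k δ x)
  one_mul x := by
    have : mulBilin 𝕜 k δ (of δ (PBDiagram.one k)) = LinearMap.id := by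
      refine lin_ext fun d => ?_
      rw [← mul_def, of_mul_of, (PBDiagram.one_comp_loops d).1, (PBDiagram.one_comp_loops d).2,
        pow_zero, one_smul, LinearMap.id_apply]
    exact LinearMap.congr_fun this x
  mul_one x := by
    have : (mulBilin 𝕜 k δ).flip (of δ (PBDiagram.one k)) = LinearMap.id := by
      refine lin_ext fun d => ?_
      rw [LinearMap.flip_apply, ← mul_def, of_mul_of, (PBDiagram.comp_one_loops d).1,
        (PBDiagram.comp_one_loops d).2, pow_zero, one_smul, LinearMap.id_apply]
    exact LinearMap.congr_fun this x
  mul_assoc := mul_assoc_aux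

noncomputable instance : Algebra 𝕜 (PBAlgebra 𝕜 k δ) :=
  Algebra.ofModule
    (fun r x y => by rw [mul_def, map_smul, LinearMap.smul_apply]; rfl)
    (fun r x y => map_smul (mulBilin 𝕜 k δ x) r y)

end PBAlgebra

/-! ### Combinatorics of diagrams -/

namespace PBDiagram

variable {k : ℕ}

/-- The blocks of a diagram. -/
def blocks (d : PBDiagram k) : Finset (Finset (Fin k ⊕ Fin k)) :=
  Finset.univ.image fun x => {x, d.mate x}

/-- The edges of a diagram. -/
def edges (d : PBDiagram k) : Finset (Finset (Fin k ⊕ Fin k)) :=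
  d.blocks.filter fun b => b.card = 2

/-- The cups: edges with both endpoints in the top row. -/
def cups (d : PBDiagram k) : Finset (Finset (Fin k ⊕ Fin k)) :=
  d.edges.filter fun b => ∀ x ∈ b, x.isLeft

/-- The caps: edges with both endpoints in the bottom row. -/
def caps (d : PBDiagram k) : Finset (Finset (Fin k ⊕ Fin k)) :=
  d.edges.filter fun b => ∀ x ∈ b, x.isRight

/-- `d' ≤ d`: each block of `d'` is contained in some block of `d`. -/
def Refines (d' d : PBDiagram k) : Prop := ∀ b' ∈ d'.blocks, ∃ b ∈ d.blocks, b' ⊆ b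

/-- The position of a vertex on the boundary of the rectangle, read along the top row from left to
right and then along the bottom row from right to left. -/
def pos : Fin k ⊕ Fin k → ℕ
  | .inl i => i
  | .inr i => 2 * k - 1 - i

/-- A diagram is planar if no two of its edges have interlacing endpoints on the boundary of the
rectangle. The planar partial Brauer diagrams are the Motzkin diagrams. -/
def Planar (d : PBDiagram k) : Prop :=
  ∀ x y, ¬ (pos x < pos y ∧ pos y < pos (d.mate x) ∧ pos (d.mate x) < pos (d.mate y))

/-- Balanced Motzkin diagrams: planar, with as many cups as caps. -/
def IsBalancedMotzkin (d : PBDiagram k) : Prop := d.Planar ∧ d.cups.card = d.caps.card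

/-- Temperley-Lieb diagrams: planar, with every block of cardinality two. -/
def IsTemperleyLieb (d : PBDiagram k) : Prop := d.Planar ∧ ∀ x, d.mate x ≠ x

/-- The diagram `p_i`: both vertices in column `i` are isolated, and in each other column the top
vertex is joined to the bottom vertex. -/
def p (i : Fin k) : PBDiagram k where
  mate x := if x = .inl i ∨ x = .inr i then x else x.swap
  invol x := by
    by_cases h : x = .inl i ∨ x = .inr i
    · simp [h]
    · have h' : ¬ (x.swap = .inl i ∨ x.swap = .inr i) := by
        rcases x with j | j <;> simpa using h
      simp [h, h']

/-- The indices of the endpoints of the cups. -/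
def topH (d : PBDiagram k) : Finset (Fin k) :=
  Finset.univ.filter fun i => ∃ b ∈ d.cups, .inl i ∈ b

/-- The indices of the endpoints of the caps. -/
def botH (d : PBDiagram k) : Finset (Fin k) :=
  Finset.univ.filter fun i => ∃ b ∈ d.caps, .inr i ∈ b

end PBDiagram

/-! ### Alternating bases and subalgebras -/

namespace PBAlgebra

variable {𝕜 : Type*} [CommRing 𝕜] {k : ℕ}

open Classical in
/-- The bar element `∑_{d' ≤ d} (-1)^(β(d) - β(d')) d'`, where `β` is the number of blocks (the sign
is written with the exponent `β(d) + β(d')`, of the same parity). -/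
noncomputable def bar (δ : 𝕜) (d : PBDiagram k) : PBAlgebra 𝕜 k δ :=
  ∑ d' : PBDiagram k with d'.Refines d, (-1 : 𝕜) ^ (d.blocks.card + d'.blocks.card) • of δ d'

/-- The product of the commuting elements `1 - p_i` for `i ∈ A`. -/
noncomputable def cutProd (δ : 𝕜) (A : Finset (Fin k)) : PBAlgebra 𝕜 k δ :=
  ((A.sort).map fun i => 1 - of δ (PBDiagram.p i)).prod

/-- The tilde element `∏_i (1 - p_i) · d · ∏_j (1 - p_j)`, where `i` runs over the endpoints of the
cups of `d` and `j` over the endpoints of its caps. -/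
noncomputable def tilde (δ : 𝕜) (d : PBDiagram k) : PBAlgebra 𝕜 k δ :=
  cutProd δ d.topH * of δ d * cutProd δ d.botH

end PBAlgebra

/-- The Temperley-Lieb algebra `TL_n(δ)`: the subalgebra generated by the Temperley-Lieb diagrams.
(No paths are ever discarded in products of such diagrams.) -/
noncomputable def TemperleyLieb (𝕜 : Type*) [CommRing 𝕜] (n : ℕ) (δ : 𝕜) :
    Subalgebra 𝕜 (PBAlgebra 𝕜 n δ) :=
  Algebra.adjoin 𝕜 {x | ∃ d : PBDiagram n, d.IsTemperleyLieb ∧ x = PBAlgebra.of δ d}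

/-- The partial Temperley-Lieb algebra `PTL_k(δ)`: the subalgebra generated by the tilde elements of
the balanced Motzkin `k`-diagrams. -/
noncomputable def PartialTL (𝕜 : Type*) [CommRing 𝕜] (k : ℕ) (δ : 𝕜) :
    Subalgebra 𝕜 (PBAlgebra 𝕜 k δ) :=
  Algebra.adjoin 𝕜 {x | ∃ d : PBDiagram k, d.IsBalancedMotzkin ∧ x = PBAlgebra.tilde δ d}

/-- `X(n)`: the linear span of the bar elements of the balanced Motzkin `k`-diagrams with exactly
`n` edges. -/
noncomputable def barSpan (𝕜 : Type*) [CommRing 𝕜] (k : ℕ) (δ : 𝕜) (n : ℕ) :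
    Submodule 𝕜 (PBAlgebra 𝕜 k δ) :=
  Submodule.span 𝕜
    {x | ∃ d : PBDiagram k, d.IsBalancedMotzkin ∧ d.edges.card = n ∧ x = PBAlgebra.bar δ d}

/-- `Q_n`: the free module on the set of `n`-element subsets of a `k`-element set. -/
abbrev SubsetModule (𝕜 : Type*) [CommRing 𝕜] (k n : ℕ) : Type _ :=
  {A : Finset (Fin k) // A.card = n} →₀ 𝕜

open scoped TensorProduct

/-- The action of `Mat(𝕜) ⊗ T ≅ End(Q_n) ⊗ T` on `Q_n ⊗ N` for a module `N` over an algebra `T`,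
`(f ⊗ t) (A ⊗ v) = f A ⊗ t v`. Matrices are identified with endomorphisms of `Q_n` by means of its
basis, enumerated by `β`. -/
noncomputable def tensorAction {𝕜 : Type*} [CommRing 𝕜] {k n : ℕ} {ι : Type*} [Fintype ι]
    [DecidableEq ι] (β : {A : Finset (Fin k) // A.card = n} ≃ ι)
    (T : Type*) [Ring T] [Algebra 𝕜 T]
    (N : Type*) [AddCommGroup N] [Module 𝕜 N] [Module T N] [IsScalarTower 𝕜 T N] :
    Matrix ι ι 𝕜 ⊗[𝕜] T →ₐ[𝕜] Module.End 𝕜 (SubsetModule 𝕜 k n ⊗[𝕜] N) :=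
  (Module.endTensorEndAlgHom (R := 𝕜) (S := 𝕜) (A := 𝕜) (M := SubsetModule 𝕜 k n) (N := N)).comp
    (Algebra.TensorProduct.map
      (Matrix.toLinAlgEquiv (Finsupp.basisSingleOne.reindex β)).toAlgHom
      (Algebra.lsmul 𝕜 𝕜 N))

universe u w

/-!
A diagram is cut open by the idempotents `1 - p_i`. Multiplying `d` by `p_i` deletes the edge at the
`i`th vertex of a row, so the products of `d` with factors `1 - p_i` on both sides are the
alternating sums `PBAlgebra.cut δ d V` over deletions of edges of `d` at subsets of `V`. Such a sum
vanishes as soon as `V` contains an isolated vertex of `d`, and depends only on the edges that meet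
`V`. Both kinds of elements in the theorem are of this form: `bar δ d` is the sum with `V` the set of
all non-isolated vertices (`bar_eq_cut`), `tilde δ d` the one with `V` the set of endpoints of cups
and caps (`tilde_eq_cut`). Adding one vertex to `V` at a time shows that they have the same span.

The product rule `bar_mul_bar` is the heart of the matter. If the non-isolated vertices of the two
middle rows differ, some `1 - p_i` kills the product of bar elements. Otherwise the product is an
alternating sum over sets of deleted edges in the middle. A deletion on a path between outer vertices
isolates an outer vertex, so its contribution is killed by the factors `1 - p_i` of the outer rows. The
deletions on a loop contribute `δ` if nothing is deleted, and `-1` in total otherwise. Hence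
`bar d₁ * bar d₂ = (δ - 1) ^ N • bar (d₁ ∘ d₂)`.

A balanced Motzkin diagram with `n` edges has `n` non-isolated vertices in either row. It amounts to two
`n`-element sets of columns and a Temperley-Lieb `n`-diagram (`expand`, `exists_expand_eq`), and
composition restricts to that of the Temperley-Lieb diagrams (`expand_comp_loops`). So the product
rule says that the bar elements multiply like matrix units with entries in `TL_n(δ - 1)`
(`block_mul_block`), and different `n` are orthogonal. They are linearly independent because `bar δ d`
is `d` plus diagrams with fewer edges (`blockCoeff_block`). That the composite of Temperley-Lieb
diagrams is planar (`IsTemperleyLieb.comp`) is seen by counting crossings modulo two.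

Finally the units of all blocks add up to `1` (`sum_block_one`), since the sum acts as the identity on
the span of the bar elements, which contains `1`. Thus `PTL_k(δ)` is the direct sum of the matrix
algebras `X(n)`, and choosing one diagonal block for each `n` exhibits the product of the algebras
`TL_n(δ - 1)` as the corner at a full idempotent, which gives the Morita equivalence
(`isMoritaEquivalent_of_corner`).
-/

namespace PBDiagram

variable {k : ℕ}

/-! ### Non-isolated vertices and deletion of edges -/

/-- The vertices met by an edge of the diagram. -/
def supp (d : PBDiagram k) : Finset (Fin k ⊕ Fin k) :=
  Finset.univ.filter fun x => d.mate x ≠ x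

theorem mem_supp {d : PBDiagram k} {x : Fin k ⊕ Fin k} : x ∈ d.supp ↔ d.mate x ≠ x := by
  simp [supp]

theorem mate_mem_supp {d : PBDiagram k} {x : Fin k ⊕ Fin k} :
    d.mate x ∈ d.supp ↔ x ∈ d.supp := by
  rw [mem_supp, mem_supp, d.invol]
  exact ne_comm

theorem mate_injective (d : PBDiagram k) : Function.Injective d.mate :=
  Function.Involutive.injective d.invol

/-- The diagram obtained by deleting every edge with an endpoint in `U`. -/
def erase (d : PBDiagram k) (U : Finset (Fin k ⊕ Fin k)) : PBDiagram k where
  mate x := if x ∈ U ∨ d.mate x ∈ U then x else d.mate x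
  invol x := by
    by_cases h : x ∈ U ∨ d.mate x ∈ U
    · simp [h]
    · have h' : ¬ (d.mate x ∈ U ∨ d.mate (d.mate x) ∈ U) := by
        rw [d.invol]; tauto
      simp only [if_neg h]
      exact (if_neg h').trans (d.invol x)

theorem erase_mate (d : PBDiagram k) (U : Finset (Fin k ⊕ Fin k)) (x : Fin k ⊕ Fin k) :
    (d.erase U).mate x = if x ∈ U ∨ d.mate x ∈ U then x else d.mate x := rfl

theorem erase_empty (d : PBDiagram k) : d.erase ∅ = d := by
  ext1; funext x; simp [erase_mate]

theorem erase_erase (d : PBDiagram k) (U V : Finset (Fin k ⊕ Fin k)) :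
    (d.erase U).erase V = d.erase (U ∪ V) := by
  ext1; funext x
  simp only [erase_mate, Finset.mem_union]
  by_cases h : x ∈ U ∨ d.mate x ∈ U
  · have h' : (x ∈ U ∨ x ∈ V) ∨ d.mate x ∈ U ∨ d.mate x ∈ V := by tauto
    simp only [if_pos h, if_pos h', ite_self]
  · have h' : ((x ∈ U ∨ x ∈ V) ∨ d.mate x ∈ U ∨ d.mate x ∈ V) ↔ x ∈ V ∨ d.mate x ∈ V := by tauto
    simp only [if_neg h, h']

theorem erase_singleton_of_mate_eq {d : PBDiagram k} {x : Fin k ⊕ Fin k} (h : d.mate x = x) :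
    d.erase {x} = d := by
  ext1; funext y
  simp only [erase_mate, Finset.mem_singleton]
  split_ifs with hy
  · rcases hy with rfl | hy
    · exact h.symm
    · rw [hy, ← d.invol y, hy, h]
  · rfl

theorem mem_supp_erase {d : PBDiagram k} {U : Finset (Fin k ⊕ Fin k)} {x : Fin k ⊕ Fin k} :
    x ∈ (d.erase U).supp ↔ x ∈ d.supp ∧ x ∉ U ∧ d.mate x ∉ U := by
  rw [mem_supp, mem_supp, erase_mate]
  split_ifs with h
  · simp only [ne_eq, not_true, false_iff]; tauto
  · tauto

theorem erase_mate_self {d : PBDiagram k} {U : Finset (Fin k ⊕ Fin k)} {x : Fin k ⊕ Fin k}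
    (h : x ∈ U ∨ d.mate x ∈ U) : (d.erase U).mate x = x := by
  rw [erase_mate, if_pos h]

theorem erase_mate_of_ne {d : PBDiagram k} {U : Finset (Fin k ⊕ Fin k)} {x : Fin k ⊕ Fin k}
    (h : (d.erase U).mate x ≠ x) : (d.erase U).mate x = d.mate x := by
  rw [erase_mate] at h ⊢
  split_ifs at h ⊢ with h'
  · exact absurd rfl h
  · rfl

theorem valid_erase {d : PBDiagram k} {U : Finset (Fin k ⊕ Fin k)} {c : Fin k ⊕ Fin k → Bool} :
    Valid (d.erase U) c ↔ Valid d c ∧ ∀ x ∈ U, c x = false := by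
  constructor
  · intro h
    have hU : ∀ x, x ∈ U ∨ d.mate x ∈ U → c x = false := fun x hx => (h x).2 (erase_mate_self hx)
    refine ⟨fun x => ?_, fun x hx => hU x (Or.inl hx)⟩
    by_cases hx : x ∈ U ∨ d.mate x ∈ U
    · have h2 : c (d.mate x) = false := hU _ (by rw [d.invol]; tauto)
      rw [hU x hx, h2]; simp
    · have := h x
      rwa [erase_mate, if_neg hx] at this
  · rintro ⟨h, hU⟩ x
    rw [erase_mate]
    split_ifs with hx
    · refine ⟨rfl, fun _ => ?_⟩
      rcases hx with hx | hx
      · exact hU x hx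
      · rw [← (h x).1]; exact hU _ hx
    · exact h x

theorem valid_p {i : Fin k} {c : Fin k ⊕ Fin k → Bool} :
    Valid (p i) c ↔ (∀ j, c (.inl j) = c (.inr j)) ∧ c (.inl i) = false := by
  have hp : p i = (one k).erase {.inl i} := by
    ext1; funext x
    rcases x with j | j <;> simp [p, one, erase_mate]
  rw [hp, valid_erase, valid_one]
  simp

theorem p_comp_loops (i : Fin k) (d : PBDiagram k) :
    loops (p i) d = 0 ∧ comp (p i) d = d.erase {.inl i} := by
  apply eq_of_smul_mat
  rw [← mat_mul, pow_zero, one_smul]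
  classical
  ext t s
  have hf : ∀ t m : Fin k → Bool, (∀ j, t j = m j) ↔ t = m := fun t m => funext_iff.symm
  simp only [Matrix.mul_apply, mat, valid_p, valid_erase, Sum.elim_inl, Sum.elim_inr,
    Finset.mem_singleton, forall_eq, hf, ite_and]
  rw [Finset.sum_eq_single t]
  · simp only [if_true]
    split_ifs <;> rfl
  · intro m _ hm
    rw [if_neg (Ne.symm hm), zero_mul]
  · simp

theorem comp_p_loops (i : Fin k) (d : PBDiagram k) :
    loops d (p i) = 0 ∧ comp d (p i) = d.erase {.inr i} := by
  apply eq_of_smul_mat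
  rw [← mat_mul, pow_zero, one_smul]
  classical
  ext t s
  have hf : ∀ t m : Fin k → Bool, (∀ j, t j = m j) ↔ t = m := fun t m => funext_iff.symm
  simp only [Matrix.mul_apply, mat, valid_p, valid_erase, Sum.elim_inl, Sum.elim_inr,
    Finset.mem_singleton, forall_eq, hf, ite_and]
  rw [Finset.sum_eq_single s]
  · simp only [if_true]
    split_ifs <;> rfl
  · intro m _ hm
    rw [if_neg hm, mul_zero]
  · simp

/-! ### Counting edges -/

/-- A set of non-isolated vertices stable under `mate` has twice as many elements as it spans
edges. -/
theorem card_image_pair (d : PBDiagram k) (W : Finset (Fin k ⊕ Fin k))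
    (hW : ∀ x ∈ W, d.mate x ≠ x ∧ d.mate x ∈ W) :
    2 * (W.image fun x => ({x, d.mate x} : Finset (Fin k ⊕ Fin k))).card = W.card := by
  rw [Finset.card_eq_sum_card_image (fun x => ({x, d.mate x} : Finset (Fin k ⊕ Fin k))) W,
    Finset.sum_const_nat (m := 2), mul_comm]
  intro b hb
  obtain ⟨x, hx, rfl⟩ := Finset.mem_image.1 hb
  have : (W.filter fun y => ({y, d.mate y} : Finset (Fin k ⊕ Fin k)) = {x, d.mate x}) =
      {x, d.mate x} := by
    ext y
    simp only [Finset.mem_filter, Finset.mem_insert, Finset.mem_singleton]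
    constructor
    · rintro ⟨_, h⟩
      have : y ∈ ({y, d.mate y} : Finset (Fin k ⊕ Fin k)) := by simp
      rw [h] at this; simpa using this
    · rintro (rfl | rfl)
      · exact ⟨hx, rfl⟩
      · exact ⟨(hW x hx).2, by rw [d.invol, Finset.pair_comm]⟩
  rw [this, Finset.card_pair (hW x hx).1.symm]

theorem card_pair_mate (d : PBDiagram k) (x : Fin k ⊕ Fin k) :
    ({x, d.mate x} : Finset (Fin k ⊕ Fin k)).card = 2 ↔ d.mate x ≠ x := by
  by_cases h : d.mate x = x
  · simp [h]
  · simp [Finset.card_pair (Ne.symm h), h]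

theorem edges_eq (d : PBDiagram k) :
    d.edges = d.supp.image fun x => ({x, d.mate x} : Finset (Fin k ⊕ Fin k)) := by
  ext b
  simp only [edges, blocks, Finset.mem_filter, Finset.mem_image, Finset.mem_univ, true_and, mem_supp]
  constructor
  · rintro ⟨⟨x, rfl⟩, h⟩
    exact ⟨x, (card_pair_mate d x).1 h, rfl⟩
  · rintro ⟨x, h, rfl⟩
    exact ⟨⟨x, rfl⟩, (card_pair_mate d x).2 h⟩

theorem two_mul_card_edges (d : PBDiagram k) : 2 * d.edges.card = d.supp.card := by
  rw [edges_eq]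
  exact card_image_pair d _ fun x hx => ⟨mem_supp.1 hx, mate_mem_supp.2 hx⟩

theorem cups_eq (d : PBDiagram k) : d.cups =
    (d.supp.filter fun x => x.isLeft ∧ (d.mate x).isLeft).image
      fun x => ({x, d.mate x} : Finset (Fin k ⊕ Fin k)) := by
  ext b
  simp only [cups, edges_eq, Finset.mem_filter, Finset.mem_image]
  constructor
  · rintro ⟨⟨x, hx, rfl⟩, h⟩
    exact ⟨x, ⟨hx, h _ (by simp), h _ (by simp)⟩, rfl⟩
  · rintro ⟨x, ⟨hx, h1, h2⟩, rfl⟩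
    refine ⟨⟨x, hx, rfl⟩, ?_⟩
    simp [h1, h2]

theorem caps_eq (d : PBDiagram k) : d.caps =
    (d.supp.filter fun x => x.isRight ∧ (d.mate x).isRight).image
      fun x => ({x, d.mate x} : Finset (Fin k ⊕ Fin k)) := by
  ext b
  simp only [caps, edges_eq, Finset.mem_filter, Finset.mem_image]
  constructor
  · rintro ⟨⟨x, hx, rfl⟩, h⟩
    exact ⟨x, ⟨hx, h _ (by simp), h _ (by simp)⟩, rfl⟩
  · rintro ⟨x, ⟨hx, h1, h2⟩, rfl⟩
    refine ⟨⟨x, hx, rfl⟩, ?_⟩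
    simp [h1, h2]

/-- The columns of the non-isolated vertices of the top row. -/
def topSupp (d : PBDiagram k) : Finset (Fin k) := Finset.univ.filter fun i => d.mate (.inl i) ≠ .inl i

/-- The columns of the non-isolated vertices of the bottom row. -/
def botSupp (d : PBDiagram k) : Finset (Fin k) := Finset.univ.filter fun i => d.mate (.inr i) ≠ .inr i

theorem mem_topSupp {d : PBDiagram k} {i : Fin k} : i ∈ d.topSupp ↔ .inl i ∈ d.supp := by
  simp [topSupp, mem_supp]

theorem mem_botSupp {d : PBDiagram k} {i : Fin k} : i ∈ d.botSupp ↔ .inr i ∈ d.supp := by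
  simp [botSupp, mem_supp]

theorem disjSum_supp (d : PBDiagram k) : d.topSupp.disjSum d.botSupp = d.supp := by
  ext (i | i)
  · simp [mem_topSupp]
  · simp [mem_botSupp]

theorem card_supp (d : PBDiagram k) : d.supp.card = d.topSupp.card + d.botSupp.card := by
  rw [← disjSum_supp, Finset.card_disjSum]

theorem card_topSupp_add (d : PBDiagram k) :
    d.topSupp.card + 2 * d.caps.card = d.botSupp.card + 2 * d.cups.card := by
  classical
  have h1 : 2 * d.cups.card = (d.supp.filter fun x => x.isLeft ∧ (d.mate x).isLeft).card := by
    rw [cups_eq]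
    refine card_image_pair d _ fun x hx => ?_
    simp only [Finset.mem_filter] at hx ⊢
    exact ⟨mem_supp.1 hx.1, mate_mem_supp.2 hx.1, hx.2.2, by rw [d.invol]; exact hx.2.1⟩
  have h2 : 2 * d.caps.card = (d.supp.filter fun x => x.isRight ∧ (d.mate x).isRight).card := by
    rw [caps_eq]
    refine card_image_pair d _ fun x hx => ?_
    simp only [Finset.mem_filter] at hx ⊢
    exact ⟨mem_supp.1 hx.1, mate_mem_supp.2 hx.1, hx.2.2, by rw [d.invol]; exact hx.2.1⟩
  have h3 : (d.supp.filter fun x => x.isLeft ∧ (d.mate x).isRight).card =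
      (d.supp.filter fun x => x.isRight ∧ (d.mate x).isLeft).card := by
    refine Finset.card_bij (fun x _ => d.mate x) ?_ (fun _ _ _ _ h => d.mate_injective h) ?_
    · intro x hx
      simp only [Finset.mem_filter] at hx ⊢
      exact ⟨mate_mem_supp.2 hx.1, hx.2.2, by rw [d.invol]; exact hx.2.1⟩
    · intro x hx
      simp only [Finset.mem_filter] at hx
      refine ⟨d.mate x, ?_, d.invol x⟩
      simp only [Finset.mem_filter]
      exact ⟨mate_mem_supp.2 hx.1, hx.2.2, by rw [d.invol]; exact hx.2.1⟩
  have h4 : d.topSupp.card = (d.supp.filter fun x => x.isLeft).card := by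
    rw [← Finset.card_map Function.Embedding.inl]
    congr 1
    ext (i | i) <;> simp [mem_topSupp]
  have h5 : d.botSupp.card = (d.supp.filter fun x => x.isRight).card := by
    rw [← Finset.card_map Function.Embedding.inr]
    congr 1
    ext (i | i) <;> simp [mem_botSupp]
  have h6 := Finset.card_filter_add_card_filter_not (s := d.supp.filter fun x => x.isLeft)
    (fun x => (d.mate x).isLeft)
  have h7 := Finset.card_filter_add_card_filter_not (s := d.supp.filter fun x => x.isRight)
    (fun x => (d.mate x).isLeft)
  simp only [Finset.filter_filter, Bool.not_eq_true, Sum.isLeft_eq_false] at h6 h7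
  omega

/-- The balanced Motzkin diagrams with `n` edges are the planar diagrams with `n` non-isolated
vertices in either row. -/
theorem isBalancedMotzkin_and_card_edges {d : PBDiagram k} {n : ℕ} :
    d.IsBalancedMotzkin ∧ d.edges.card = n ↔
      d.Planar ∧ d.topSupp.card = n ∧ d.botSupp.card = n := by
  have h1 := card_topSupp_add d
  have h2 := two_mul_card_edges d
  rw [card_supp] at h2
  constructor
  · rintro ⟨⟨hp, h⟩, hn⟩
    exact ⟨hp, by omega, by omega⟩
  · rintro ⟨hp, h, hn⟩
    exact ⟨⟨hp, by omega⟩, by omega⟩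

theorem isBalancedMotzkin_iff {d : PBDiagram k} :
    d.IsBalancedMotzkin ↔ d.Planar ∧ d.topSupp.card = d.botSupp.card := by
  have h1 := card_topSupp_add d
  exact and_congr_right fun _ => by omega

theorem card_blocks_add (d : PBDiagram k) : d.blocks.card + d.edges.card = 2 * k := by
  classical
  have h1 : d.blocks = d.edges ∪ (d.suppᶜ).image fun x => {x} := by
    ext b
    simp only [edges_eq, blocks, Finset.mem_union, Finset.mem_image, Finset.mem_univ, true_and,
      Finset.mem_compl]
    constructor
    · rintro ⟨x, rfl⟩
      by_cases hx : x ∈ d.supp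
      · exact Or.inl ⟨x, hx, rfl⟩
      · refine Or.inr ⟨x, hx, ?_⟩
        rw [mem_supp, not_not] at hx
        simp [hx]
    · rintro (⟨x, _, rfl⟩ | ⟨x, hx, rfl⟩)
      · exact ⟨x, rfl⟩
      · rw [mem_supp, not_not] at hx
        exact ⟨x, by simp [hx]⟩
  have h2 : Disjoint d.edges ((d.suppᶜ).image fun x => ({x} : Finset (Fin k ⊕ Fin k))) := by
    rw [Finset.disjoint_left]
    intro b hb hb'
    obtain ⟨x, -, rfl⟩ := Finset.mem_image.1 hb'
    have := (Finset.mem_filter.1 hb).2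
    simp at this
  rw [h1, Finset.card_union_of_disjoint h2,
    Finset.card_image_of_injective _ Finset.singleton_injective]
  have h3 := two_mul_card_edges d
  have h4 := Finset.card_add_card_compl d.supp
  simp only [Fintype.card_sum, Fintype.card_fin] at h4
  omega

theorem planar_erase {d : PBDiagram k} (hd : d.Planar) (U : Finset (Fin k ⊕ Fin k)) :
    (d.erase U).Planar := by
  rintro x y ⟨h1, h2, h3⟩
  have hx : (d.erase U).mate x ≠ x := by
    intro h; rw [h] at h2; omega
  have hy : (d.erase U).mate y ≠ y := by
    intro h; rw [h] at h3; omega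
  rw [erase_mate_of_ne hx] at h2 h3
  rw [erase_mate_of_ne hy] at h3
  exact hd x y ⟨h1, h2, h3⟩

end PBDiagram

namespace PBDiagram

variable {k : ℕ}

theorem pos_injective : Function.Injective (pos (k := k)) := by
  rintro (i | i) (j | j) h <;> simp only [pos] at h
  · exact congrArg _ (Fin.ext h)
  · omega
  · omega
  · exact congrArg _ (Fin.ext (by omega))

theorem refines_iff {d' d : PBDiagram k} :
    d'.Refines d ↔ ∀ x, d'.mate x = x ∨ d'.mate x = d.mate x := by
  constructor
  · intro h x
    obtain ⟨b, hb, hs⟩ := h {x, d'.mate x} (Finset.mem_image_of_mem _ (Finset.mem_univ x))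
    obtain ⟨y, -, rfl⟩ := Finset.mem_image.1 hb
    have h1 := hs (Finset.mem_insert_self _ _)
    have h2 := hs (Finset.mem_insert_of_mem (Finset.mem_singleton_self _))
    simp only [Finset.mem_insert, Finset.mem_singleton] at h1 h2
    rcases h1 with h1 | h1 <;> rcases h2 with h2 | h2
    · exact Or.inl (h2.trans h1.symm)
    · right; rw [h2, h1]
    · right; rw [h2, h1, d.invol]
    · exact Or.inl (h2.trans h1.symm)
  · intro h b' hb'
    obtain ⟨x, -, rfl⟩ := Finset.mem_image.1 hb'
    refine ⟨{x, d.mate x}, Finset.mem_image_of_mem _ (Finset.mem_univ x), ?_⟩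
    intro y hy
    simp only [Finset.mem_insert, Finset.mem_singleton] at hy ⊢
    rcases hy with hy | hy
    · exact Or.inl hy
    · rcases h x with h | h
      · left; rw [hy, h]
      · right; rw [hy, h]

/-- The endpoint of each edge that comes first on the boundary of the rectangle: a set of
representatives for the edges. -/
def firstEnds (d : PBDiagram k) : Finset (Fin k ⊕ Fin k) :=
  Finset.univ.filter fun x => pos x < pos (d.mate x)

theorem mem_firstEnds {d : PBDiagram k} {x : Fin k ⊕ Fin k} :
    x ∈ d.firstEnds ↔ pos x < pos (d.mate x) := by simp [firstEnds]

theorem mate_ne_of_mem_firstEnds {d : PBDiagram k} {x : Fin k ⊕ Fin k} (h : x ∈ d.firstEnds) :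
    d.mate x ≠ x := by
  intro h'
  rw [mem_firstEnds, h'] at h
  exact lt_irrefl _ h

theorem mate_notMem_firstEnds {d : PBDiagram k} {x : Fin k ⊕ Fin k} (h : x ∈ d.firstEnds) :
    d.mate x ∉ d.firstEnds := by
  rw [mem_firstEnds] at h ⊢
  rw [d.invol]; omega

theorem mem_firstEnds_or {d : PBDiagram k} {x : Fin k ⊕ Fin k} (h : d.mate x ≠ x) :
    x ∈ d.firstEnds ∨ d.mate x ∈ d.firstEnds := by
  rw [mem_firstEnds, mem_firstEnds, d.invol]
  have := pos_injective.ne h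
  omega

theorem card_blocks_erase {d : PBDiagram k} {U : Finset (Fin k ⊕ Fin k)} (hU : U ⊆ d.firstEnds) :
    (d.erase U).blocks.card = d.blocks.card + U.card := by
  have h1 : d.supp = (d.erase U).supp ∪ (U ∪ U.image d.mate) := by
    ext x
    simp only [Finset.mem_union, mem_supp_erase, Finset.mem_image]
    constructor
    · intro hx
      by_cases h : x ∈ U
      · exact Or.inr (Or.inl h)
      · by_cases h' : d.mate x ∈ U
        · exact Or.inr (Or.inr ⟨_, h', d.invol x⟩)
        · exact Or.inl ⟨hx, h, h'⟩
    · rintro (h | h | ⟨y, hy, rfl⟩)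
      · exact h.1
      · exact mem_supp.2 (mate_ne_of_mem_firstEnds (hU h))
      · exact mate_mem_supp.2 (mem_supp.2 (mate_ne_of_mem_firstEnds (hU hy)))
  have h2 : Disjoint U (U.image d.mate) := by
    rw [Finset.disjoint_left]
    intro x hx hx'
    obtain ⟨y, hy, rfl⟩ := Finset.mem_image.1 hx'
    exact mate_notMem_firstEnds (hU hy) (hU hx)
  have h3 : Disjoint (d.erase U).supp (U ∪ U.image d.mate) := by
    rw [Finset.disjoint_left]
    intro x hx hx'
    rw [mem_supp_erase] at hx
    rcases Finset.mem_union.1 hx' with h | h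
    · exact hx.2.1 h
    · obtain ⟨y, hy, rfl⟩ := Finset.mem_image.1 h
      rw [d.invol] at hx
      exact hx.2.2 hy
  have h4 := congrArg Finset.card h1
  rw [Finset.card_union_of_disjoint h3, Finset.card_union_of_disjoint h2,
    Finset.card_image_of_injective _ d.mate_injective] at h4
  have h5 := card_blocks_add d
  have h6 := card_blocks_add (d.erase U)
  have h7 := two_mul_card_edges d
  have h8 := two_mul_card_edges (d.erase U)
  omega

theorem mem_topH {d : PBDiagram k} {i : Fin k} :
    i ∈ d.topH ↔ .inl i ∈ d.supp ∧ (d.mate (.inl i)).isLeft := by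
  simp only [topH, Finset.mem_filter, Finset.mem_univ, true_and, cups_eq, Finset.mem_image]
  constructor
  · rintro ⟨b, ⟨x, ⟨hx, h1, h2⟩, rfl⟩, hi⟩
    simp only [Finset.mem_insert, Finset.mem_singleton] at hi
    rcases hi with rfl | hi
    · exact ⟨hx, h2⟩
    · rw [hi, d.invol]
      exact ⟨mate_mem_supp.2 hx, h1⟩
  · rintro ⟨h, h'⟩
    exact ⟨_, ⟨.inl i, ⟨h, rfl, h'⟩, rfl⟩, by simp⟩

theorem mem_botH {d : PBDiagram k} {i : Fin k} :
    i ∈ d.botH ↔ .inr i ∈ d.supp ∧ (d.mate (.inr i)).isRight := by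
  simp only [botH, Finset.mem_filter, Finset.mem_univ, true_and, caps_eq, Finset.mem_image]
  constructor
  · rintro ⟨b, ⟨x, ⟨hx, h1, h2⟩, rfl⟩, hi⟩
    simp only [Finset.mem_insert, Finset.mem_singleton] at hi
    rcases hi with rfl | hi
    · exact ⟨hx, h2⟩
    · rw [hi, d.invol]
      exact ⟨mate_mem_supp.2 hx, h1⟩
  · rintro ⟨h, h'⟩
    exact ⟨_, ⟨.inr i, ⟨h, rfl, h'⟩, rfl⟩, by simp⟩

theorem mem_disjSum_topH_botH {d : PBDiagram k} {x : Fin k ⊕ Fin k} :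
    x ∈ d.topH.disjSum d.botH ↔ x ∈ d.supp ∧ (d.mate x).isLeft = x.isLeft := by
  rcases x with i | i
  · simp [mem_topH]
  · simp [mem_botH, Sum.isLeft_eq_false]

end PBDiagram

/-! ### Cutting edges -/

namespace PBAlgebra

open PBDiagram

variable {𝕜 : Type*} [CommRing 𝕜] {k : ℕ} (δ : 𝕜)

/-- The alternating sum, over the subsets `U` of `V`, of the diagrams obtained from `d` by deleting
the edges that meet `U`. It is the result of multiplying `d` by a factor `1 - p_i` for each vertex
of `V`. -/
noncomputable def cut (d : PBDiagram k) (V : Finset (Fin k ⊕ Fin k)) : PBAlgebra 𝕜 k δ :=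
  ∑ U ∈ V.powerset, (-1 : 𝕜) ^ U.card • of δ (d.erase U)

theorem cut_empty (d : PBDiagram k) : cut δ d ∅ = of δ d := by
  simp [cut, erase_empty]

theorem cut_insert (d : PBDiagram k) {x : Fin k ⊕ Fin k} {V : Finset (Fin k ⊕ Fin k)}
    (hx : x ∉ V) : cut δ d (insert x V) = cut δ d V - cut δ (d.erase {x}) V := by
  rw [cut, Finset.sum_powerset_insert hx, sub_eq_add_neg, cut, cut, ← Finset.sum_neg_distrib]
  congr 1
  refine Finset.sum_congr rfl fun U hU => ?_
  have hxU : x ∉ U := fun h => hx (Finset.mem_powerset.1 hU h)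
  rw [Finset.card_insert_of_notMem hxU, pow_succ, mul_neg_one, neg_smul, erase_erase]
  rfl

theorem cut_eq_zero {d : PBDiagram k} {x : Fin k ⊕ Fin k} {V : Finset (Fin k ⊕ Fin k)}
    (hx : x ∈ V) (h : d.mate x = x) : cut δ d V = 0 := by
  rw [← Finset.insert_erase hx, cut_insert _ _ (Finset.notMem_erase x V),
    erase_singleton_of_mate_eq h, sub_self]

theorem cut_insert_mate {d : PBDiagram k} {x : Fin k ⊕ Fin k} {V : Finset (Fin k ⊕ Fin k)}
    (hx : x ∈ V) : cut δ d (insert (d.mate x) V) = cut δ d V := by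
  by_cases h : d.mate x ∈ V
  · rw [Finset.insert_eq_of_mem h]
  · rw [cut_insert _ _ h, cut_eq_zero δ (d := d.erase _) hx, sub_zero]
    exact erase_mate_self (Or.inr (Finset.mem_singleton_self _))

theorem cut_union_image_mate (d : PBDiagram k) {W V : Finset (Fin k ⊕ Fin k)} (h : W ⊆ V) :
    cut δ d (V ∪ W.image d.mate) = cut δ d V := by
  classical
  induction W using Finset.induction_on with
  | empty => simp
  | insert a W _ ih =>
    rw [Finset.image_insert, Finset.union_insert, cut_insert_mate, ih]
    · exact fun x hx => h (Finset.mem_insert_of_mem hx)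
    · exact Finset.mem_union_left _ (h (Finset.mem_insert_self _ _))

/-- Only the edges that meet `V` matter to `cut δ d V`. -/
theorem cut_congr {d : PBDiagram k} {V V' : Finset (Fin k ⊕ Fin k)}
    (h : ∀ x ∈ V, x ∈ V' ∨ d.mate x ∈ V') (h' : ∀ x ∈ V', x ∈ V ∨ d.mate x ∈ V) :
    cut δ d V = cut δ d V' := by
  have key : ∀ (V : Finset (Fin k ⊕ Fin k)) x, x ∈ V ∪ V.image d.mate ↔ x ∈ V ∨ d.mate x ∈ V := by
    intro V x
    rw [Finset.mem_union, Finset.mem_image]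
    refine or_congr_right ⟨?_, fun hx => ⟨_, hx, d.invol x⟩⟩
    rintro ⟨y, hy, rfl⟩
    rwa [d.invol]
  rw [← cut_union_image_mate δ d (subset_refl V), ← cut_union_image_mate δ d (subset_refl V')]
  congr 1
  ext x
  rw [key, key]
  constructor
  · rintro (hx | hx)
    · exact h x hx
    · have := h _ hx
      rw [d.invol] at this; exact this.symm
  · rintro (hx | hx)
    · exact h' x hx
    · have := h' _ hx
      rw [d.invol] at this; exact this.symm

theorem bar_eq_cut_firstEnds (d : PBDiagram k) : bar δ d = cut δ d d.firstEnds := by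
  classical
  rw [bar, cut]
  symm
  refine Finset.sum_bij' (fun U _ => d.erase U)
    (fun d' _ => d.firstEnds.filter fun x => d'.mate x = x) ?_ ?_ ?_ ?_ ?_
  · intro U _
    rw [Finset.mem_filter, refines_iff]
    refine ⟨Finset.mem_univ _, fun x => ?_⟩
    rw [erase_mate]
    split_ifs
    · exact Or.inl rfl
    · exact Or.inr rfl
  · intro d' _
    exact Finset.mem_powerset.2 (Finset.filter_subset _ _)
  · intro U hU
    have hU := Finset.mem_powerset.1 hU
    ext x
    rw [Finset.mem_filter, erase_mate]
    constructor
    · rintro ⟨hx, h⟩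
      split_ifs at h with h'
      · exact h'.resolve_right fun h' => mate_notMem_firstEnds hx (hU h')
      · exact absurd h (mate_ne_of_mem_firstEnds hx)
    · intro hx
      exact ⟨hU hx, if_pos (Or.inl hx)⟩
  · intro d' hd'
    have hd' := refines_iff.1 (Finset.mem_filter.1 hd').2
    ext1; funext x
    rw [erase_mate]
    simp only [Finset.mem_filter]
    have hmate : d.mate x ≠ x → d'.mate x = x → d'.mate (d.mate x) = d.mate x := by
      intro hx h
      refine (hd' (d.mate x)).resolve_right fun h' => hx ?_
      rw [d.invol] at h'
      rw [← d'.invol (d.mate x), h', h]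
    split_ifs with h
    · rcases h with h | h
      · exact h.2.symm
      · rcases hd' x with h' | h'
        · exact h'.symm
        · calc x = d'.mate (d'.mate x) := (d'.invol x).symm
            _ = d'.mate (d.mate x) := by rw [h']
            _ = d.mate x := h.2
            _ = d'.mate x := h'.symm
    · rcases hd' x with h' | h'
      · by_cases hx : d.mate x = x
        · rw [hx, h']
        · rcases mem_firstEnds_or hx with h1 | h1
          · exact absurd (Or.inl ⟨h1, h'⟩) h
          · exact absurd (Or.inr ⟨h1, hmate hx h'⟩) h
      · exact h'.symm
  · intro U hU
    rw [card_blocks_erase (Finset.mem_powerset.1 hU), ← add_assoc, ← two_mul, pow_add, pow_mul]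
    simp

theorem bar_eq_cut (d : PBDiagram k) : bar δ d = cut δ d d.supp := by
  rw [bar_eq_cut_firstEnds]
  refine cut_congr δ (fun x hx => Or.inl (mem_supp.2 (mate_ne_of_mem_firstEnds hx)))
    fun x hx => mem_firstEnds_or (mem_supp.1 hx)

/-! ### Multiplication by the elements `1 - p_i` -/

theorem p_mul_of (i : Fin k) (d : PBDiagram k) : of δ (p i) * of δ d = of δ (d.erase {.inl i}) := by
  rw [of_mul_of, (p_comp_loops i d).1, (p_comp_loops i d).2, pow_zero, one_smul]

theorem of_mul_p (i : Fin k) (d : PBDiagram k) : of δ d * of δ (p i) = of δ (d.erase {.inr i}) := by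
  rw [of_mul_of, (comp_p_loops i d).1, (comp_p_loops i d).2, pow_zero, one_smul]

theorem p_mul_cut (i : Fin k) (d : PBDiagram k) (V : Finset (Fin k ⊕ Fin k)) :
    of δ (p i) * cut δ d V = cut δ (d.erase {.inl i}) V := by
  rw [cut, cut, Finset.mul_sum]
  refine Finset.sum_congr rfl fun U _ => ?_
  rw [mul_smul_comm, p_mul_of, erase_erase, erase_erase, Finset.union_comm]

theorem cut_mul_p (i : Fin k) (d : PBDiagram k) (V : Finset (Fin k ⊕ Fin k)) :
    cut δ d V * of δ (p i) = cut δ (d.erase {.inr i}) V := by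
  rw [cut, cut, Finset.sum_mul]
  refine Finset.sum_congr rfl fun U _ => ?_
  rw [smul_mul_assoc, of_mul_p, erase_erase, erase_erase, Finset.union_comm]

theorem one_sub_p_mul_cut (i : Fin k) (d : PBDiagram k) (V : Finset (Fin k ⊕ Fin k)) :
    (1 - of δ (p i)) * cut δ d V = cut δ d (insert (.inl i) V) := by
  rw [sub_mul, one_mul, p_mul_cut]
  by_cases h : .inl i ∈ V
  · rw [Finset.insert_eq_of_mem h, cut_eq_zero δ (d := d.erase _) h, sub_zero]
    exact erase_mate_self (Or.inl (Finset.mem_singleton_self _))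
  · rw [cut_insert δ d h]

theorem cut_mul_one_sub_p (i : Fin k) (d : PBDiagram k) (V : Finset (Fin k ⊕ Fin k)) :
    cut δ d V * (1 - of δ (p i)) = cut δ d (insert (.inr i) V) := by
  rw [mul_sub, mul_one, cut_mul_p]
  by_cases h : .inr i ∈ V
  · rw [Finset.insert_eq_of_mem h, cut_eq_zero δ (d := d.erase _) h, sub_zero]
    exact erase_mate_self (Or.inl (Finset.mem_singleton_self _))
  · rw [cut_insert δ d h]

theorem cutProd_mul_cut (A : Finset (Fin k)) (d : PBDiagram k) (V : Finset (Fin k ⊕ Fin k)) :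
    cutProd δ A * cut δ d V = cut δ d (A.disjSum ∅ ∪ V) := by
  have key : ∀ l : List (Fin k), (l.map fun i => 1 - of δ (p i)).prod * cut δ d V =
      cut δ d (l.toFinset.disjSum ∅ ∪ V) := by
    intro l
    induction l with
    | nil => simp
    | cons a l ih =>
      rw [List.map_cons, List.prod_cons, mul_assoc, ih, one_sub_p_mul_cut]
      congr 1
      ext (i | i) <;> simp
  rw [cutProd, key, Finset.sort_toFinset]

theorem cut_mul_cutProd (A : Finset (Fin k)) (d : PBDiagram k) (V : Finset (Fin k ⊕ Fin k)) :
    cut δ d V * cutProd δ A = cut δ d (Finset.disjSum ∅ A ∪ V) := by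
  have key : ∀ (l : List (Fin k)) (V : Finset (Fin k ⊕ Fin k)),
      cut δ d V * (l.map fun i => 1 - of δ (p i)).prod =
      cut δ d (Finset.disjSum ∅ l.toFinset ∪ V) := by
    intro l
    induction l with
    | nil => simp
    | cons a l ih =>
      intro V
      rw [List.map_cons, List.prod_cons, ← mul_assoc, cut_mul_one_sub_p, ih]
      congr 1
      ext (i | i) <;> simp
  rw [cutProd, key, Finset.sort_toFinset]

theorem cutProd_mul_cut_mul_cutProd (A B : Finset (Fin k)) (d : PBDiagram k)
    (V : Finset (Fin k ⊕ Fin k)) :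
    cutProd δ A * cut δ d V * cutProd δ B = cut δ d (A.disjSum B ∪ V) := by
  rw [cutProd_mul_cut, cut_mul_cutProd]
  congr 1
  ext (i | i) <;> simp

theorem cutProd_mul_of_mul_cutProd (A B : Finset (Fin k)) (d : PBDiagram k) :
    cutProd δ A * of δ d * cutProd δ B = cut δ d (A.disjSum B) := by
  rw [← cut_empty, cutProd_mul_cut_mul_cutProd, Finset.union_empty]

theorem tilde_eq_cut (d : PBDiagram k) : tilde δ d = cut δ d (d.topH.disjSum d.botH) :=
  cutProd_mul_of_mul_cutProd δ _ _ d

theorem bar_eq_mul (d : PBDiagram k) :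
    bar δ d = cutProd δ d.topSupp * of δ d * cutProd δ d.botSupp := by
  rw [cutProd_mul_of_mul_cutProd, disjSum_supp, bar_eq_cut]

end PBAlgebra

namespace PBDiagram

variable {k : ℕ}

/-! ### Deleting edges in a composite configuration -/

theorem conn_upperMate (d₁ d₂ : PBDiagram k) (v : CVertex k) : conn d₁ d₂ v (upperMate d₁ v) :=
  Relation.EqvGen.rel _ _ (Or.inl rfl)

theorem conn_lowerMate (d₁ d₂ : PBDiagram k) (v : CVertex k) : conn d₁ d₂ v (lowerMate d₂ v) :=
  Relation.EqvGen.rel _ _ (Or.inr rfl)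

/-- A property of vertices that is invariant under both involutions is constant on components. -/
theorem conn_induction {d₁ d₂ : PBDiagram k} {P : CVertex k → Prop}
    (hu : ∀ v, P v → P (upperMate d₁ v)) (hl : ∀ v, P v → P (lowerMate d₂ v)) {v w : CVertex k}
    (h : conn d₁ d₂ v w) : P v ↔ P w := by
  induction h with
  | rel u v h =>
    rcases h with rfl | rfl
    · exact ⟨hu u, fun h => upperMate_invol d₁ u ▸ hu _ h⟩
    · exact ⟨hl u, fun h => lowerMate_invol d₂ u ▸ hl _ h⟩
  | refl => exact Iff.rfl
  | symm _ _ _ ih => exact ih.symm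
  | trans _ _ _ _ _ ih1 ih2 => exact ih1.trans ih2

theorem eq_of_conn_of_fixed {d₁ d₂ : PBDiagram k} {v w : CVertex k} (hu : upperMate d₁ v = v)
    (hl : lowerMate d₂ v = v) (h : conn d₁ d₂ v w) : w = v :=
  (conn_induction (P := fun w => w = v) (by rintro _ rfl; exact hu) (by rintro _ rfl; exact hl)
    h).1 rfl

theorem lower_injective : Function.Injective (lower (k := k)) := by
  rintro (i | i) (j | j) h <;> simp_all [lower]

theorem upper_injective : Function.Injective (upper (k := k)) := by
  rintro (i | i) (j | j) h <;> simp_all [upper]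

theorem lowerMate_lower (d : PBDiagram k) (x : Fin k ⊕ Fin k) :
    lowerMate d (lower x) = lower (d.mate x) := by
  rcases x with i | i <;> rfl

theorem upperMate_upper (d : PBDiagram k) (x : Fin k ⊕ Fin k) :
    upperMate d (upper x) = upper (d.mate x) := by
  rcases x with i | i <;> rfl

theorem lowerMate_lower_eq_iff {d : PBDiagram k} {x : Fin k ⊕ Fin k} :
    lowerMate d (lower x) = lower x ↔ x ∉ d.supp := by
  rw [lowerMate_lower, lower_injective.eq_iff, mem_supp, not_not]

theorem upperMate_upper_eq_iff {d : PBDiagram k} {x : Fin k ⊕ Fin k} :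
    upperMate d (upper x) = upper x ↔ x ∉ d.supp := by
  rw [upperMate_upper, upper_injective.eq_iff, mem_supp, not_not]

theorem lowerMate_middle_eq_iff {d : PBDiagram k} {i : Fin k} :
    lowerMate d (.inr i) = .inr i ↔ i ∉ d.topSupp := by
  rw [mem_topSupp]; exact lowerMate_lower_eq_iff (x := .inl i)

theorem upperMate_middle_eq_iff {d : PBDiagram k} {i : Fin k} :
    upperMate d (.inr i) = .inr i ↔ i ∉ d.botSupp := by
  rw [mem_botSupp]; exact upperMate_upper_eq_iff (x := .inr i)

theorem lowerMate_erase (d : PBDiagram k) (U : Finset (Fin k ⊕ Fin k)) (v : CVertex k) :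
    lowerMate (d.erase U) v = lowerMate d v ∨ lowerMate (d.erase U) v = v := by
  have key : ∀ x, lowerMate (d.erase U) (lower x) = lowerMate d (lower x) ∨
      lowerMate (d.erase U) (lower x) = lower x := by
    intro x
    rw [lowerMate_lower, lowerMate_lower, erase_mate]
    split_ifs
    · exact Or.inr rfl
    · exact Or.inl rfl
  rcases v with (i | i) | i
  · exact Or.inl rfl
  · exact key (.inr i)
  · exact key (.inl i)

theorem exists_of_lowerMate_erase_ne {d₁ d₂ : PBDiagram k} {U : Finset (Fin k ⊕ Fin k)}
    {v : CVertex k} (h : lowerMate (d₂.erase U) v ≠ lowerMate d₂ v) :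
    ∃ x ∈ U, conn d₁ d₂ v (lower x) := by
  have key : ∀ x, lowerMate (d₂.erase U) (lower x) ≠ lowerMate d₂ (lower x) →
      ∃ y ∈ U, conn d₁ d₂ (lower x) (lower y) := by
    intro x h
    rw [lowerMate_lower, lowerMate_lower, erase_mate] at h
    split_ifs at h with hx
    · rcases hx with hx | hx
      · exact ⟨x, hx, Setoid.refl' _ _⟩
      · refine ⟨_, hx, ?_⟩
        rw [← lowerMate_lower]
        exact conn_lowerMate _ _ _
    · exact absurd rfl h
  rcases v with (i | i) | i
  · exact absurd rfl h
  · exact key (.inr i) h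
  · exact key (.inl i) h

theorem lowerMate_erase_of_mem {d : PBDiagram k} {U : Finset (Fin k ⊕ Fin k)} {x : Fin k ⊕ Fin k}
    (h : x ∈ U) : lowerMate (d.erase U) (lower x) = lower x := by
  rw [lowerMate_lower, erase_mate_self (Or.inl h)]

theorem conn_of_conn_erase {d₁ d₂ : PBDiagram k} {U : Finset (Fin k ⊕ Fin k)} {v w : CVertex k}
    (h : conn d₁ (d₂.erase U) v w) : conn d₁ d₂ v w := by
  refine (conn_induction (P := fun w => conn d₁ d₂ v w) ?_ ?_ h).1 (Setoid.refl' _ _)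
  · exact fun w hw => Setoid.trans' _ hw (conn_upperMate _ _ _)
  · intro w hw
    rcases lowerMate_erase d₂ U w with h | h
    · rw [h]; exact Setoid.trans' _ hw (conn_lowerMate _ _ _)
    · rwa [h]

/-- A component that survives a deletion of edges without losing an edge is not cut. -/
theorem conn_erase_of_conn {d₁ d₂ : PBDiagram k} {U : Finset (Fin k ⊕ Fin k)} {v w : CVertex k}
    (hv : ∀ w, conn d₁ (d₂.erase U) v w → lowerMate (d₂.erase U) w = lowerMate d₂ w)
    (h : conn d₁ d₂ v w) : conn d₁ (d₂.erase U) v w := by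
  refine (conn_induction (P := fun w => conn d₁ (d₂.erase U) v w) ?_ ?_ h).1 (Setoid.refl' _ _)
  · exact fun w hw => Setoid.trans' _ hw (conn_upperMate _ _ _)
  · intro w hw
    rw [← hv w hw]; exact Setoid.trans' _ hw (conn_lowerMate _ _ _)

/-- A composite is determined by the connections between its outer vertices. -/
theorem comp_congr {d₁ d₂ e₁ e₂ : PBDiagram k}
    (h : ∀ x y, conn d₁ d₂ (.inl x) (.inl y) ↔ conn e₁ e₂ (.inl x) (.inl y)) :
    comp d₁ d₂ = comp e₁ e₂ := by
  ext1; funext x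
  by_cases hx : (comp d₁ d₂).mate x = x
  · by_contra hne
    rw [hx] at hne
    exact hne (hx.symm.trans (comp_mate_of_conn d₁ d₂ (Ne.symm hne)
      ((h _ _).2 (comp_conn e₁ e₂ x))))
  · exact (comp_mate_of_conn e₁ e₂ hx ((h _ _).1 (comp_conn d₁ d₂ x))).symm

/-- If the components of all vertices of `U` are loops, deleting the edges at `U` does not change
the composite. -/
theorem comp_erase_of_isLoop {d₁ d₂ : PBDiagram k} {U : Finset (Fin k ⊕ Fin k)}
    (hU : ∀ x ∈ U, IsLoop d₁ d₂ (Quotient.mk _ (lower x))) :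
    comp d₁ (d₂.erase U) = comp d₁ d₂ := by
  refine comp_congr fun x y => ⟨conn_of_conn_erase, conn_erase_of_conn fun w hw => ?_⟩
  by_contra hne
  obtain ⟨z, hz, hwz⟩ := exists_of_lowerMate_erase_ne (d₁ := d₁) hne
  have : Quotient.mk (conn d₁ d₂) (.inl x) = Quotient.mk _ (lower z) :=
    Quotient.sound (Setoid.trans' _ (conn_of_conn_erase hw) hwz)
  exact not_isLoop_outer d₁ d₂ x (this ▸ hU z hz)

theorem side_not_outSide_eq_iff {d₁ d₂ : PBDiagram k} {x : Fin k ⊕ Fin k} :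
    side d₁ d₂ (!outSide x) (.inl x) = .inl x ↔ x ∉ d₁.topSupp.disjSum d₂.botSupp := by
  rcases x with i | i
  · simp only [outSide, Bool.not_false, Finset.inl_mem_disjSum, mem_topSupp]
    exact upperMate_upper_eq_iff (x := .inl i)
  · simp only [outSide, Bool.not_true, Finset.inr_mem_disjSum, mem_botSupp]
    exact lowerMate_lower_eq_iff (x := .inr i)

theorem eq_of_conn_of_notMem {d₁ d₂ : PBDiagram k} {x : Fin k ⊕ Fin k} {w : CVertex k}
    (hx : x ∉ d₁.topSupp.disjSum d₂.botSupp) (h : conn d₁ d₂ (.inl x) w) : w = .inl x := by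
  have h1 := side_not_outSide_eq_iff.2 hx
  have h2 := side_outer d₁ d₂ x
  rcases x with i | i
  · exact eq_of_conn_of_fixed h1 h2 h
  · exact eq_of_conn_of_fixed h2 h1 h

theorem eq_of_conn_of_side_middle {d₁ d₂ : PBDiagram k} (hB : d₁.botSupp = d₂.topSupp) {i : Fin k}
    {b : Bool} (hb : side d₁ d₂ b (.inr i) = .inr i) {w : CVertex k} (h : conn d₁ d₂ (.inr i) w) :
    w = .inr i := by
  have key : i ∉ d₂.topSupp := by
    cases b
    · exact lowerMate_middle_eq_iff.1 hb
    · rw [← hB]; exact upperMate_middle_eq_iff.1 hb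
  exact eq_of_conn_of_fixed (upperMate_middle_eq_iff.2 (hB ▸ key)) (lowerMate_middle_eq_iff.2 key) h

/-- When the middle rows match, a middle vertex met by edges lies on a loop or is connected to a
non-isolated outer vertex. -/
theorem exists_outer_of_not_isLoop {d₁ d₂ : PBDiagram k} (hB : d₁.botSupp = d₂.topSupp) {i : Fin k}
    (hi : i ∈ d₂.topSupp) (h : ¬ IsLoop d₁ d₂ (Quotient.mk _ (.inr i))) :
    ∃ x ∈ d₁.topSupp.disjSum d₂.botSupp, conn d₁ d₂ (.inl x) (.inr i) := by
  unfold IsLoop at h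
  push Not at h
  obtain ⟨v, hv, hv'⟩ := h
  have hv := Quotient.exact hv
  have hb : ∃ b, side d₁ d₂ b v = v := by
    by_cases h1 : upperMate d₁ v = v
    · exact ⟨true, h1⟩
    · exact ⟨false, hv' h1⟩
  obtain ⟨b, hb⟩ := hb
  rcases v with x | j
  · refine ⟨x, ?_, hv⟩
    by_contra hx
    exact absurd (eq_of_conn_of_notMem hx hv) Sum.inr_ne_inl
  · have := eq_of_conn_of_side_middle hB hb hv
    obtain rfl : i = j := Sum.inr_injective this
    cases b
    · exact absurd hi (lowerMate_middle_eq_iff.1 hb)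
    · exact absurd (hB ▸ hi) (upperMate_middle_eq_iff.1 hb)

theorem supp_comp {d₁ d₂ : PBDiagram k} (hB : d₁.botSupp = d₂.topSupp) :
    (comp d₁ d₂).supp = d₁.topSupp.disjSum d₂.botSupp := by
  ext x
  rw [mem_supp]
  constructor
  · intro h
    by_contra hx
    exact h (Sum.inl_injective (eq_of_conn_of_notMem hx (comp_conn d₁ d₂ x)))
  · intro hx
    obtain ⟨⟨v, b⟩, hne, hfix, hconn, -⟩ := ends d₁ d₂ (.inl x) _ (side_outer d₁ d₂ x)
    rcases v with y | j
    · by_cases hyx : y = x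
      · subst hyx
        have : b = !outSide y := by
          have : b ≠ outSide y := fun h => hne (by rw [h])
          revert this; cases b <;> cases outSide y <;> simp
        subst this
        exact absurd hx (side_not_outSide_eq_iff.1 hfix)
      · rw [comp_mate_of_conn d₁ d₂ hyx hconn]; exact hyx
    · exact absurd (eq_of_conn_of_side_middle hB hfix (Setoid.symm' _ hconn)) Sum.inl_ne_inr

/-- Deleting an edge on the path from an outer vertex isolates that vertex in the composite. -/
theorem comp_erase_mate_of_conn {d₁ d₂ : PBDiagram k} {U : Finset (Fin k ⊕ Fin k)} {i : Fin k}
    (hi : .inl i ∈ U) {x : Fin k ⊕ Fin k} (hx : conn d₁ d₂ (.inl x) (.inr i)) :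
    (comp d₁ (d₂.erase U)).mate x = x := by
  by_contra hne
  obtain ⟨e, -, -, -, he⟩ := ends d₁ (d₂.erase U) (.inl x) _ (side_outer _ _ x)
  have h1 := he _ _ (comp_conn d₁ (d₂.erase U) x) (side_outer _ _ _)
  rw [Prod.mk.injEq, Sum.inl.injEq] at h1
  have h1 := h1.resolve_left fun h => hne h.1
  have hends : ∀ v b, conn d₁ (d₂.erase U) (.inl x) v → side d₁ (d₂.erase U) b v = v →
      ∃ y, v = .inl y ∧ b = outSide y := by
    intro v b hv hb
    rcases he v b hv hb with h | h
    · exact ⟨x, (Prod.mk.inj h).1, (Prod.mk.inj h).2⟩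
    · rw [← h1] at h
      exact ⟨_, (Prod.mk.inj h).1, (Prod.mk.inj h).2⟩
  have hconn : conn d₁ (d₂.erase U) (.inl x) (.inr i) := by
    refine conn_erase_of_conn (fun v hv => ?_) hx
    rcases lowerMate_erase d₂ U v with h | h
    · exact h
    · obtain ⟨y, rfl, hy⟩ := hends v false hv h
      rcases y with j | j
      · rfl
      · cases hy
  obtain ⟨y, hy, -⟩ := hends _ false hconn (lowerMate_erase_of_mem (x := .inl i) hi)
  cases hy

open Classical in
/-- The loops that remain after deleting edges are the loops that did not lose an edge. -/
theorem loops_erase {d₁ d₂ : PBDiagram k} (U : Finset (Fin k ⊕ Fin k)) :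
    loops d₁ (d₂.erase U) =
      (((d₂.topSupp.disjSum ∅).filter fun x => IsLoop d₁ d₂ (Quotient.mk _ (lower x))).image
        (fun x => Quotient.mk (conn d₁ d₂) (lower x)) \
          U.image fun x => Quotient.mk (conn d₁ d₂) (lower x)).card := by
  have hmem : ∀ q : Quotient (conn d₁ d₂),
      q ∈ (((d₂.topSupp.disjSum ∅).filter fun x =>
        IsLoop d₁ d₂ (Quotient.mk _ (lower x))).image
          (fun x => Quotient.mk (conn d₁ d₂) (lower x)) \
            U.image fun x => Quotient.mk (conn d₁ d₂) (lower x)) ↔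
      IsLoop d₁ d₂ q ∧ ∀ x ∈ U, Quotient.mk (conn d₁ d₂) (lower x) ≠ q := by
    intro q
    simp only [Finset.mem_sdiff, Finset.mem_image, not_exists, not_and, Finset.mem_filter]
    refine and_congr_left fun _ => ?_
    constructor
    · rintro ⟨x, ⟨-, hx⟩, rfl⟩; exact hx
    · intro hq
      induction q using Quotient.inductionOn with
      | h v =>
        rcases v with x | i
        · exact absurd hq (not_isLoop_outer d₁ d₂ x)
        · refine ⟨.inl i, ⟨?_, hq⟩, rfl⟩
          rw [Finset.inl_mem_disjSum]
          by_contra hi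
          exact (hq _ rfl).2 (lowerMate_middle_eq_iff.2 hi)
  rw [loops, ← Fintype.card_coe, ← Nat.card_eq_fintype_card]
  have hloop : ∀ v w, IsLoop d₁ (d₂.erase U) (Quotient.mk _ v) → conn d₁ (d₂.erase U) v w →
      lowerMate (d₂.erase U) w = lowerMate d₂ w := fun v w h hw =>
    (lowerMate_erase d₂ U w).resolve_right (h w (Quotient.sound (Setoid.symm' _ hw))).2
  have hmap : ∀ v, IsLoop d₁ (d₂.erase U) (Quotient.mk _ v) →
      IsLoop d₁ d₂ (Quotient.mk _ v) ∧ ∀ x ∈ U, Quotient.mk (conn d₁ d₂) (lower x) ≠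
        Quotient.mk _ v := by
    intro v hv
    have hconn : ∀ w, conn d₁ d₂ v w → conn d₁ (d₂.erase U) v w := fun w =>
      conn_erase_of_conn fun w => hloop v w hv
    constructor
    · intro w hw
      have hw := hconn w (Setoid.symm' _ (Quotient.exact hw))
      rw [← hloop v w hv hw]
      exact hv w (Quotient.sound (Setoid.symm' _ hw))
    · intro x hx hq
      have hw := hconn _ (Setoid.symm' _ (Quotient.exact hq))
      exact (hv _ (Quotient.sound (Setoid.symm' _ hw))).2 (lowerMate_erase_of_mem hx)
  refine Nat.card_congr (Equiv.ofBijective (fun c => ⟨Quotient.map' id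
    (fun _ _ h => conn_of_conn_erase h) c.1, ?_⟩) ⟨?_, ?_⟩)
  · rw [hmem]
    obtain ⟨c, hc⟩ := c
    induction c using Quotient.inductionOn with
    | h v => exact hmap v hc
  · rintro ⟨c, hc⟩ ⟨c', hc'⟩ h
    induction c using Quotient.inductionOn with
    | h v =>
      induction c' using Quotient.inductionOn with
      | h v' =>
        have h := Quotient.exact (congrArg Subtype.val h)
        exact Subtype.ext (Quotient.sound (conn_erase_of_conn (fun w => hloop v w hc) h))
  · rintro ⟨q, hq⟩
    rw [hmem] at hq
    induction q using Quotient.inductionOn with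
    | h v =>
      have hkeep : ∀ w, conn d₁ d₂ v w → lowerMate (d₂.erase U) w = lowerMate d₂ w := by
        intro w hw
        by_contra hne
        obtain ⟨x, hx, hwx⟩ := exists_of_lowerMate_erase_ne (d₁ := d₁) hne
        exact hq.2 x hx (Quotient.sound (Setoid.symm' _ (Setoid.trans' _ hw hwx)))
      refine ⟨⟨Quotient.mk _ v, fun w hw => ?_⟩, rfl⟩
      have hw := conn_of_conn_erase (Quotient.exact hw)
      rw [hkeep w (Setoid.symm' _ hw)]
      exact hq.1 w (Quotient.sound hw)

end PBDiagram

/-! ### Products of bar elements -/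

/-- An alternating sum over subsets `U` of `W`, with a factor `δ` for each fibre of `f` that misses
`U`: each fibre contributes `δ + ∑_{∅ ≠ U} (-1)^|U| = δ - 1`. -/
theorem sum_powerset_neg_one_pow_mul_pow {𝕜 α β : Type*} [CommRing 𝕜] [DecidableEq α]
    [DecidableEq β] (δ : 𝕜) (f : α → β) (W : Finset α) :
    ∑ U ∈ W.powerset, (-1 : 𝕜) ^ U.card * δ ^ (W.image f \ U.image f).card =
      (δ - 1) ^ (W.image f).card := by
  have h1 : ∀ U ∈ W.powerset, (-1 : 𝕜) ^ U.card * δ ^ (W.image f \ U.image f).card =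
      ∑ T ∈ (W.image f).powerset, (δ - 1) ^ T.card *
        if U ⊆ W.filter fun x => f x ∉ T then (-1 : 𝕜) ^ U.card else 0 := by
    intro U hU
    have h2 : δ ^ (W.image f \ U.image f).card =
        ∏ b ∈ W.image f, ((if b ∉ U.image f then δ - 1 else 0) + 1) := by
      rw [Finset.sdiff_eq_filter, ← Finset.prod_const, Finset.prod_filter]
      refine Finset.prod_congr rfl fun b _ => ?_
      split_ifs <;> ring
    rw [h2, Finset.prod_add_one, Finset.mul_sum]
    refine Finset.sum_congr rfl fun T _ => ?_
    rw [Finset.prod_ite_zero, Finset.prod_const]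
    have h3 : (∀ b ∈ T, b ∉ U.image f) ↔ U ⊆ W.filter fun x => f x ∉ T := by
      have hU := Finset.mem_powerset.1 hU
      constructor
      · intro h x hx
        exact Finset.mem_filter.2 ⟨hU hx, fun hT => h _ hT (Finset.mem_image_of_mem f hx)⟩
      · intro h b hb hbU
        obtain ⟨x, hx, rfl⟩ := Finset.mem_image.1 hbU
        exact (Finset.mem_filter.1 (h hx)).2 hb
    simp only [h3]
    split_ifs <;> ring
  rw [Finset.sum_congr rfl h1, Finset.sum_comm, Finset.sum_eq_single (W.image f)]
  · rw [← Finset.mul_sum, Finset.sum_eq_single ∅]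
    · simp
    · intro U hU hne
      rw [if_neg]
      intro h
      obtain ⟨x, hx⟩ := Finset.nonempty_iff_ne_empty.2 hne
      exact (Finset.mem_filter.1 (h hx)).2
        (Finset.mem_image_of_mem f (Finset.mem_filter.1 (h hx)).1)
    · simp
  · intro T hT hne
    rw [← Finset.mul_sum, ← Finset.sum_filter]
    have h4 : (W.powerset.filter fun U => U ⊆ W.filter fun x => f x ∉ T) =
        (W.filter fun x => f x ∉ T).powerset := by
      ext U
      simp only [Finset.mem_filter, Finset.mem_powerset]
      exact ⟨fun h => h.2, fun h => ⟨h.trans (Finset.filter_subset _ _), h⟩⟩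
    have h5 : (W.filter fun x => f x ∉ T) ≠ ∅ := by
      intro h
      refine hne (Finset.Subset.antisymm (Finset.mem_powerset.1 hT) fun b hb => ?_)
      obtain ⟨x, hx, rfl⟩ := Finset.mem_image.1 hb
      by_contra hT
      have : x ∈ W.filter fun x => f x ∉ T := Finset.mem_filter.2 ⟨hx, hT⟩
      simp [h] at this
    have h6 := Finset.sum_powerset_neg_one_pow_card (x := W.filter fun x => f x ∉ T)
    rw [if_neg h5] at h6
    rw [h4]
    have h7 := congrArg (Int.cast : ℤ → 𝕜) h6
    push_cast at h7
    rw [h7, mul_zero]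
  · simp

namespace PBAlgebra

open PBDiagram

variable {𝕜 : Type*} [CommRing 𝕜] {k : ℕ} (δ : 𝕜)

theorem one_sub_p_mul_bar {d : PBDiagram k} {i : Fin k} (hi : i ∈ d.topSupp) :
    (1 - of δ (p i)) * bar δ d = bar δ d := by
  rw [bar_eq_cut, one_sub_p_mul_cut, Finset.insert_eq_of_mem (mem_topSupp.1 hi)]

theorem bar_mul_one_sub_p {d : PBDiagram k} {i : Fin k} (hi : i ∈ d.botSupp) :
    bar δ d * (1 - of δ (p i)) = bar δ d := by
  rw [bar_eq_cut, cut_mul_one_sub_p, Finset.insert_eq_of_mem (mem_botSupp.1 hi)]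

theorem one_sub_p_mul_bar_eq_zero {d : PBDiagram k} {i : Fin k} (hi : i ∉ d.topSupp) :
    (1 - of δ (p i)) * bar δ d = 0 := by
  rw [mem_topSupp, mem_supp, not_not] at hi
  rw [bar_eq_cut, one_sub_p_mul_cut, cut_eq_zero δ (Finset.mem_insert_self _ _) hi]

theorem bar_mul_one_sub_p_eq_zero {d : PBDiagram k} {i : Fin k} (hi : i ∉ d.botSupp) :
    bar δ d * (1 - of δ (p i)) = 0 := by
  rw [mem_botSupp, mem_supp, not_not] at hi
  rw [bar_eq_cut, cut_mul_one_sub_p, cut_eq_zero δ (Finset.mem_insert_self _ _) hi]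

theorem bar_mul_bar_of_ne {d₁ d₂ : PBDiagram k} (h : d₁.botSupp ≠ d₂.topSupp) :
    bar δ d₁ * bar δ d₂ = 0 := by
  by_cases h1 : d₁.botSupp ⊆ d₂.topSupp
  · have h2 : ¬ d₂.topSupp ⊆ d₁.botSupp := fun h2 => h (Finset.Subset.antisymm h1 h2)
    obtain ⟨i, hi, hi'⟩ := Finset.not_subset.1 h2
    rw [← one_sub_p_mul_bar δ hi, ← mul_assoc, bar_mul_one_sub_p_eq_zero δ hi', zero_mul]
  · obtain ⟨i, hi, hi'⟩ := Finset.not_subset.1 h1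
    rw [← bar_mul_one_sub_p δ hi, mul_assoc, one_sub_p_mul_bar_eq_zero δ hi', mul_zero]

/-- The product of two bar elements whose middle rows match: a sum over sets of deleted edges, in
which only the deletions of edges of loops contribute. -/
theorem bar_mul_bar {d₁ d₂ : PBDiagram k} (hB : d₁.botSupp = d₂.topSupp) :
    bar δ d₁ * bar δ d₂ = (δ - 1) ^ loops d₁ d₂ • bar δ (comp d₁ d₂) := by
  classical
  have h1 : cutProd δ d₁.botSupp * bar δ d₂ = bar δ d₂ := by
    rw [bar_eq_cut, cutProd_mul_cut, hB, ← disjSum_supp]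
    congr 1
    ext (i | i) <;> simp
  have h2 : cutProd δ d₂.topSupp * of δ d₂ = cut δ d₂ (d₂.topSupp.disjSum ∅) := by
    rw [← cut_empty, cutProd_mul_cut, Finset.union_empty]
  have h3 : bar δ d₁ * bar δ d₂ =
      cutProd δ d₁.topSupp * (of δ d₁ * cut δ d₂ (d₂.topSupp.disjSum ∅)) *
        cutProd δ d₂.botSupp := by
    rw [bar_eq_mul δ d₁, mul_assoc, h1, bar_eq_mul δ d₂, h2]
    simp only [mul_assoc]
  rw [h3, cut, Finset.mul_sum, Finset.mul_sum, Finset.sum_mul]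
  set V : Finset (Fin k ⊕ Fin k) := d₂.topSupp.disjSum ∅ with hV
  set f : Fin k ⊕ Fin k → Quotient (conn d₁ d₂) := fun x => Quotient.mk _ (lower x) with hf
  set W := V.filter fun x => IsLoop d₁ d₂ (f x) with hW
  have h4 : ∀ U ∈ V.powerset, cutProd δ d₁.topSupp *
      (of δ d₁ * (-1 : 𝕜) ^ U.card • of δ (d₂.erase U)) * cutProd δ d₂.botSupp =
      if U ⊆ W then ((-1 : 𝕜) ^ U.card * δ ^ (W.image f \ U.image f).card) • bar δ (comp d₁ d₂)
      else 0 := by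
    intro U hU
    have hU := Finset.mem_powerset.1 hU
    rw [mul_smul_comm, mul_smul_comm, smul_mul_assoc, of_mul_of, mul_smul_comm, smul_mul_assoc,
      cutProd_mul_of_mul_cutProd, smul_smul, loops_erase]
    split_ifs with hUW
    · rw [comp_erase_of_isLoop fun x hx => (Finset.mem_filter.1 (hUW hx)).2, bar_eq_cut,
        supp_comp hB]
    · obtain ⟨x, hx, hxW⟩ := Finset.not_subset.1 hUW
      have hxV := hU hx
      have hxL : ¬ IsLoop d₁ d₂ (f x) := fun h => hxW (Finset.mem_filter.2 ⟨hxV, h⟩)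
      rcases x with i | i
      · obtain ⟨y, hy, hconn⟩ := exists_outer_of_not_isLoop hB (by simpa [hV] using hxV) hxL
        rw [cut_eq_zero δ hy (comp_erase_mate_of_conn hx hconn), smul_zero]
      · simp [hV] at hxV
  rw [Finset.sum_congr rfl h4, ← Finset.sum_filter, ← Finset.sum_smul]
  have h5 : V.powerset.filter (fun U => U ⊆ W) = W.powerset := by
    ext U
    simp only [Finset.mem_filter, Finset.mem_powerset]
    exact ⟨fun h => h.2, fun h => ⟨h.trans (Finset.filter_subset _ _), h⟩⟩
  rw [h5, sum_powerset_neg_one_pow_mul_pow]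
  have h6 := loops_erase (d₁ := d₁) (d₂ := d₂) ∅
  rw [erase_empty, Finset.image_empty, Finset.sdiff_empty] at h6
  rw [h6]

end PBAlgebra

namespace PBDiagram

variable {k n : ℕ}

/-! ### Planarity of composites -/

/-- Two disjoint unions of edges of a planar diagram cross an even number of times; modulo two the
number of crossings depends only on the endpoints. -/
theorem Planar.sum_eq_zero {d : PBDiagram k} (hd : d.Planar) {P Q : Finset (Fin k ⊕ Fin k)}
    (hP : ∀ u ∈ P, d.mate u ≠ u ∧ d.mate u ∈ P) (hQ : ∀ u ∈ Q, d.mate u ≠ u ∧ d.mate u ∈ Q)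
    (hPQ : Disjoint P Q) :
    ∑ u ∈ P, ∑ v ∈ Q, (if pos u < pos v then 1 else 0 : ZMod 2) = 0 := by
  refine Finset.sum_involution (fun u _ => d.mate u) (fun u hu => ?_)
    (fun u hu _ => (hP u hu).1) (fun u hu => (hP u hu).2) (fun u _ => d.invol u)
  rw [← Finset.sum_add_distrib]
  refine Finset.sum_involution (fun u _ => d.mate u) (fun v hv => ?_)
    (fun u hu _ => (hQ u hu).1) (fun u hu => (hQ u hu).2) (fun u _ => d.invol u)
  have hne : ∀ u ∈ P, ∀ v ∈ Q, pos u ≠ pos v := fun u hu v hv h =>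
    Finset.disjoint_left.1 hPQ hu (pos_injective h ▸ hv)
  have hu' := (hP u hu).2
  have hv' := (hQ v hv).2
  have n1 := hne _ hu _ hv
  have n2 := hne _ hu _ hv'
  have n3 := hne _ hu' _ hv
  have n4 := hne _ hu' _ hv'
  have p1 := hd u v
  have p2 := hd u (d.mate v)
  have p3 := hd (d.mate u) v
  have p4 := hd (d.mate u) (d.mate v)
  have q1 := hd v u
  have q2 := hd (d.mate v) u
  have q3 := hd v (d.mate u)
  have q4 := hd (d.mate v) (d.mate u)
  simp only [d.invol] at p2 p3 p4 q2 q3 q4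
  generalize pos u = a at *
  generalize pos (d.mate u) = b at *
  generalize pos v = c at *
  generalize pos (d.mate v) = e at *
  split_ifs <;> first | rfl | (exfalso; omega)

theorem sum_disjSum_pos (A B A' B' : Finset (Fin k)) :
    ∑ u ∈ A.disjSum B, ∑ v ∈ A'.disjSum B', (if pos u < pos v then 1 else 0 : ZMod 2) =
      ∑ i ∈ A, ∑ j ∈ A', (if i < j then 1 else 0 : ZMod 2) + A.card * B'.card +
        ∑ i ∈ B, ∑ j ∈ B', (if j < i then 1 else 0 : ZMod 2) := by
  have h1 : ∀ i j : Fin k, (i : ℕ) < 2 * k - 1 - j := fun i j => by omega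
  have h2 : ∀ i j : Fin k, ¬ 2 * k - 1 - (i : ℕ) < j := fun i j => by omega
  have h3 : ∀ i j : Fin k, 2 * k - 1 - (i : ℕ) < 2 * k - 1 - j ↔ j < i := fun i j => by
    rw [Fin.lt_def]; omega
  simp [Finset.sum_disjSum, pos, h1, h2, h3, Finset.sum_add_distrib, add_assoc]

theorem sum_lt_add_sum_gt {m m' : Finset (Fin k)} (h : Disjoint m m') :
    ∑ i ∈ m, ∑ j ∈ m', (if i < j then 1 else 0 : ZMod 2) +
      ∑ i ∈ m, ∑ j ∈ m', (if j < i then 1 else 0 : ZMod 2) = m.card * m'.card := by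
  rw [← Finset.sum_add_distrib, Finset.sum_congr rfl (g := fun _ => (m'.card : ZMod 2))]
  · simp
  · intro i hi
    rw [← Finset.sum_add_distrib, Finset.sum_congr rfl (g := fun _ => (1 : ZMod 2))]
    · simp
    · intro j hj
      have : i ≠ j := fun h' => Finset.disjoint_left.1 h hi (h' ▸ hj)
      rcases lt_or_gt_of_ne this with h | h
      · simp [h, h.le]
      · simp [h, h.le]

theorem IsTemperleyLieb.botSupp {t : PBDiagram n} (ht : t.IsTemperleyLieb) :
    t.botSupp = Finset.univ := by
  ext i; simp [PBDiagram.botSupp, ht.2]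

theorem IsTemperleyLieb.topSupp {t : PBDiagram n} (ht : t.IsTemperleyLieb) :
    t.topSupp = Finset.univ := by
  ext i; simp [PBDiagram.topSupp, ht.2]

open Classical in
/-- The composite of Temperley-Lieb diagrams is a Temperley-Lieb diagram. If two of its edges
crossed, then so would the two paths that give rise to them, an odd number of times; but this number
is the sum of the numbers of crossings in the upper and in the lower diagram. -/
theorem IsTemperleyLieb.comp {d₁ d₂ : PBDiagram n} (h₁ : d₁.IsTemperleyLieb)
    (h₂ : d₂.IsTemperleyLieb) : (PBDiagram.comp d₁ d₂).IsTemperleyLieb := by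
  have hB : d₁.botSupp = d₂.topSupp := by rw [h₁.botSupp, h₂.topSupp]
  have hmate : ∀ x, (PBDiagram.comp d₁ d₂).mate x ≠ x := by
    intro x
    rw [← mem_supp, supp_comp hB, h₁.topSupp, h₂.botSupp]
    rcases x with i | i <;> simp
  refine ⟨?_, hmate⟩
  rintro x y ⟨hxy, hyx, hxy'⟩
  -- the top, middle and bottom vertices of the component of an outer vertex
  let T : Fin n ⊕ Fin n → Finset (Fin n) := fun x =>
    Finset.univ.filter fun i => conn d₁ d₂ (.inl x) (.inl (.inl i))
  let M : Fin n ⊕ Fin n → Finset (Fin n) := fun x =>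
    Finset.univ.filter fun i => conn d₁ d₂ (.inl x) (.inr i)
  let B : Fin n ⊕ Fin n → Finset (Fin n) := fun x =>
    Finset.univ.filter fun i => conn d₁ d₂ (.inl x) (.inl (.inr i))
  have memTM : ∀ x u, u ∈ (T x).disjSum (M x) ↔ conn d₁ d₂ (.inl x) (upper u) := by
    rintro x (i | i) <;> simp [T, M, upper]
  have memMB : ∀ x u, u ∈ (M x).disjSum (B x) ↔ conn d₁ d₂ (.inl x) (lower u) := by
    rintro x (i | i) <;> simp [M, B, lower]
  have memTB : ∀ x u, u ∈ (T x).disjSum (B x) ↔ conn d₁ d₂ (.inl x) (.inl u) := by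
    rintro x (i | i) <;> simp [T, B]
  have closedTM : ∀ x, ∀ u ∈ (T x).disjSum (M x),
      d₁.mate u ≠ u ∧ d₁.mate u ∈ (T x).disjSum (M x) := by
    intro x u hu
    rw [memTM] at hu ⊢
    rw [← upperMate_upper]
    exact ⟨h₁.2 u, Setoid.trans' _ hu (conn_upperMate _ _ _)⟩
  have closedMB : ∀ x, ∀ u ∈ (M x).disjSum (B x),
      d₂.mate u ≠ u ∧ d₂.mate u ∈ (M x).disjSum (B x) := by
    intro x u hu
    rw [memMB] at hu ⊢
    rw [← lowerMate_lower]
    exact ⟨h₂.2 u, Setoid.trans' _ hu (conn_lowerMate _ _ _)⟩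
  have h20 : (2 : ZMod 2) = 0 := rfl
  have evenTM : ∀ x, ((T x).card : ZMod 2) + (M x).card = 0 := by
    intro x
    have := card_image_pair d₁ _ (closedTM x)
    rw [Finset.card_disjSum] at this
    have := congrArg (Nat.cast : ℕ → ZMod 2) this
    push_cast at this
    rw [← this, h20, zero_mul]
  have evenMB : ∀ x, ((M x).card : ZMod 2) + (B x).card = 0 := by
    intro x
    have := card_image_pair d₂ _ (closedMB x)
    rw [Finset.card_disjSum] at this
    have := congrArg (Nat.cast : ℕ → ZMod 2) this
    push_cast at this
    rw [← this, h20, zero_mul]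
  have hnconn : ¬ conn d₁ d₂ (.inl x) (.inl y) := by
    intro h
    have hne : y ≠ x := by rintro rfl; omega
    have := comp_mate_of_conn d₁ d₂ hne h
    rw [this] at hyx; omega
  have hdisj : ∀ v, conn d₁ d₂ (.inl x) v → ¬ conn d₁ d₂ (.inl y) v := fun v h h' =>
    hnconn (Setoid.trans' _ h (Setoid.symm' _ h'))
  have e1 := h₁.1.sum_eq_zero (closedTM x) (closedTM y) (by
    rw [Finset.disjoint_left]; intro u hu; rw [memTM] at hu ⊢; exact hdisj _ hu)
  have e2 := h₂.1.sum_eq_zero (closedMB x) (closedMB y) (by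
    rw [Finset.disjoint_left]; intro u hu; rw [memMB] at hu ⊢; exact hdisj _ hu)
  have e3 := sum_lt_add_sum_gt (m := M x) (m' := M y) (by
    rw [Finset.disjoint_left]; intro u hu
    simp only [M, Finset.mem_filter, Finset.mem_univ, true_and] at hu ⊢; exact hdisj _ hu)
  have e4 := sum_disjSum_pos (T x) (B x) (T y) (B y)
  rw [sum_disjSum_pos] at e1 e2
  have houter : ∀ x, (T x).disjSum (B x) = {x, (PBDiagram.comp d₁ d₂).mate x} := by
    intro x
    ext u
    rw [memTB, Finset.mem_insert, Finset.mem_singleton]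
    constructor
    · intro h
      by_cases hu : u = x
      · exact Or.inl hu
      · exact Or.inr (comp_mate_of_conn d₁ d₂ hu h).symm
    · rintro (rfl | rfl)
      · exact Setoid.refl' _ _
      · exact comp_conn d₁ d₂ x
  have e5 : ∑ u ∈ (T x).disjSum (B x), ∑ v ∈ (T y).disjSum (B y),
      (if pos u < pos v then 1 else 0 : ZMod 2) = 1 := by
    rw [houter, houter, Finset.sum_pair (hmate x).symm, Finset.sum_pair (hmate y).symm,
      Finset.sum_pair (hmate y).symm, if_pos hxy, if_pos (by omega), if_neg (by omega),
      if_pos hxy']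
    rfl
  rw [e4] at e5
  have f1 := evenTM x
  have f2 := evenMB x
  have f3 := evenTM y
  have f4 := evenMB y
  generalize ((T x).card : ZMod 2) = t at *
  generalize ((M x).card : ZMod 2) = m at *
  generalize ((B x).card : ZMod 2) = b at *
  generalize ((T y).card : ZMod 2) = t' at *
  generalize ((M y).card : ZMod 2) = m' at *
  generalize ((B y).card : ZMod 2) = b' at *
  refine one_ne_zero (α := ZMod 2) ?_
  rw [← e5]
  linear_combination e1 + e2 - e3 + (t - m) * f4 - t * m' * h20

end PBDiagram

namespace PBDiagram

variable {k n m : ℕ}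

/-! ### Spreading out a diagram over given columns -/

/-- The places of the vertices of an `n`-diagram when its top row is put on the columns in `A` and its
bottom row on the columns in `B`, in increasing order. -/
def place (A B : {A : Finset (Fin k) // A.card = n}) : Fin n ⊕ Fin n → Fin k ⊕ Fin k :=
  Sum.map (A.1.orderEmbOfFin A.2) (B.1.orderEmbOfFin B.2)

theorem place_injective (A B : {A : Finset (Fin k) // A.card = n}) :
    Function.Injective (place A B) :=
  Sum.map_injective.2 ⟨(A.1.orderEmbOfFin A.2).injective, (B.1.orderEmbOfFin B.2).injective⟩

theorem exists_orderEmbOfFin {A : {A : Finset (Fin k) // A.card = n}} {i : Fin k} :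
    (∃ j, A.1.orderEmbOfFin A.2 j = i) ↔ i ∈ A.1 := by
  rw [← Finset.mem_coe, ← Finset.range_orderEmbOfFin A.1 A.2]
  rfl

theorem exists_place {A B : {A : Finset (Fin k) // A.card = n}} {x : Fin k ⊕ Fin k} :
    (∃ y, place A B y = x) ↔ x ∈ A.1.disjSum B.1 := by
  rcases x with i | i
  · rw [Finset.inl_mem_disjSum, ← exists_orderEmbOfFin]
    simp [place]
  · rw [Finset.inr_mem_disjSum, ← exists_orderEmbOfFin]
    simp [place]

theorem pos_place_lt_iff {A B : {A : Finset (Fin k) // A.card = n}} {x y : Fin n ⊕ Fin n} :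
    pos (place A B x) < pos (place A B y) ↔ pos x < pos y := by
  have hA : ∀ i j, A.1.orderEmbOfFin A.2 i < A.1.orderEmbOfFin A.2 j ↔ i < j :=
    fun i j => (A.1.orderEmbOfFin A.2).lt_iff_lt
  have hB : ∀ i j, B.1.orderEmbOfFin B.2 i < B.1.orderEmbOfFin B.2 j ↔ i < j :=
    fun i j => (B.1.orderEmbOfFin B.2).lt_iff_lt
  rcases x with i | i <;> rcases y with j | j <;> simp only [place, Sum.map_inl, Sum.map_inr, pos]
  · exact hA i j
  · omega
  · omega
  · have := hB j i
    rw [Fin.lt_def, Fin.lt_def] at this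
    omega

open Classical in
/-- The `k`-diagram obtained from an `n`-diagram `t` by putting its top row on the columns in `A` and
its bottom row on the columns in `B`, all other vertices being isolated. -/
noncomputable def expand (A B : {A : Finset (Fin k) // A.card = n}) (t : PBDiagram n) :
    PBDiagram k where
  mate x := if h : ∃ y, place A B y = x then place A B (t.mate h.choose) else x
  invol x := by
    by_cases h : ∃ y, place A B y = x
    · have h' : ∃ y, place A B y = place A B (t.mate h.choose) := ⟨_, rfl⟩
      have h2 : h'.choose = t.mate h.choose := place_injective A B h'.choose_spec
      rw [dif_pos h, dif_pos h', h2, t.invol, h.choose_spec]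
    · simp only [dif_neg h]

theorem expand_mate_place (A B : {A : Finset (Fin k) // A.card = n}) (t : PBDiagram n)
    (y : Fin n ⊕ Fin n) : (expand A B t).mate (place A B y) = place A B (t.mate y) := by
  have h : ∃ z, place A B z = place A B y := ⟨y, rfl⟩
  have h2 : h.choose = y := place_injective A B h.choose_spec
  simp only [expand]
  rw [dif_pos h, h2]

theorem expand_mate_of_notMem {A B : {A : Finset (Fin k) // A.card = n}} (t : PBDiagram n)
    {x : Fin k ⊕ Fin k} (hx : x ∉ A.1.disjSum B.1) : (expand A B t).mate x = x := by
  simp only [expand]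
  rw [dif_neg (mt exists_place.1 hx)]

theorem expand_injective (A B : {A : Finset (Fin k) // A.card = n}) :
    Function.Injective (expand A B) := by
  intro t t' h
  ext1; funext y
  apply place_injective A B
  rw [← expand_mate_place, h, expand_mate_place]

theorem supp_expand {A B : {A : Finset (Fin k) // A.card = n}} {t : PBDiagram n}
    (ht : ∀ y, t.mate y ≠ y) : (expand A B t).supp = A.1.disjSum B.1 := by
  ext x
  rw [mem_supp]
  constructor
  · intro h
    by_contra hx
    exact h (expand_mate_of_notMem t hx)
  · intro hx
    obtain ⟨y, rfl⟩ := exists_place.2 hx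
    rw [expand_mate_place]
    exact (place_injective A B).ne (ht y)

theorem topSupp_expand {A B : {A : Finset (Fin k) // A.card = n}} {t : PBDiagram n}
    (ht : ∀ y, t.mate y ≠ y) : (expand A B t).topSupp = A.1 := by
  ext i; rw [mem_topSupp, supp_expand ht, Finset.inl_mem_disjSum]

theorem botSupp_expand {A B : {A : Finset (Fin k) // A.card = n}} {t : PBDiagram n}
    (ht : ∀ y, t.mate y ≠ y) : (expand A B t).botSupp = B.1 := by
  ext i; rw [mem_botSupp, supp_expand ht, Finset.inr_mem_disjSum]

theorem valid_expand {A B : {A : Finset (Fin k) // A.card = n}} {t : PBDiagram n}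
    {c : Fin k ⊕ Fin k → Bool} :
    Valid (expand A B t) c ↔
      Valid t (fun y => c (place A B y)) ∧ ∀ x ∉ A.1.disjSum B.1, c x = false := by
  constructor
  · refine fun h => ⟨fun y => ?_, fun x hx => (h x).2 (expand_mate_of_notMem t hx)⟩
    have := h (place A B y)
    rwa [expand_mate_place, (place_injective A B).eq_iff] at this
  · rintro ⟨h, h'⟩ x
    by_cases hx : x ∈ A.1.disjSum B.1
    · obtain ⟨y, rfl⟩ := exists_place.2 hx
      rw [expand_mate_place, (place_injective A B).eq_iff]
      exact h y
    · rw [expand_mate_of_notMem t hx]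
      exact ⟨rfl, fun _ => h' x hx⟩

open Classical in
theorem mat_expand (A B : {A : Finset (Fin k) // A.card = n}) (t : PBDiagram n)
    (u v : Fin k → Bool) : mat (expand A B t) u v =
      if ∀ i ∉ A.1, u i = false then
        if ∀ i ∉ B.1, v i = false then
          mat t (fun i => u (A.1.orderEmbOfFin A.2 i)) (fun i => v (B.1.orderEmbOfFin B.2 i))
        else 0
      else 0 := by
  have h1 : (fun y => Sum.elim u v (place A B y)) =
      Sum.elim (fun i => u (A.1.orderEmbOfFin A.2 i)) (fun i => v (B.1.orderEmbOfFin B.2 i)) := by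
    funext y; rcases y with i | i <;> rfl
  have h2 : (∀ x ∉ A.1.disjSum B.1, Sum.elim u v x = false) ↔
      (∀ i ∉ A.1, u i = false) ∧ ∀ i ∉ B.1, v i = false := by
    simp [Sum.forall]
  simp only [mat, valid_expand, h1, h2]
  split_ifs <;> first | rfl | tauto

/-- Spreading out is compatible with composition. -/
theorem expand_comp_loops (A B C : {A : Finset (Fin k) // A.card = n}) (t s : PBDiagram n) :
    loops (expand A B t) (expand B C s) = loops t s ∧
      comp (expand A B t) (expand B C s) = expand A C (comp t s) := by
  classical
  apply eq_of_smul_mat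
  rw [← mat_mul]
  ext u v
  rw [Matrix.smul_apply, mat_expand, Matrix.mul_apply]
  simp only [mat_expand]
  by_cases hu : ∀ i ∉ A.1, u i = false
  swap
  · simp [if_neg hu]
  by_cases hv : ∀ i ∉ C.1, v i = false
  swap
  · simp [if_neg hv]
  simp only [if_pos hu, if_pos hv]
  have h := congrFun (congrFun (mat_mul t s) fun i => u (A.1.orderEmbOfFin A.2 i))
    fun i => v (C.1.orderEmbOfFin C.2 i)
  rw [Matrix.smul_apply] at h
  rw [← h, Matrix.mul_apply]
  simp only [ite_mul, mul_ite, zero_mul, mul_zero]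
  rw [← Finset.sum_filter]
  refine Finset.sum_bij' (fun w _ i => w (B.1.orderEmbOfFin B.2 i))
    (fun w _ => Function.extend (B.1.orderEmbOfFin B.2) w fun _ => false) ?_ ?_ ?_ ?_ ?_
  · simp
  · intro w _
    rw [Finset.mem_filter]
    refine ⟨Finset.mem_univ _, fun i hi => Function.extend_apply' _ _ _ ?_⟩
    rwa [exists_orderEmbOfFin]
  · intro w hw
    funext i
    by_cases hi : i ∈ B.1
    · obtain ⟨j, rfl⟩ := exists_orderEmbOfFin.2 hi
      rw [(B.1.orderEmbOfFin B.2).injective.extend_apply]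
    · rw [Function.extend_apply' _ _ _ (mt exists_orderEmbOfFin.1 hi)]
      exact ((Finset.mem_filter.1 hw).2 i hi).symm
  · intro w _
    funext i
    rw [(B.1.orderEmbOfFin B.2).injective.extend_apply]
  · intro w hw
    exact if_pos (Finset.mem_filter.1 hw).2

theorem IsTemperleyLieb.planar_expand {t : PBDiagram n} (ht : t.IsTemperleyLieb)
    (A B : {A : Finset (Fin k) // A.card = n}) : (expand A B t).Planar := by
  rintro x y ⟨h1, h2, h3⟩
  by_cases hx : x ∈ A.1.disjSum B.1
  · by_cases hy : y ∈ A.1.disjSum B.1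
    · obtain ⟨x, rfl⟩ := exists_place.2 hx
      obtain ⟨y, rfl⟩ := exists_place.2 hy
      rw [expand_mate_place] at h2 h3
      rw [expand_mate_place] at h3
      rw [pos_place_lt_iff] at h1 h2 h3
      exact ht.1 x y ⟨h1, h2, h3⟩
    · rw [expand_mate_of_notMem t hy] at h3; omega
  · rw [expand_mate_of_notMem t hx] at h2; omega

/-- Every balanced Motzkin diagram arises from a Temperley-Lieb diagram by adding isolated
vertices. -/
theorem exists_expand_eq {d : PBDiagram k} (hd : d.Planar)
    (A B : {A : Finset (Fin k) // A.card = n}) (hA : d.topSupp = A.1) (hB : d.botSupp = B.1) :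
    ∃ t : PBDiagram n, t.IsTemperleyLieb ∧ expand A B t = d := by
  have hs : d.supp = A.1.disjSum B.1 := by rw [← disjSum_supp, hA, hB]
  have h : ∀ y, ∃ z, place A B z = d.mate (place A B y) := by
    intro y
    rw [exists_place, ← hs, mate_mem_supp, hs]
    exact exists_place.1 ⟨y, rfl⟩
  choose f hf using h
  refine ⟨⟨f, fun y => place_injective A B (by rw [hf, hf, d.invol])⟩, ⟨?_, ?_⟩, ?_⟩
  · rintro x y ⟨h1, h2, h3⟩
    rw [← pos_place_lt_iff (A := A) (B := B)] at h1 h2 h3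
    refine hd _ _ ⟨h1, ?_, ?_⟩
    · rwa [← hf]
    · rwa [← hf, ← hf]
  · intro y hy
    have : place A B y ∈ d.supp := by rw [hs]; exact exists_place.1 ⟨y, rfl⟩
    rw [mem_supp, ← hf] at this
    exact this (congrArg _ hy)
  · ext1; funext x
    by_cases hx : x ∈ A.1.disjSum B.1
    · obtain ⟨y, rfl⟩ := exists_place.2 hx
      rw [expand_mate_place, ← hf]
    · rw [expand_mate_of_notMem _ hx]
      rw [← hs, mem_supp, not_not] at hx
      exact hx.symm

theorem isTemperleyLieb_one (n : ℕ) : (one n).IsTemperleyLieb := by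
  refine ⟨?_, ?_⟩
  · rintro (i | i) (j | j) ⟨h1, h2, h3⟩ <;>
      simp only [one, pos, Sum.swap_inl, Sum.swap_inr] at h1 h2 h3 <;> omega
  · rintro (i | i) <;> simp [one]

end PBDiagram

/-! ### The spans of the diagram bases -/

theorem toSubmodule_adjoin_eq_span {R A : Type*} [CommSemiring R] [Semiring A] [Algebra R A]
    {s : Set A} (h1 : 1 ∈ Submodule.span R s)
    (hmul : ∀ x ∈ s, ∀ y ∈ s, x * y ∈ Submodule.span R s) :
    Subalgebra.toSubmodule (Algebra.adjoin R s) = Submodule.span R s := by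
  have h : Submodule.span R s * Submodule.span R s ≤ Submodule.span R s := by
    rw [Submodule.span_mul_span, Submodule.span_le]
    rintro _ ⟨x, hx, y, hy, rfl⟩
    exact hmul x hx y hy
  refine le_antisymm ?_ (Submodule.span_le.2 Algebra.subset_adjoin)
  have : Algebra.adjoin R s ≤ (Submodule.span R s).toSubalgebra h1
      fun x y hx hy => h (Submodule.mul_mem_mul hx hy) :=
    Algebra.adjoin_le Submodule.subset_span
  exact this

theorem toSubmodule_temperleyLieb {𝕜 : Type*} [CommRing 𝕜] (n : ℕ) (δ : 𝕜) :
    Subalgebra.toSubmodule (TemperleyLieb 𝕜 n δ) =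
      Submodule.span 𝕜 {x | ∃ d : PBDiagram n, d.IsTemperleyLieb ∧ x = PBAlgebra.of δ d} := by
  refine toSubmodule_adjoin_eq_span
    (Submodule.subset_span ⟨_, PBDiagram.isTemperleyLieb_one n, rfl⟩) ?_
  rintro _ ⟨d, hd, rfl⟩ _ ⟨e, he, rfl⟩
  rw [PBAlgebra.of_mul_of]
  exact Submodule.smul_mem _ _ (Submodule.subset_span ⟨_, hd.comp he, rfl⟩)

namespace PBDiagram

variable {k : ℕ}

theorem two_mul_card_cups (d : PBDiagram k) : 2 * d.cups.card = d.topH.card := by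
  classical
  have h := card_image_pair d (d.supp.filter fun x => x.isLeft ∧ (d.mate x).isLeft) fun x hx => by
    simp only [Finset.mem_filter] at hx ⊢
    exact ⟨mem_supp.1 hx.1, mate_mem_supp.2 hx.1, hx.2.2, by rw [d.invol]; exact hx.2.1⟩
  have h' : (d.supp.filter fun x => x.isLeft ∧ (d.mate x).isLeft) =
      d.topH.map Function.Embedding.inl := by
    ext (i | i) <;> simp [mem_topH]
  rw [cups_eq, h, h', Finset.card_map]

theorem two_mul_card_caps (d : PBDiagram k) : 2 * d.caps.card = d.botH.card := by
  classical
  have h := card_image_pair d (d.supp.filter fun x => x.isRight ∧ (d.mate x).isRight) fun x hx => by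
    simp only [Finset.mem_filter] at hx ⊢
    exact ⟨mem_supp.1 hx.1, mate_mem_supp.2 hx.1, hx.2.2, by rw [d.invol]; exact hx.2.1⟩
  have h' : (d.supp.filter fun x => x.isRight ∧ (d.mate x).isRight) =
      d.botH.map Function.Embedding.inr := by
    ext (i | i) <;> simp [mem_botH]
  rw [caps_eq, h, h', Finset.card_map]

/-- Deleting an edge that is neither a cup nor a cap leaves the endpoints of cups and caps alone. -/
theorem disjSum_topH_botH_erase {d : PBDiagram k} {x : Fin k ⊕ Fin k}
    (hx : x ∉ d.topH.disjSum d.botH) :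
    (d.erase {x}).topH.disjSum (d.erase {x}).botH = d.topH.disjSum d.botH := by
  ext y
  rw [mem_disjSum_topH_botH] at hx ⊢
  rw [mem_disjSum_topH_botH, mem_supp_erase]
  simp only [Finset.mem_singleton]
  constructor
  · rintro ⟨⟨h1, h2, h3⟩, h4⟩
    rw [erase_mate, if_neg (by simp [h2, h3])] at h4
    exact ⟨h1, h4⟩
  · rintro ⟨h1, h2⟩
    have h3 : y ≠ x := by rintro rfl; exact hx ⟨h1, h2⟩
    have h4 : d.mate y ≠ x := by
      rintro rfl
      exact hx ⟨mate_mem_supp.2 h1, by rw [d.invol]; exact h2.symm⟩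
    refine ⟨⟨h1, h3, h4⟩, ?_⟩
    rwa [erase_mate, if_neg (by simp [h3, h4])]

theorem IsBalancedMotzkin.erase {d : PBDiagram k} (hd : d.IsBalancedMotzkin) {x : Fin k ⊕ Fin k}
    (hx : x ∉ d.topH.disjSum d.botH) : (d.erase {x}).IsBalancedMotzkin := by
  refine ⟨planar_erase hd.1 _, ?_⟩
  have h := disjSum_topH_botH_erase hx
  have h1 : (d.erase {x}).topH = d.topH := by
    ext i; simpa using congrArg (fun s => Sum.inl i ∈ s) h
  have h2 : (d.erase {x}).botH = d.botH := by
    ext i; simpa using congrArg (fun s => Sum.inr i ∈ s) h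
  have h3 := hd.2
  have h4 := two_mul_card_cups d
  have h5 := two_mul_card_caps d
  have h6 := two_mul_card_cups (d.erase {x})
  have h7 := two_mul_card_caps (d.erase {x})
  rw [h1] at h6
  rw [h2] at h7
  omega

theorem isBalancedMotzkin_one (k : ℕ) : (one k).IsBalancedMotzkin := by
  have h := isTemperleyLieb_one k
  exact isBalancedMotzkin_iff.2 ⟨h.1, by rw [h.topSupp, h.botSupp]⟩

end PBDiagram

namespace PBAlgebra

open PBDiagram

variable {𝕜 : Type*} [CommRing 𝕜] {k n m : ℕ} (δ : 𝕜)

/-- The elements between `tilde δ d` and `bar δ d` lie in the span of the bar elements. -/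
theorem cut_mem_span_bar (d : PBDiagram k) (V : Finset (Fin k ⊕ Fin k))
    (hd : d.IsBalancedMotzkin) (hV : d.topH.disjSum d.botH ⊆ V) :
    cut δ d V ∈ Submodule.span 𝕜
      {x | ∃ d : PBDiagram k, d.IsBalancedMotzkin ∧ x = bar δ d} := by
  classical
  induction h : (d.supp \ V).card using Nat.strong_induction_on generalizing d V with
  | _ N ih =>
    by_cases hs : d.supp ⊆ V
    · by_cases hs' : V ⊆ d.supp
      · rw [Finset.Subset.antisymm hs' hs, ← bar_eq_cut]
        exact Submodule.subset_span ⟨d, hd, rfl⟩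
      · obtain ⟨x, hx, hx'⟩ := Finset.not_subset.1 hs'
        rw [mem_supp, not_not] at hx'
        rw [cut_eq_zero δ hx hx']
        exact Submodule.zero_mem _
    · obtain ⟨x, hx, hx'⟩ := Finset.not_subset.1 hs
      have hxH : x ∉ d.topH.disjSum d.botH := fun h => hx' (hV h)
      have h1 : cut δ d V = cut δ d (insert x V) + cut δ (d.erase {x}) V := by
        rw [cut_insert δ d hx', sub_add_cancel]
      have hmem : x ∈ d.supp \ V := Finset.mem_sdiff.2 ⟨hx, hx'⟩
      rw [h1]
      refine Submodule.add_mem _ (ih _ ?_ d _ hd (hV.trans (Finset.subset_insert _ _)) rfl)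
        (ih _ ?_ _ _ (hd.erase hxH) (by rwa [disjSum_topH_botH_erase hxH]) rfl)
      · rw [← h]
        refine Finset.card_lt_card (Finset.ssubset_iff_subset_ne.2 ⟨?_, fun h => ?_⟩)
        · exact Finset.sdiff_subset_sdiff (subset_refl _) (Finset.subset_insert _ _)
        · rw [← h] at hmem; simp at hmem
      · rw [← h]
        refine Finset.card_lt_card (Finset.ssubset_iff_subset_ne.2 ⟨?_, fun h => ?_⟩)
        · exact Finset.sdiff_subset_sdiff (fun y hy => (mem_supp_erase.1 hy).1) (subset_refl _)
        · rw [← h, Finset.mem_sdiff, mem_supp_erase] at hmem; simp at hmem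

/-- The elements between `tilde δ d` and `bar δ d` lie in the span of the tilde elements. -/
theorem cut_mem_span_tilde (d : PBDiagram k) (V : Finset (Fin k ⊕ Fin k))
    (hd : d.IsBalancedMotzkin) (hV : d.topH.disjSum d.botH ⊆ V) :
    cut δ d V ∈ Submodule.span 𝕜
      {x | ∃ d : PBDiagram k, d.IsBalancedMotzkin ∧ x = tilde δ d} := by
  classical
  induction h : V.card using Nat.strong_induction_on generalizing d V with
  | _ N ih =>
    by_cases hs : V ⊆ d.topH.disjSum d.botH
    · rw [Finset.Subset.antisymm hs hV, ← tilde_eq_cut]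
      exact Submodule.subset_span ⟨d, hd, rfl⟩
    · obtain ⟨x, hx, hxH⟩ := Finset.not_subset.1 hs
      have hcard : (V.erase x).card < N := by
        rw [← h]; exact Finset.card_erase_lt_of_mem hx
      have hsub : d.topH.disjSum d.botH ⊆ V.erase x := fun y hy =>
        Finset.mem_erase.2 ⟨fun h => hxH (h ▸ hy), hV hy⟩
      rw [← Finset.insert_erase hx, cut_insert δ d (Finset.notMem_erase x V)]
      exact Submodule.sub_mem _ (ih _ hcard d _ hd hsub rfl)
        (ih _ hcard _ _ (hd.erase hxH) (by rwa [disjSum_topH_botH_erase hxH]) rfl)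

theorem span_tilde_eq_span_bar :
    Submodule.span 𝕜 {x | ∃ d : PBDiagram k, d.IsBalancedMotzkin ∧ x = tilde δ d} =
      Submodule.span 𝕜 {x | ∃ d : PBDiagram k, d.IsBalancedMotzkin ∧ x = bar δ d} := by
  apply le_antisymm <;> rw [Submodule.span_le]
  · rintro _ ⟨d, hd, rfl⟩
    rw [tilde_eq_cut]
    exact cut_mem_span_bar δ d _ hd (subset_refl _)
  · rintro _ ⟨d, hd, rfl⟩
    rw [bar_eq_cut]
    exact cut_mem_span_tilde δ d _ hd fun x hx => (mem_disjSum_topH_botH.1 hx).1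

theorem one_mem_span_tilde :
    (1 : PBAlgebra 𝕜 k δ) ∈
      Submodule.span 𝕜 {x | ∃ d : PBDiagram k, d.IsBalancedMotzkin ∧ x = tilde δ d} := by
  refine Submodule.subset_span ⟨one k, isBalancedMotzkin_one k, ?_⟩
  have h : (one k).topH.disjSum (one k).botH = ∅ := by
    ext (i | i)
    · rw [mem_disjSum_topH_botH]; simp [one]
    · rw [mem_disjSum_topH_botH]; simp [one]
  rw [tilde_eq_cut, h, cut_empty]
  rfl

/-! ### The matrix blocks -/

/-- The block of `X(n)` at the `n`-element subsets `A` and `B`: the linear map that sends an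
`n`-diagram `t` to the bar element of `t` spread out over the columns in `A` and `B`. -/
noncomputable def block (A B : {A : Finset (Fin k) // A.card = n}) :
    PBAlgebra 𝕜 n (δ - 1) →ₗ[𝕜] PBAlgebra 𝕜 k δ :=
  lift (δ - 1) fun t => bar δ (expand A B t)

theorem block_of (A B : {A : Finset (Fin k) // A.card = n}) (t : PBDiagram n) :
    block δ A B (of (δ - 1) t) = bar δ (expand A B t) :=
  lift_of _ _

theorem of_mem_temperleyLieb {t : PBDiagram n} (ht : t.IsTemperleyLieb) :
    of δ t ∈ TemperleyLieb 𝕜 n δ :=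
  Algebra.subset_adjoin ⟨t, ht, rfl⟩

theorem temperleyLieb_induction {P : (x : PBAlgebra 𝕜 n δ) → x ∈ TemperleyLieb 𝕜 n δ → Prop}
    (of : ∀ (t : PBDiagram n) (ht : t.IsTemperleyLieb), P (of δ t) (of_mem_temperleyLieb δ ht))
    (zero : P 0 (zero_mem _))
    (add : ∀ x y hx hy, P x hx → P y hy → P (x + y) (add_mem hx hy))
    (smul : ∀ (r : 𝕜) x hx, P x hx → P (r • x) (Subalgebra.smul_mem _ hx r))
    {x : PBAlgebra 𝕜 n δ} (hx : x ∈ TemperleyLieb 𝕜 n δ) : P x hx := by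
  have hx' := hx
  rw [← Subalgebra.mem_toSubmodule, toSubmodule_temperleyLieb] at hx'
  suffices h : ∃ h, P x h from h.2
  clear hx
  induction hx' using Submodule.span_induction with
  | mem x h => obtain ⟨t, ht, rfl⟩ := h; exact ⟨_, of t ht⟩
  | zero => exact ⟨_, zero⟩
  | add x y _ _ hx hy => exact ⟨_, add x y _ _ hx.2 hy.2⟩
  | smul r x _ hx => exact ⟨_, smul r x _ hx.2⟩

theorem block_mul_block (A B C : {A : Finset (Fin k) // A.card = n}) {x y : PBAlgebra 𝕜 n (δ - 1)}
    (hx : x ∈ TemperleyLieb 𝕜 n (δ - 1)) (hy : y ∈ TemperleyLieb 𝕜 n (δ - 1)) :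
    block δ A B x * block δ B C y = block δ A C (x * y) := by
  induction hx using temperleyLieb_induction with
  | of t ht =>
    induction hy using temperleyLieb_induction with
    | of s hs =>
      rw [block_of, block_of, bar_mul_bar δ (by rw [botSupp_expand ht.2, topSupp_expand hs.2]),
        (expand_comp_loops A B C t s).1, (expand_comp_loops A B C t s).2, of_mul_of, map_smul,
        block_of]
    | zero => simp
    | add x y _ _ hx hy => rw [map_add, mul_add, hx, hy, mul_add, map_add]
    | smul r x _ hx => rw [map_smul, mul_smul_comm, hx, mul_smul_comm, map_smul]
  | zero => simp
  | add x y _ _ hx hy => rw [map_add, add_mul, hx, hy, add_mul, map_add]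
  | smul r x _ hx => rw [map_smul, smul_mul_assoc, hx, smul_mul_assoc, map_smul]

theorem block_mul_block_of_ne (A B : {A : Finset (Fin k) // A.card = n})
    (C D : {A : Finset (Fin k) // A.card = m}) (h : B.1 ≠ C.1) {x : PBAlgebra 𝕜 n (δ - 1)}
    {y : PBAlgebra 𝕜 m (δ - 1)} (hx : x ∈ TemperleyLieb 𝕜 n (δ - 1))
    (hy : y ∈ TemperleyLieb 𝕜 m (δ - 1)) : block δ A B x * block δ C D y = 0 := by
  induction hx using temperleyLieb_induction with
  | of t ht =>
    induction hy using temperleyLieb_induction with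
    | of s hs =>
      rw [block_of, block_of, bar_mul_bar_of_ne δ (by rwa [botSupp_expand ht.2, topSupp_expand hs.2])]
    | zero => simp
    | add x y _ _ hx hy => rw [map_add, mul_add, hx, hy, add_zero]
    | smul r x _ hx => rw [map_smul, mul_smul_comm, hx, smul_zero]
  | zero => simp
  | add x y _ _ hx hy => rw [map_add, add_mul, hx, hy, add_zero]
  | smul r x _ hx => rw [map_smul, smul_mul_assoc, hx, smul_zero]

theorem isBalancedMotzkin_expand {t : PBDiagram n} (ht : t.IsTemperleyLieb)
    (A B : {A : Finset (Fin k) // A.card = n}) :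
    (expand A B t).IsBalancedMotzkin ∧ (expand A B t).edges.card = n :=
  isBalancedMotzkin_and_card_edges.2
    ⟨ht.planar_expand A B, by rw [topSupp_expand ht.2, A.2], by rw [botSupp_expand ht.2, B.2]⟩

theorem exists_bar_eq_block {d : PBDiagram k} (hd : d.IsBalancedMotzkin) (hn : d.edges.card = n) :
    ∃ (A B : {A : Finset (Fin k) // A.card = n}) (t : PBDiagram n), t.IsTemperleyLieb ∧
      bar δ d = block δ A B (of (δ - 1) t) := by
  obtain ⟨hp, hA, hB⟩ := isBalancedMotzkin_and_card_edges.1 ⟨hd, hn⟩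
  obtain ⟨t, ht, h⟩ := exists_expand_eq hp ⟨_, hA⟩ ⟨_, hB⟩ rfl rfl
  exact ⟨_, _, t, ht, by rw [block_of, h]⟩

theorem block_mem_barSpan (A B : {A : Finset (Fin k) // A.card = n}) {x : PBAlgebra 𝕜 n (δ - 1)}
    (hx : x ∈ TemperleyLieb 𝕜 n (δ - 1)) : block δ A B x ∈ barSpan 𝕜 k δ n := by
  induction hx using temperleyLieb_induction with
  | of t ht =>
    have := isBalancedMotzkin_expand ht A B
    exact Submodule.subset_span ⟨_, this.1, this.2, block_of δ _ _ t⟩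
  | zero => rw [map_zero]; exact Submodule.zero_mem _
  | add x y _ _ hx hy => rw [map_add]; exact Submodule.add_mem _ hx hy
  | smul r x _ hx => rw [map_smul]; exact Submodule.smul_mem _ _ hx

theorem bar_mul_bar_mem_barSpan {d e : PBDiagram k} (hd : d.IsBalancedMotzkin)
    (he : e.IsBalancedMotzkin) :
    bar δ d * bar δ e ∈ barSpan 𝕜 k δ d.edges.card ∧
      bar δ d * bar δ e ∈ barSpan 𝕜 k δ e.edges.card := by
  by_cases h : d.botSupp = e.topSupp
  · have h1 : e.edges.card = d.edges.card := by
      rw [← (isBalancedMotzkin_and_card_edges.1 ⟨hd, rfl⟩).2.2, h,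
        ← (isBalancedMotzkin_and_card_edges.1 ⟨he, rfl⟩).2.1]
    rw [h1, and_self]
    obtain ⟨A, B, t, ht, h2⟩ := exists_bar_eq_block δ hd rfl
    obtain ⟨B', C, s, hs, h3⟩ := exists_bar_eq_block δ he h1
    rw [h2, h3]
    by_cases hB : B = B'
    · subst hB
      rw [block_mul_block δ _ _ _ (of_mem_temperleyLieb _ ht) (of_mem_temperleyLieb _ hs)]
      exact block_mem_barSpan δ _ _
        (mul_mem (of_mem_temperleyLieb _ ht) (of_mem_temperleyLieb _ hs))
    · rw [block_mul_block_of_ne δ _ _ _ _ (fun h => hB (Subtype.ext h))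
        (of_mem_temperleyLieb _ ht) (of_mem_temperleyLieb _ hs)]
      exact Submodule.zero_mem _
  · rw [bar_mul_bar_of_ne δ h]
    exact ⟨Submodule.zero_mem _, Submodule.zero_mem _⟩

theorem barSpan_le_span_bar (n : ℕ) : barSpan 𝕜 k δ n ≤
    Submodule.span 𝕜 {x | ∃ d : PBDiagram k, d.IsBalancedMotzkin ∧ x = bar δ d} := by
  refine Submodule.span_mono ?_
  rintro _ ⟨d, hd, _, rfl⟩
  exact ⟨d, hd, rfl⟩

theorem toSubmodule_partialTL :
    Subalgebra.toSubmodule (PartialTL 𝕜 k δ) =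
      Submodule.span 𝕜 {x | ∃ d : PBDiagram k, d.IsBalancedMotzkin ∧ x = tilde δ d} := by
  refine toSubmodule_adjoin_eq_span (one_mem_span_tilde δ) fun x hx y hy => ?_
  have hx' := Submodule.subset_span (R := 𝕜) hx
  have hy' := Submodule.subset_span (R := 𝕜) hy
  rw [span_tilde_eq_span_bar] at hx' hy' ⊢
  have key : Submodule.span 𝕜 {x | ∃ d : PBDiagram k, d.IsBalancedMotzkin ∧ x = bar δ d} *
      Submodule.span 𝕜 {x | ∃ d : PBDiagram k, d.IsBalancedMotzkin ∧ x = bar δ d} ≤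
      Submodule.span 𝕜 {x | ∃ d : PBDiagram k, d.IsBalancedMotzkin ∧ x = bar δ d} := by
    rw [Submodule.span_mul_span, Submodule.span_le]
    rintro _ ⟨_, ⟨d, hd, rfl⟩, _, ⟨e, he, rfl⟩, rfl⟩
    exact barSpan_le_span_bar δ _ (bar_mul_bar_mem_barSpan δ hd he).1
  exact key (Submodule.mul_mem_mul hx' hy')

theorem toSubmodule_partialTL_eq_span_bar :
    Subalgebra.toSubmodule (PartialTL 𝕜 k δ) =
      Submodule.span 𝕜 {x | ∃ d : PBDiagram k, d.IsBalancedMotzkin ∧ x = bar δ d} := by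
  rw [toSubmodule_partialTL, span_tilde_eq_span_bar]

theorem barSpan_le_partialTL (n : ℕ) :
    barSpan 𝕜 k δ n ≤ Subalgebra.toSubmodule (PartialTL 𝕜 k δ) := by
  rw [toSubmodule_partialTL_eq_span_bar]
  exact barSpan_le_span_bar δ n

theorem partialTL_mul_barSpan (n : ℕ) :
    Subalgebra.toSubmodule (PartialTL 𝕜 k δ) * barSpan 𝕜 k δ n ≤ barSpan 𝕜 k δ n := by
  rw [toSubmodule_partialTL_eq_span_bar]
  nth_rewrite 1 [barSpan]
  rw [Submodule.span_mul_span, Submodule.span_le]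
  rintro _ ⟨_, ⟨d, hd, rfl⟩, _, ⟨e, he, rfl, rfl⟩, rfl⟩
  exact (bar_mul_bar_mem_barSpan δ hd he).2

theorem barSpan_mul_partialTL (n : ℕ) :
    barSpan 𝕜 k δ n * Subalgebra.toSubmodule (PartialTL 𝕜 k δ) ≤ barSpan 𝕜 k δ n := by
  rw [toSubmodule_partialTL_eq_span_bar]
  nth_rewrite 1 [barSpan]
  rw [Submodule.span_mul_span, Submodule.span_le]
  rintro _ ⟨_, ⟨d, hd, rfl, rfl⟩, _, ⟨e, he, rfl⟩, rfl⟩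
  exact (bar_mul_bar_mem_barSpan δ hd he).1

open Classical in
/-- The coefficients at the diagrams spread out over `A` and `B`. -/
noncomputable def blockCoeff (A B : {A : Finset (Fin k) // A.card = n}) :
    PBAlgebra 𝕜 k δ →ₗ[𝕜] PBAlgebra 𝕜 n (δ - 1) :=
  lift δ fun d => if h : ∃ t : PBDiagram n, (∀ y, t.mate y ≠ y) ∧ expand A B t = d then
    of (δ - 1) h.choose else 0

open Classical in
/-- `bar δ d` is `d` plus diagrams with fewer edges, which do not occur in the blocks of the same
size. -/
theorem blockCoeff_block (A B C D : {A : Finset (Fin k) // A.card = n})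
    {x : PBAlgebra 𝕜 n (δ - 1)} (hx : x ∈ TemperleyLieb 𝕜 n (δ - 1)) :
    blockCoeff δ A B (block δ C D x) = if A = C ∧ B = D then x else 0 := by
  induction hx using temperleyLieb_induction with
  | of t ht =>
    rw [block_of, bar_eq_cut, cut, map_sum, Finset.sum_eq_single ∅]
    · rw [Finset.card_empty, pow_zero, one_smul, erase_empty, blockCoeff, lift_of]
      split_ifs with h h' h'
      · obtain ⟨rfl, rfl⟩ := h'
        rw [expand_injective A B h.choose_spec.2]
      · obtain ⟨hs, h1⟩ := h.choose_spec
        have h2 := topSupp_expand (A := A) (B := B) hs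
        have h3 := botSupp_expand (A := A) (B := B) hs
        rw [h1, topSupp_expand ht.2] at h2
        rw [h1, botSupp_expand ht.2] at h3
        exact absurd ⟨Subtype.ext h2.symm, Subtype.ext h3.symm⟩ h'
      · obtain ⟨rfl, rfl⟩ := h'
        exact absurd ⟨t, ht.2, rfl⟩ h
      · rfl
    · intro U hU hne
      have hU := Finset.mem_powerset.1 hU
      obtain ⟨x, hx⟩ := Finset.nonempty_iff_ne_empty.2 hne
      rw [map_smul, blockCoeff, lift_of, dif_neg, smul_zero]
      rintro ⟨s, hs, h⟩
      have h1 : ((expand C D t).erase U).supp.card < (expand C D t).supp.card := by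
        refine Finset.card_lt_card (Finset.ssubset_iff_subset_ne.2
          ⟨fun y hy => (mem_supp_erase.1 hy).1, fun h => ?_⟩)
        have := hU hx
        rw [← h, mem_supp_erase] at this
        exact this.2.1 hx
      rw [← h, supp_expand hs, supp_expand ht.2, Finset.card_disjSum, Finset.card_disjSum, A.2, B.2,
        C.2, D.2] at h1
      exact lt_irrefl _ h1
    · simp
  | zero => simp
  | add x y _ _ hx hy => rw [map_add, map_add, hx, hy]; split_ifs <;> simp
  | smul r x _ hx => rw [map_smul, map_smul, hx]; split_ifs <;> simp

/-- The units of the diagonal blocks add up to the unit of the partial Brauer algebra. -/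
theorem sum_block_one :
    ∑ n : Fin (k + 1), ∑ A : {A : Finset (Fin k) // A.card = n},
      block δ A A (1 : PBAlgebra 𝕜 n (δ - 1)) = (1 : PBAlgebra 𝕜 k δ) := by
  set E : PBAlgebra 𝕜 k δ := ∑ n : Fin (k + 1), ∑ A : {A : Finset (Fin k) // A.card = n},
      block δ A A (1 : PBAlgebra 𝕜 n (δ - 1)) with hE
  have h1 : (1 : PBAlgebra 𝕜 k δ) ∈ Submodule.span 𝕜
      {x | ∃ d : PBDiagram k, d.IsBalancedMotzkin ∧ x = bar δ d} := by
    rw [← span_tilde_eq_span_bar]; exact one_mem_span_tilde δ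
  suffices h : ∀ x ∈ Submodule.span 𝕜
      {x | ∃ d : PBDiagram k, d.IsBalancedMotzkin ∧ x = bar δ d}, E * x = x by
    have := h 1 h1
    rwa [mul_one] at this
  intro x hx
  induction hx using Submodule.span_induction with
  | mem x hx =>
    obtain ⟨d, hd, rfl⟩ := hx
    obtain ⟨-, hA, -⟩ := isBalancedMotzkin_and_card_edges.1 ⟨hd, rfl⟩
    have hn : d.edges.card < k + 1 := by
      rw [← hA]
      exact Nat.lt_succ_of_le (by simpa using Finset.card_le_univ d.topSupp)
    obtain ⟨A, B, t, ht, h2⟩ := exists_bar_eq_block (n := (⟨d.edges.card, hn⟩ : Fin (k + 1)))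
      δ hd rfl
    have ht := of_mem_temperleyLieb (δ - 1) ht
    rw [h2, hE, Finset.sum_mul, Finset.sum_eq_single ⟨d.edges.card, hn⟩, Finset.sum_mul,
      Finset.sum_eq_single A]
    · rw [block_mul_block δ _ _ _ (one_mem _) ht, one_mul]
    · intro A' _ hne
      exact block_mul_block_of_ne δ _ _ _ _ (fun h => hne (Subtype.ext h)) (one_mem _) ht
    · simp
    · intro m _ hm
      rw [Finset.sum_mul]
      refine Finset.sum_eq_zero fun A' _ => ?_
      refine block_mul_block_of_ne δ _ _ _ _ (fun h => hm (Fin.ext ?_)) (one_mem _) ht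
      rw [← A'.2, h, A.2]
    · simp
  | zero => rw [mul_zero]
  | add x y _ _ hx hy => rw [mul_add, hx, hy]
  | smul r x _ hx => rw [mul_smul_comm, hx]

end PBAlgebra

namespace PBAlgebra

open PBDiagram

variable {𝕜 : Type*} [CommRing 𝕜] {k n : ℕ} (δ : 𝕜) {ι : Type*} [Fintype ι]

/-- The map from the matrices over `TL_n(δ - 1)` to `X(n)` assembled from the blocks, where the
`n`-element subsets are enumerated by `β`. -/
noncomputable def ofMatrix (β : {A : Finset (Fin k) // A.card = n} ≃ ι) :
    Matrix ι ι (TemperleyLieb 𝕜 n (δ - 1)) →ₗ[𝕜] PBAlgebra 𝕜 k δ where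
  toFun M := ∑ i, ∑ j, block δ (β.symm i) (β.symm j) (M i j : PBAlgebra 𝕜 n (δ - 1))
  map_add' M N := by
    simp only [Matrix.add_apply, Subalgebra.coe_add, map_add, Finset.sum_add_distrib]
  map_smul' r M := by
    simp only [Matrix.smul_apply, Subalgebra.coe_smul, map_smul, Finset.smul_sum, RingHom.id_apply]

theorem ofMatrix_apply (β : {A : Finset (Fin k) // A.card = n} ≃ ι)
    (M : Matrix ι ι (TemperleyLieb 𝕜 n (δ - 1))) : ofMatrix δ β M =
      ∑ i, ∑ j, block δ (β.symm i) (β.symm j) (M i j : PBAlgebra 𝕜 n (δ - 1)) := rfl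

theorem ofMatrix_injective (β : {A : Finset (Fin k) // A.card = n} ≃ ι) :
    Function.Injective (ofMatrix δ β) := by
  rw [injective_iff_map_eq_zero]
  intro M hM
  refine Matrix.ext fun i j => ?_
  have h := congrArg (blockCoeff δ (β.symm i) (β.symm j)) hM
  rw [ofMatrix_apply, map_zero, map_sum, Finset.sum_eq_single i, map_sum, Finset.sum_eq_single j,
    blockCoeff_block δ _ _ _ _ (M i j).2, if_pos ⟨rfl, rfl⟩] at h
  · exact Subtype.ext h
  · intro j' _ hj
    rw [blockCoeff_block δ _ _ _ _ (M i j').2, if_neg]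
    exact fun h => hj (β.symm.injective h.2).symm
  · simp
  · intro i' _ hi
    rw [map_sum]
    refine Finset.sum_eq_zero fun j' _ => ?_
    rw [blockCoeff_block δ _ _ _ _ (M i' j').2, if_neg]
    exact fun h => hi (β.symm.injective h.1).symm
  · simp

variable [DecidableEq ι]

theorem ofMatrix_single (β : {A : Finset (Fin k) // A.card = n} ≃ ι) (i j : ι)
    (t : TemperleyLieb 𝕜 n (δ - 1)) :
    ofMatrix δ β (Matrix.single i j t) = block δ (β.symm i) (β.symm j) t := by
  rw [ofMatrix_apply, Finset.sum_eq_single i, Finset.sum_eq_single j]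
  · rw [Matrix.single_apply_same]
  · intro j' _ hj
    rw [Matrix.single_apply_of_col_ne _ _ hj.symm, Subalgebra.coe_zero, map_zero]
  · simp
  · intro i' _ hi
    refine Finset.sum_eq_zero fun j' _ => ?_
    rw [Matrix.single_apply_of_row_ne hi.symm, Subalgebra.coe_zero, map_zero]
  · simp

theorem ofMatrix_mul (β : {A : Finset (Fin k) // A.card = n} ≃ ι)
    (M N : Matrix ι ι (TemperleyLieb 𝕜 n (δ - 1))) :
    ofMatrix δ β (M * N) = ofMatrix δ β M * ofMatrix δ β N := by
  have hs : ∀ i j l m (t s : TemperleyLieb 𝕜 n (δ - 1)),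
      ofMatrix δ β (Matrix.single i j t * Matrix.single l m s) =
      ofMatrix δ β (Matrix.single i j t) * ofMatrix δ β (Matrix.single l m s) := by
    intro i j l m t s
    rw [ofMatrix_single, ofMatrix_single]
    by_cases h : j = l
    · subst h
      rw [Matrix.single_mul_single_same, ofMatrix_single, block_mul_block δ _ _ _ t.2 s.2]
      rfl
    · rw [Matrix.single_mul_single_of_ne _ _ _ _ h, map_zero,
        block_mul_block_of_ne δ _ _ _ _ (fun h' => h (β.symm.injective (Subtype.ext h'))) t.2 s.2]
  induction M using Matrix.induction_on' with
  | h_zero => rw [zero_mul, map_zero, zero_mul]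
  | h_add M M' h h' => rw [add_mul, map_add, h, h', map_add, add_mul]
  | h_std_basis i j t =>
    induction N using Matrix.induction_on' with
    | h_zero => rw [mul_zero, map_zero, mul_zero]
    | h_add M M' h h' => rw [mul_add, map_add, h, h', map_add, mul_add]
    | h_std_basis l m s => exact hs i j l m t s

theorem range_ofMatrix (β : {A : Finset (Fin k) // A.card = n} ≃ ι) :
    LinearMap.range (ofMatrix δ β) = barSpan 𝕜 k δ n := by
  apply le_antisymm
  · rintro _ ⟨M, rfl⟩
    exact Submodule.sum_mem _ fun i _ => Submodule.sum_mem _ fun j _ =>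
      block_mem_barSpan δ _ _ (M i j).2
  · rw [barSpan, Submodule.span_le]
    rintro _ ⟨d, hd, hn, rfl⟩
    obtain ⟨A, B, t, ht, h⟩ := exists_bar_eq_block δ hd hn
    refine ⟨Matrix.single (β A) (β B) ⟨_, of_mem_temperleyLieb _ ht⟩, ?_⟩
    rw [ofMatrix_single, h, β.symm_apply_apply, β.symm_apply_apply]

/-- `X(n)` as a subalgebra without unit. -/
noncomputable def barIdeal (k n : ℕ) (δ : 𝕜) : NonUnitalSubalgebra 𝕜 (PBAlgebra 𝕜 k δ) where
  __ := barSpan 𝕜 k δ n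
  mul_mem' {_ _} hx hy := partialTL_mul_barSpan δ n
    (Submodule.mul_mem_mul (barSpan_le_partialTL δ n hx) hy)

/-- The isomorphism of `X(n)` with an algebra of matrices. -/
noncomputable def barIdealEquiv (β : {A : Finset (Fin k) // A.card = n} ≃ ι) :
    barIdeal k n δ ≃ₗ[𝕜] Matrix ι ι (TemperleyLieb 𝕜 n (δ - 1)) :=
  ((LinearEquiv.ofInjective _ (ofMatrix_injective δ β)).trans
    (LinearEquiv.ofEq _ _ (range_ofMatrix δ β))).symm

theorem coe_barIdealEquiv_symm (β : {A : Finset (Fin k) // A.card = n} ≃ ι)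
    (M : Matrix ι ι (TemperleyLieb 𝕜 n (δ - 1))) :
    ((barIdealEquiv δ β).symm M : PBAlgebra 𝕜 k δ) = ofMatrix δ β M := rfl

theorem barIdealEquiv_mul (β : {A : Finset (Fin k) // A.card = n} ≃ ι) (x y : barIdeal k n δ) :
    barIdealEquiv δ β (x * y) = barIdealEquiv δ β x * barIdealEquiv δ β y := by
  apply (barIdealEquiv δ β).symm.injective
  rw [LinearEquiv.symm_apply_apply]
  apply Subtype.ext
  rw [coe_barIdealEquiv_symm, ofMatrix_mul, ← coe_barIdealEquiv_symm, ← coe_barIdealEquiv_symm,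
    LinearEquiv.symm_apply_apply, LinearEquiv.symm_apply_apply]
  rfl

end PBAlgebra

/-! ### Modules over matrix algebras -/

/-- `Q_n ⊗ N` as a power of `N`. -/
noncomputable def subsetModuleTensorEquiv {𝕜 : Type*} [CommRing 𝕜] {k n : ℕ} {ι : Type*}
    (β : {A : Finset (Fin k) // A.card = n} ≃ ι)
    (N : Type*) [AddCommGroup N] [Module 𝕜 N] : SubsetModule 𝕜 k n ⊗[𝕜] N ≃ₗ[𝕜] (ι → N) :=
  ((TensorProduct.finsuppScalarLeft 𝕜 N {A : Finset (Fin k) // A.card = n}).trans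
    (Finsupp.linearEquivFunOnFinite 𝕜 N _)).trans (LinearEquiv.funCongrLeft 𝕜 N β.symm)

theorem subsetModuleTensorEquiv_tmul {𝕜 : Type*} [CommRing 𝕜] {k n : ℕ} {ι : Type*}
    (β : {A : Finset (Fin k) // A.card = n} ≃ ι)
    {N : Type*} [AddCommGroup N] [Module 𝕜 N] (q : SubsetModule 𝕜 k n) (v : N) (i : ι) :
    subsetModuleTensorEquiv β N (q ⊗ₜ v) i = q (β.symm i) • v := by
  simp [subsetModuleTensorEquiv, LinearEquiv.funCongrLeft_apply, LinearMap.funLeft_apply]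

section MatrixModules

variable {𝕜 : Type*} [CommRing 𝕜] {ι : Type*} [Fintype ι] [DecidableEq ι]
  {T : Type*} [Ring T] [Algebra 𝕜 T]

/-- Matrices over an algebra as a tensor product. -/
noncomputable def matrixTensorEquiv (𝕜 : Type*) [CommRing 𝕜] (ι : Type*) [Fintype ι]
    [DecidableEq ι] (T : Type*) [Ring T] [Algebra 𝕜 T] :
    Matrix ι ι T ≃ₐ[𝕜] Matrix ι ι 𝕜 ⊗[𝕜] T :=
  (matrixEquivTensor ι 𝕜 T).trans (Algebra.TensorProduct.comm 𝕜 T (Matrix ι ι 𝕜))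

theorem matrixTensorEquiv_single (i j : ι) (t : T) :
    matrixTensorEquiv 𝕜 ι T (Matrix.single i j t) = Matrix.single i j 1 ⊗ₜ t := by
  rw [matrixTensorEquiv, AlgEquiv.trans_apply, matrixEquivTensor_apply_single,
    Algebra.TensorProduct.comm_tmul]

/-- A module over a matrix algebra is a power of its image under a diagonal matrix unit. -/
theorem exists_equiv_pi {M : Type w} [AddCommGroup M] [Module 𝕜 M] [Nonempty ι]
    (σ : Matrix ι ι T →ₐ[𝕜] Module.End 𝕜 M) :
    ∃ (N : Type w) (_ : AddCommGroup N) (_ : Module 𝕜 N) (_ : Module T N)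
      (_ : IsScalarTower 𝕜 T N) (e : M ≃ₗ[𝕜] (ι → N)),
      ∀ i j t m, e (σ (Matrix.single i j t) m) = Pi.single i (t • e m j) := by
  let o : ι := Classical.arbitrary ι
  let N : Submodule 𝕜 M := LinearMap.range (σ (Matrix.single o o 1))
  have hmul : ∀ i j l (t s : T) m, σ (Matrix.single i j t) (σ (Matrix.single j l s) m) =
      σ (Matrix.single i l (t * s)) m := by
    intro i j l t s m
    rw [← Module.End.mul_apply, ← map_mul, Matrix.single_mul_single_same]
  have hne : ∀ i j j' l (t s : T) m, j ≠ j' →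
      σ (Matrix.single i j t) (σ (Matrix.single j' l s) m) = 0 := by
    intro i j j' l t s m h
    rw [← Module.End.mul_apply, ← map_mul, Matrix.single_mul_single_of_ne _ _ _ _ h, map_zero,
      LinearMap.zero_apply]
  have hN : ∀ j (t : T) m, σ (Matrix.single o j t) m ∈ N := by
    intro j t m
    exact ⟨σ (Matrix.single o j t) m, by rw [hmul, one_mul]⟩
  have hN' : ∀ v ∈ N, σ (Matrix.single o o 1) v = v := by
    rintro _ ⟨m, rfl⟩
    rw [hmul, one_mul]
  let τ : T →ₐ[𝕜] Module.End 𝕜 N := AlgHom.ofLinearMap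
    { toFun := fun t => (σ (Matrix.single o o t)).restrict fun v _ => hN o t v
      map_add' := fun t s => by
        ext v
        simp [Matrix.single_add]
      map_smul' := fun r t => by
        ext v
        simp [← Matrix.smul_single] }
    (by ext v; exact hN' v v.2)
    (fun t s => by
      ext v
      exact (hmul o o o t s v).symm)
  let _ : Module T N := Module.compHom N τ.toRingHom
  have hsmul : ∀ (t : T) (v : N), ((t • v : N) : M) = σ (Matrix.single o o t) v := fun t v => rfl
  refine ⟨N, inferInstance, inferInstance, inferInstance, ⟨fun r t v => ?_⟩, ?_⟩
  · apply Subtype.ext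
    rw [hsmul, Submodule.coe_smul, hsmul, ← Matrix.smul_single, map_smul, LinearMap.smul_apply]
  · refine ⟨
      { toFun := fun m i => ⟨σ (Matrix.single o i 1) m, hN i 1 m⟩
        map_add' := fun m m' => by ext i; simp
        map_smul' := fun r m => by ext i; simp
        invFun := fun v => ∑ i, σ (Matrix.single i o 1) (v i)
        left_inv := fun m => ?_
        right_inv := fun v => ?_ }, ?_⟩
    · simp only [hmul, mul_one]
      rw [← LinearMap.sum_apply, ← map_sum, Matrix.sum_single_one, map_one, Module.End.one_apply]
    · ext i
      change σ (Matrix.single o i 1) (∑ j, σ (Matrix.single j o 1) (v j)) = v i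
      rw [map_sum, Finset.sum_eq_single i]
      · rw [hmul, one_mul, hN' _ (v i).2]
      · exact fun j _ hj => hne _ _ _ _ _ _ _ hj.symm
      · simp
    · intro i j t m
      funext l
      apply Subtype.ext
      change σ (Matrix.single o l 1) (σ (Matrix.single i j t) m) = _
      by_cases h : l = i
      · subst h
        rw [hmul, one_mul, Pi.single_eq_same, hsmul]
        change _ = σ (Matrix.single o o t) (σ (Matrix.single o j 1) m)
        rw [hmul, mul_one]
      · rw [hne _ _ _ _ _ _ _ h, Pi.single_eq_of_ne h, Submodule.coe_zero]

variable {k n : ℕ}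

theorem tensorAction_single (β : {A : Finset (Fin k) // A.card = n} ≃ ι)
    {N : Type*} [AddCommGroup N] [Module 𝕜 N] [Module T N] [IsScalarTower 𝕜 T N]
    (i j : ι) (t : T) (z : SubsetModule 𝕜 k n ⊗[𝕜] N) :
    subsetModuleTensorEquiv β N (tensorAction (𝕜 := 𝕜) β T N (Matrix.single i j 1 ⊗ₜ t) z) =
      Pi.single i (t • subsetModuleTensorEquiv β N z j) := by
  induction z using TensorProduct.induction_on with
  | zero => simp
  | add x y hx hy => rw [map_add, map_add, hx, hy, map_add, Pi.add_apply, smul_add, Pi.single_add]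
  | tmul q v =>
    have h : tensorAction (𝕜 := 𝕜) β T N (Matrix.single i j 1 ⊗ₜ t) (q ⊗ₜ v) =
        (Matrix.toLinAlgEquiv ((Finsupp.basisSingleOne (R := 𝕜)).reindex β) (Matrix.single i j 1) q)
          ⊗ₜ (t • v) := rfl
    rw [h]
    have h2 : Matrix.toLinAlgEquiv ((Finsupp.basisSingleOne (R := 𝕜)).reindex β)
        (Matrix.single i j 1) q = Finsupp.single (β.symm i) (q (β.symm j)) := by
      rw [Matrix.toLinAlgEquiv_apply, Finset.sum_eq_single i]
      · simp [Matrix.single_mulVec]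
      · intro l _ hl
        simp [Matrix.single_mulVec, hl]
      · simp
    funext l
    rw [h2, subsetModuleTensorEquiv_tmul, subsetModuleTensorEquiv_tmul]
    by_cases h : l = i
    · subst h
      rw [Finsupp.single_eq_same, Pi.single_eq_same, smul_comm]
    · rw [Finsupp.single_eq_of_ne (β.symm.injective.ne h), zero_smul, Pi.single_eq_of_ne h]

/-- Every module over the matrix algebra is `Q_n ⊗ N`, where `N` is the image of a diagonal matrix unit. -/
theorem exists_equiv_tensor [Nonempty ι] (β : {A : Finset (Fin k) // A.card = n} ≃ ι)
    {M : Type w} [AddCommGroup M] [Module 𝕜 M] (σ : Matrix ι ι T →ₐ[𝕜] Module.End 𝕜 M) :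
    ∃ (N : Type w) (_ : AddCommGroup N) (_ : Module 𝕜 N) (_ : Module T N)
      (_ : IsScalarTower 𝕜 T N) (e : M ≃ₗ[𝕜] SubsetModule 𝕜 k n ⊗[𝕜] N),
      ∀ Y m, e (σ Y m) = tensorAction (𝕜 := 𝕜) β T N (matrixTensorEquiv 𝕜 ι T Y) (e m) := by
  obtain ⟨N, i1, i2, i3, i4, e, he⟩ := exists_equiv_pi σ
  refine ⟨N, i1, i2, i3, i4, e.trans (subsetModuleTensorEquiv β N).symm, fun Y m => ?_⟩
  induction Y using Matrix.induction_on' with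
  | h_zero => simp
  | h_add M M' h h' => simp only [map_add, LinearMap.add_apply, h, h']
  | h_std_basis i j t =>
    rw [matrixTensorEquiv_single]
    apply (subsetModuleTensorEquiv β N).injective
    rw [tensorAction_single]
    simp [he]

end MatrixModules

/-! ### Morita equivalence with a full corner -/

section Corner

open CategoryTheory

variable {R : Type u} [CommRing R] {A B : Type u} [Ring A] [Algebra R A] [Ring B] [Algebra R B]
  (j : B →ₙₐ[R] A)

/-- For a non-unital embedding `j : B → A` of algebras and an `A`-module `M`, the part of `M` that is
fixed by the idempotent `j 1`. -/
def cornerPart (M : Type*) [AddCommGroup M] [Module A M] : AddSubgroup M where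
  carrier := {m | j 1 • m = m}
  add_mem' {x y} hx hy := by
    change j 1 • (x + y) = x + y
    rw [smul_add, show j 1 • x = x from hx, show j 1 • y = y from hy]
  zero_mem' := smul_zero _
  neg_mem' {x} hx := by
    change j 1 • (-x) = -x
    rw [smul_neg, show j 1 • x = x from hx]

theorem smul_mem_cornerPart {M : Type*} [AddCommGroup M] [Module A M] (s : B) (m : M) :
    j s • m ∈ cornerPart j M := by
  change j 1 • j s • m = j s • m
  rw [smul_smul, ← map_mul, one_mul]

instance cornerPart.module (M : Type*) [AddCommGroup M] [Module A M] :
    Module B (cornerPart j M) where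
  smul s m := ⟨j s • (m : M), smul_mem_cornerPart j s _⟩
  one_smul m := Subtype.ext m.2
  mul_smul s t m := Subtype.ext (by
    change j (s * t) • (m : M) = j s • j t • (m : M)
    rw [map_mul, mul_smul])
  smul_zero s := Subtype.ext (smul_zero _)
  smul_add s m m' := Subtype.ext (smul_add _ _ _)
  add_smul s t m := Subtype.ext (by
    change j (s + t) • (m : M) = j s • (m : M) + j t • (m : M)
    rw [map_add, add_smul])
  zero_smul m := Subtype.ext (by
    change j 0 • (m : M) = 0
    rw [map_zero, zero_smul])

theorem cornerPart.coe_smul {M : Type*} [AddCommGroup M] [Module A M] (s : B)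
    (m : cornerPart j M) : ((s • m : cornerPart j M) : M) = j s • (m : M) := rfl

/-- The functor from `A`-modules to `B`-modules that cuts out the part fixed by `j 1`. -/
def cornerFunctor : ModuleCat.{u} A ⥤ ModuleCat.{u} B where
  obj M := ModuleCat.of B (cornerPart j M)
  map {M M'} f := ModuleCat.ofHom
    { toFun := fun m => ⟨f.hom m, by
        change j 1 • f.hom m = f.hom m
        rw [← map_smul]
        exact congrArg _ m.2⟩
      map_add' := fun m m' => Subtype.ext (map_add f.hom _ _)
      map_smul' := fun s m => Subtype.ext (map_smul f.hom _ _) }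

/-- The `A`-module coinduced from a `B`-module `N` along `j`: the additive maps `A → N` that are
`B`-linear with respect to left multiplication. -/
def coinducedPart (N : Type*) [AddCommGroup N] [Module B N] : AddSubgroup (A →+ N) where
  carrier := {f | ∀ s r, f (j s * r) = s • f r}
  add_mem' {f g} hf hg s r := by
    rw [AddMonoidHom.add_apply, hf, hg, AddMonoidHom.add_apply, smul_add]
  zero_mem' s r := by simp
  neg_mem' {f} hf s r := by
    rw [AddMonoidHom.neg_apply, hf, AddMonoidHom.neg_apply, smul_neg]

instance coinducedPart.module (N : Type*) [AddCommGroup N] [Module B N] :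
    Module A (coinducedPart j N) where
  smul r f := ⟨(f : A →+ N).comp (AddMonoidHom.mulRight r), fun s x => by
    change (f : A →+ N) (j s * x * r) = s • (f : A →+ N) (x * r)
    rw [mul_assoc, f.2]⟩
  one_smul f := Subtype.ext (AddMonoidHom.ext fun x => congrArg (f : A →+ N) (mul_one x))
  mul_smul r r' f := Subtype.ext (AddMonoidHom.ext fun x =>
    congrArg (f : A →+ N) (mul_assoc x r r').symm)
  smul_zero r := rfl
  smul_add r f f' := rfl
  add_smul r r' f := Subtype.ext (AddMonoidHom.ext fun x => by
    change (f : A →+ N) (x * (r + r')) = (f : A →+ N) (x * r) + (f : A →+ N) (x * r')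
    rw [mul_add, map_add])
  zero_smul f := Subtype.ext (AddMonoidHom.ext fun x => by
    change (f : A →+ N) (x * 0) = 0
    rw [mul_zero, map_zero])

theorem coinducedPart.smul_apply {N : Type*} [AddCommGroup N] [Module B N] (r : A)
    (f : coinducedPart j N) (x : A) :
    ((r • f : coinducedPart j N) : A →+ N) x = (f : A →+ N) (x * r) := rfl

theorem cornerFunctor_faithful {κ : Type*} [Fintype κ] (a b : κ → A)
    (hfull : ∑ i, a i * j 1 * b i = 1) : (cornerFunctor j).Faithful where
  map_injective {M M'} f g h := by
    ext m
    have h' : ∀ m : cornerPart j M, f.hom (m : M) = g.hom (m : M) := fun m =>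
      congrArg Subtype.val (LinearMap.congr_fun (congrArg ModuleCat.Hom.hom h) m)
    have hm : m = ∑ i, a i • j 1 • b i • m := by
      simp only [smul_smul, ← Finset.sum_smul, ← mul_assoc]
      rw [hfull, one_smul]
    rw [hm, map_sum, map_sum]
    refine Finset.sum_congr rfl fun i _ => ?_
    rw [map_smul f.hom, map_smul g.hom]
    exact congrArg (a i • ·) (h' ⟨_, smul_mem_cornerPart j 1 (b i • m)⟩)

theorem cornerFunctor_full (hcorner : ∀ x, ∃ s, j s = j 1 * x * j 1) {κ : Type*} [Fintype κ]
    (a b : κ → A) (hfull : ∑ i, a i * j 1 * b i = 1) : (cornerFunctor j).Full where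
  map_surjective {M M'} g' := by
    choose σ hσ using hcorner
    let g : cornerPart j M →ₗ[B] cornerPart j M' := g'.hom
    have h11 : j 1 * j 1 = j 1 := by rw [← map_mul, one_mul]
    let c : κ → M → cornerPart j M := fun i m => ⟨_, smul_mem_cornerPart j 1 (b i • m)⟩
    have hc : ∀ i m, (c i m : M) = j 1 • b i • m := fun _ _ => rfl
    have hfix : ∀ m : cornerPart j M', j 1 • (m : M') = m := fun m => m.2
    have hfixM : ∀ m : cornerPart j M, j 1 • (m : M) = m := fun m => m.2
    -- `b i • r • m` is expanded by means of `1 = ∑ l, a l * j 1 * b l`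
    have hexp : ∀ i r m, c i (r • m) = ∑ l, σ (b i * r * a l) • c l m := by
      intro i r m
      apply Subtype.ext
      rw [AddSubgroup.val_finsetSum]
      simp only [hc, cornerPart.coe_smul, hσ, smul_smul]
      rw [← Finset.sum_smul]
      congr 1
      calc j 1 * (b i * r) = j 1 * (b i * r) * ∑ l, a l * j 1 * b l := by rw [hfull, mul_one]
        _ = _ := by
          rw [Finset.mul_sum]
          refine Finset.sum_congr rfl fun l _ => ?_
          rw [mul_assoc (j 1 * (b i * r * a l)) (j 1) (j 1 * b l), ← mul_assoc (j 1) (j 1) (b l),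
            h11]
          simp only [mul_assoc]
    let f : M →ₗ[A] M' :=
      { toFun := fun m => ∑ i, a i • (g (c i m) : M')
        map_add' := fun m m' => by
          rw [← Finset.sum_add_distrib]
          refine Finset.sum_congr rfl fun i _ => ?_
          have : c i (m + m') = c i m + c i m' := Subtype.ext (by simp [hc])
          rw [this, map_add, AddSubgroup.coe_add, smul_add]
        map_smul' := fun r m => by
          simp only [hexp, map_sum, map_smul, AddSubgroup.val_finsetSum, cornerPart.coe_smul, hσ,
            Finset.smul_sum, RingHom.id_apply, smul_smul]
          rw [Finset.sum_comm]
          refine Finset.sum_congr rfl fun l _ => ?_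
          rw [← Finset.sum_smul]
          conv_rhs => rw [← hfix, smul_smul]
          congr 1
          calc ∑ i, a i * (j 1 * (b i * r * a l) * j 1)
              = (∑ i, a i * j 1 * b i) * (r * a l * j 1) := by
                rw [Finset.sum_mul]
                simp only [mul_assoc]
            _ = _ := by rw [hfull, one_mul] }
    refine ⟨ModuleCat.ofHom f, ?_⟩
    refine ModuleCat.hom_ext (LinearMap.ext fun (m : cornerPart j M) => Subtype.ext ?_)
    change ∑ i, a i • (g (c i (m : M)) : M') = g m
    have h2 : ∀ i, c i (m : M) = σ (b i) • m := by
      intro i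
      apply Subtype.ext
      rw [cornerPart.coe_smul, hσ, hc]
      conv_lhs => rw [← hfixM m]
      simp only [smul_smul, mul_assoc]
    simp only [h2, map_smul, cornerPart.coe_smul, hσ, smul_smul]
    rw [← Finset.sum_smul]
    conv_rhs => rw [← hfix]
    congr 1
    calc ∑ i, a i * (j 1 * b i * j 1) = (∑ i, a i * j 1 * b i) * j 1 := by
          rw [Finset.sum_mul]
          simp only [mul_assoc]
      _ = _ := by rw [hfull, one_mul]

/-- The coinduced module of `N` is a preimage of `N`, by evaluation at `j 1`. -/
theorem cornerFunctor_essSurj (hinj : Function.Injective j)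
    (hcorner : ∀ x, ∃ s, j s = j 1 * x * j 1) : (cornerFunctor j).EssSurj where
  mem_essImage N := by
    choose σ hσ using hcorner
    have hl : ∀ s, j 1 * j s = j s := fun s => by rw [← map_mul, one_mul]
    have hr : ∀ s, j s * j 1 = j s := fun s => by rw [← map_mul, mul_one]
    let φ : cornerPart j (coinducedPart j N) →ₗ[B] N :=
      { toFun := fun f => ((f : coinducedPart j N) : A →+ N) (j 1)
        map_add' := fun f g => rfl
        map_smul' := fun s f => by
          rw [cornerPart.coe_smul, coinducedPart.smul_apply, hl, ← hr s]
          exact (f : coinducedPart j N).2 s _ }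
    have hφ : ∀ f : cornerPart j (coinducedPart j N), ∀ x,
        ((f : coinducedPart j N) : A →+ N) x = σ x • φ f := by
      intro f x
      have h1 : ((f : coinducedPart j N) : A →+ N) x =
          ((f : coinducedPart j N) : A →+ N) (x * j 1) :=
        (congrArg (fun g : coinducedPart j N => (g : A →+ N) x) f.2).symm
      have h2 := (f : coinducedPart j N).2 1 (x * j 1)
      rw [one_smul, ← mul_assoc, ← hσ, ← hr, (f : coinducedPart j N).2] at h2
      rw [h1, ← h2]
      rfl
    have hbij : Function.Bijective φ := by
      constructor
      · intro f g h
        refine Subtype.ext (Subtype.ext (AddMonoidHom.ext fun x => ?_))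
        rw [hφ, hφ, h]
      · intro v
        have hadd : ∀ x y, σ (x + y) = σ x + σ y := fun x y => hinj (by
          rw [map_add, hσ, hσ, hσ, mul_add, add_mul])
        have hs : ∀ s x, σ (j s * x) = s * σ x := fun s x => hinj (by
          rw [map_mul, hσ, hσ, ← mul_assoc, hl, ← mul_assoc, ← mul_assoc, hr])
        have h1 : σ (j 1) = 1 := hinj (by rw [hσ, hl, hl])
        have he : ∀ x, σ (x * j 1) = σ x := fun x => hinj (by
          rw [hσ, hσ, mul_assoc, mul_assoc, hl, ← mul_assoc])
        let f : coinducedPart j N := ⟨AddMonoidHom.mk' (fun x => σ x • v) fun x y => by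
          rw [hadd, add_smul], fun s x => by
            change σ (j s * x) • v = s • σ x • v
            rw [hs, mul_smul]⟩
        refine ⟨⟨f, Subtype.ext (AddMonoidHom.ext fun x => ?_)⟩, ?_⟩
        · change σ (x * j 1) • v = σ x • v
          rw [he]
        · change σ (j 1) • v = v
          rw [h1, one_smul]
    exact ⟨ModuleCat.of A (coinducedPart j N), ⟨(LinearEquiv.ofBijective φ hbij).toModuleIso⟩⟩

open scoped ModuleCat.Algebra in
/-- An algebra is Morita equivalent to the corner cut out by a full idempotent. -/
theorem isMoritaEquivalent_of_corner (hinj : Function.Injective j)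
    (hcorner : ∀ x, ∃ s, j s = j 1 * x * j 1) {κ : Type*} [Fintype κ] (a b : κ → A)
    (hfull : ∑ i, a i * j 1 * b i = 1) : IsMoritaEquivalent R A B := by
  have := cornerFunctor_faithful j a b hfull
  have := cornerFunctor_full j hcorner a b hfull
  have := cornerFunctor_essSurj j hinj hcorner
  have : (cornerFunctor j).IsEquivalence := { }
  refine ⟨⟨⟨(cornerFunctor j).asEquivalence, ⟨fun {M M'} f r => ?_⟩⟩⟩⟩
  refine ModuleCat.hom_ext (LinearMap.ext fun (m : cornerPart j M) => Subtype.ext ?_)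
  change algebraMap R A r • f.hom (m : M) = j (algebraMap R B r) • f.hom (m : M)
  have h : j 1 • (m : M) = m := m.2
  conv_lhs => rw [← h]
  rw [map_smul, smul_smul, Algebra.algebraMap_eq_smul_one r (A := B), map_smul, Algebra.smul_def]

end Corner

/-! ### The Morita equivalence -/

namespace PBAlgebra

open PBDiagram

variable {𝕜 : Type u} [CommRing 𝕜] {k : ℕ} (δ : 𝕜)

theorem block_mem_partialTL {n : ℕ} (A B : {A : Finset (Fin k) // A.card = n})
    {x : PBAlgebra 𝕜 n (δ - 1)} (hx : x ∈ TemperleyLieb 𝕜 n (δ - 1)) :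
    block δ A B x ∈ PartialTL 𝕜 k δ :=
  barSpan_le_partialTL δ n (block_mem_barSpan δ A B hx)

/-- The scalar action underlying the algebra structure of the product, as a shortcut for instance search. -/
noncomputable instance : DistribMulAction 𝕜 (Π n : Fin (k + 1), TemperleyLieb 𝕜 n (δ - 1)) :=
  (Algebra.toModule : Module 𝕜 (Π n : Fin (k + 1), TemperleyLieb 𝕜 n (δ - 1))).toDistribMulAction

/-- The embedding of the product of the Temperley-Lieb algebras into `PTL_k(δ)` given by the choice of
one diagonal block in each `X(n)`. -/
noncomputable def diagonalBlocks
    (A₀ : ∀ n : Fin (k + 1), {A : Finset (Fin k) // A.card = n}) :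
    (Π n : Fin (k + 1), TemperleyLieb 𝕜 n (δ - 1)) →ₙₐ[𝕜] PartialTL 𝕜 k δ where
  toFun s := ⟨∑ n, block δ (A₀ n) (A₀ n) (s n : PBAlgebra 𝕜 n (δ - 1)),
    sum_mem fun n _ => block_mem_partialTL δ _ _ (s n).2⟩
  map_smul' r s := Subtype.ext (by
    simp [Finset.smul_sum])
  map_zero' := Subtype.ext (by simp)
  map_add' s t := Subtype.ext (by simp [Finset.sum_add_distrib])
  map_mul' s t := Subtype.ext (by
    change ∑ n, block δ (A₀ n) (A₀ n) ((s * t) n : PBAlgebra 𝕜 n (δ - 1)) =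
      (∑ n, block δ (A₀ n) (A₀ n) (s n : PBAlgebra 𝕜 n (δ - 1))) *
        ∑ n, block δ (A₀ n) (A₀ n) (t n : PBAlgebra 𝕜 n (δ - 1))
    rw [Finset.sum_mul]
    refine Finset.sum_congr rfl fun n _ => ?_
    rw [Finset.mul_sum, Finset.sum_eq_single n, block_mul_block δ _ _ _ (s n).2 (t n).2]
    · rfl
    · intro m _ hm
      refine block_mul_block_of_ne δ _ _ _ _ (fun h => hm (Fin.ext ?_)) (s n).2 (t m).2
      rw [← (A₀ m).2, ← h, (A₀ n).2]
    · simp)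

theorem coe_diagonalBlocks (A₀ : ∀ n : Fin (k + 1), {A : Finset (Fin k) // A.card = n})
    (s : Π n : Fin (k + 1), TemperleyLieb 𝕜 n (δ - 1)) :
    (diagonalBlocks δ A₀ s : PBAlgebra 𝕜 k δ) =
      ∑ n, block δ (A₀ n) (A₀ n) (s n : PBAlgebra 𝕜 n (δ - 1)) := rfl

theorem diagonalBlocks_mul_block (A₀ : ∀ n : Fin (k + 1), {A : Finset (Fin k) // A.card = n})
    (s : Π n : Fin (k + 1), TemperleyLieb 𝕜 n (δ - 1)) {n : Fin (k + 1)}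
    (A B : {A : Finset (Fin k) // A.card = n}) {x : PBAlgebra 𝕜 n (δ - 1)}
    (hx : x ∈ TemperleyLieb 𝕜 n (δ - 1)) :
    (diagonalBlocks δ A₀ s : PBAlgebra 𝕜 k δ) * block δ A B x =
      if A = A₀ n then block δ A B (s n * x) else 0 := by
  rw [coe_diagonalBlocks, Finset.sum_mul, Finset.sum_eq_single n]
  · split_ifs with h
    · subst h
      exact block_mul_block δ _ _ _ (s n).2 hx
    · exact block_mul_block_of_ne δ _ _ _ _ (fun h' => h (Subtype.ext h'.symm)) (s n).2 hx
  · intro m _ hm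
    refine block_mul_block_of_ne δ _ _ _ _ (fun h => hm (Fin.ext ?_)) (s m).2 hx
    rw [← (A₀ m).2, h, A.2]
  · simp

theorem block_mul_diagonalBlocks (A₀ : ∀ n : Fin (k + 1), {A : Finset (Fin k) // A.card = n})
    (s : Π n : Fin (k + 1), TemperleyLieb 𝕜 n (δ - 1)) {n : Fin (k + 1)}
    (A B : {A : Finset (Fin k) // A.card = n}) {x : PBAlgebra 𝕜 n (δ - 1)}
    (hx : x ∈ TemperleyLieb 𝕜 n (δ - 1)) :
    block δ A B x * (diagonalBlocks δ A₀ s : PBAlgebra 𝕜 k δ) =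
      if B = A₀ n then block δ A B (x * s n) else 0 := by
  rw [coe_diagonalBlocks, Finset.mul_sum, Finset.sum_eq_single n]
  · split_ifs with h
    · subst h
      exact block_mul_block δ _ _ _ hx (s n).2
    · exact block_mul_block_of_ne δ _ _ _ _ (fun h' => h (Subtype.ext h')) hx (s n).2
  · intro m _ hm
    refine block_mul_block_of_ne δ _ _ _ _ (fun h => hm (Fin.ext ?_)) hx (s m).2
    rw [← (A₀ m).2, ← h, B.2]
  · simp

theorem diagonalBlocks_injective
    (A₀ : ∀ n : Fin (k + 1), {A : Finset (Fin k) // A.card = n}) :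
    Function.Injective (diagonalBlocks (𝕜 := 𝕜) δ A₀) := by
  classical
  intro s t h
  funext n
  have h1 := congrArg (fun x : PartialTL 𝕜 k δ => blockCoeff δ (A₀ n) (A₀ n)
    ((x : PBAlgebra 𝕜 k δ) * block δ (A₀ n) (A₀ n) 1)) h
  simp only [diagonalBlocks_mul_block δ A₀ _ _ _ (one_mem _), if_true, mul_one,
    blockCoeff_block δ _ _ _ _ (s n).2, blockCoeff_block δ _ _ _ _ (t n).2, and_self] at h1
  exact Subtype.ext h1

theorem exists_diagonalBlocks_eq
    (A₀ : ∀ n : Fin (k + 1), {A : Finset (Fin k) // A.card = n}) (x : PartialTL 𝕜 k δ) :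
    ∃ s, diagonalBlocks δ A₀ s = diagonalBlocks δ A₀ 1 * x * diagonalBlocks δ A₀ 1 := by
  classical
  suffices h : ∀ x ∈ Submodule.span 𝕜
      {x | ∃ d : PBDiagram k, d.IsBalancedMotzkin ∧ x = bar δ d},
      ∃ s, (diagonalBlocks δ A₀ s : PBAlgebra 𝕜 k δ) =
        diagonalBlocks δ A₀ 1 * x * diagonalBlocks δ A₀ 1 by
    obtain ⟨x, hx⟩ := x
    rw [← Subalgebra.mem_toSubmodule, toSubmodule_partialTL_eq_span_bar] at hx
    obtain ⟨s, hs⟩ := h x hx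
    exact ⟨s, Subtype.ext hs⟩
  intro x hx
  induction hx using Submodule.span_induction with
  | mem x hx =>
    obtain ⟨d, hd, rfl⟩ := hx
    obtain ⟨-, hA, -⟩ := isBalancedMotzkin_and_card_edges.1 ⟨hd, rfl⟩
    have hn : d.edges.card < k + 1 := by
      rw [← hA]
      exact Nat.lt_succ_of_le (by simpa using Finset.card_le_univ d.topSupp)
    obtain ⟨n, hn⟩ : ∃ n : Fin (k + 1), d.edges.card = n := ⟨⟨_, hn⟩, rfl⟩
    obtain ⟨A, B, t, ht, h⟩ := exists_bar_eq_block δ hd hn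
    have ht := of_mem_temperleyLieb (δ - 1) ht
    rw [h, diagonalBlocks_mul_block δ A₀ _ _ _ ht, Pi.one_apply, Subalgebra.coe_one, one_mul]
    by_cases hA : A = A₀ n
    · rw [if_pos hA, block_mul_diagonalBlocks δ A₀ _ _ _ ht, Pi.one_apply, Subalgebra.coe_one,
        mul_one]
      by_cases hB : B = A₀ n
      · rw [if_pos hB, hA, hB]
        refine ⟨Pi.single n ⟨_, ht⟩, ?_⟩
        rw [coe_diagonalBlocks, Finset.sum_eq_single n]
        · rw [Pi.single_eq_same]
        · intro m _ hm
          rw [Pi.single_eq_of_ne hm, Subalgebra.coe_zero, map_zero]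
        · simp
      · rw [if_neg hB]
        exact ⟨0, by rw [map_zero]; rfl⟩
    · rw [if_neg hA, zero_mul]
      exact ⟨0, by rw [map_zero]; rfl⟩
  | zero => exact ⟨0, by rw [map_zero, mul_zero, zero_mul]; rfl⟩
  | add x y _ _ hx hy =>
    obtain ⟨s, hs⟩ := hx
    obtain ⟨t, ht⟩ := hy
    exact ⟨s + t, by rw [map_add, Subalgebra.coe_add, hs, ht, mul_add, add_mul]⟩
  | smul r x _ hx =>
    obtain ⟨s, hs⟩ := hx
    exact ⟨r • s, by rw [map_smul, Subalgebra.coe_smul, hs, mul_smul_comm, smul_mul_assoc]⟩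

theorem isMoritaEquivalent_partialTL :
    IsMoritaEquivalent 𝕜 (PartialTL 𝕜 k δ) (Π n : Fin (k + 1), TemperleyLieb 𝕜 n (δ - 1)) := by
  have hex : ∀ n : Fin (k + 1), Nonempty {A : Finset (Fin k) // A.card = n} := by
    intro n
    obtain ⟨A, -, hA⟩ := Finset.exists_subset_card_eq (s := (Finset.univ : Finset (Fin k)))
      (n := n) (by rw [Finset.card_univ, Fintype.card_fin]; omega)
    exact ⟨⟨A, hA⟩⟩
  let A₀ : ∀ n : Fin (k + 1), {A : Finset (Fin k) // A.card = n} := fun n => (hex n).some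
  refine isMoritaEquivalent_of_corner (diagonalBlocks δ A₀) (diagonalBlocks_injective δ A₀)
    (exists_diagonalBlocks_eq δ A₀)
    (κ := Σ n : Fin (k + 1), {A : Finset (Fin k) // A.card = n})
    (fun i => ⟨block δ i.2 (A₀ i.1) 1, block_mem_partialTL δ _ _ (one_mem _)⟩)
    (fun i => ⟨block δ (A₀ i.1) i.2 1, block_mem_partialTL δ _ _ (one_mem _)⟩) ?_
  apply Subtype.ext
  rw [AddSubmonoidClass.coe_finsetSum, Fintype.sum_sigma]
  refine Eq.trans ?_ (sum_block_one δ)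
  refine Finset.sum_congr rfl fun n _ => Finset.sum_congr rfl fun A _ => ?_
  classical
  change block δ A (A₀ n) 1 * (diagonalBlocks δ A₀ 1 : PBAlgebra 𝕜 k δ) * block δ (A₀ n) A 1 = _
  rw [block_mul_diagonalBlocks δ A₀ _ _ _ (one_mem _), if_pos rfl, Pi.one_apply,
    Subalgebra.coe_one, one_mul, block_mul_block δ _ _ _ (one_mem _) (one_mem _), one_mul]

end PBAlgebra

theorem theoremt {𝕜 : Type u} [CommRing 𝕜] (δ : 𝕜) (k : ℕ) :
    -- `PTL_k(δ)` is the linear span of the tilde elements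
    Subalgebra.toSubmodule (PartialTL 𝕜 k δ) =
      Submodule.span 𝕜
        {x | ∃ d : PBDiagram k, d.IsBalancedMotzkin ∧ x = PBAlgebra.tilde δ d} ∧
    (∀ n ≤ k,
      -- `TL_n(δ - 1)` is the linear span of the Temperley-Lieb diagrams
      Subalgebra.toSubmodule (TemperleyLieb 𝕜 n (δ - 1)) =
        Submodule.span 𝕜
          {x | ∃ d : PBDiagram n, d.IsTemperleyLieb ∧ x = PBAlgebra.of (δ - 1) d} ∧
      -- `X(n)` is a two-sided ideal of `PTL_k(δ)`
      ∃ I : NonUnitalSubalgebra 𝕜 (PBAlgebra 𝕜 k δ),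
        I.toSubmodule = barSpan 𝕜 k δ n ∧
        (∀ x ∈ I, x ∈ PartialTL 𝕜 k δ) ∧
        (∀ a ∈ PartialTL 𝕜 k δ, ∀ x ∈ I, a * x ∈ I ∧ x * a ∈ I) ∧
        ∃ (β : {A : Finset (Fin k) // A.card = n} ≃ Fin (k.choose n))
          (Φ : I ≃ₗ[𝕜]
            Matrix (Fin (k.choose n)) (Fin (k.choose n)) (TemperleyLieb 𝕜 n (δ - 1)))
          (Ψ : Matrix (Fin (k.choose n)) (Fin (k.choose n)) (TemperleyLieb 𝕜 n (δ - 1)) ≃ₐ[𝕜]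
            Matrix (Fin (k.choose n)) (Fin (k.choose n)) 𝕜 ⊗[𝕜] TemperleyLieb 𝕜 n (δ - 1)),
          -- the isomorphisms of algebras
          (∀ x y, Φ (x * y) = Φ x * Φ y) ∧
          (∀ i j t, Ψ (Matrix.single i j t) = Matrix.single i j 1 ⊗ₜ t) ∧
          -- every module over `X(n)`, whose identity element is `Φ⁻¹(1)`, is some `Q_n ⊗ N`
          ∀ (M : Type w) [AddCommGroup M] [Module 𝕜 M] (ρ : I →ₙₐ[𝕜] Module.End 𝕜 M),
            ρ (Φ.symm 1) = 1 →
            ∃ (N : Type w) (_ : AddCommGroup N) (_ : Module 𝕜 N)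
              (_ : Module (TemperleyLieb 𝕜 n (δ - 1)) N)
              (_ : IsScalarTower 𝕜 (TemperleyLieb 𝕜 n (δ - 1)) N)
              (e : M ≃ₗ[𝕜] SubsetModule 𝕜 k n ⊗[𝕜] N),
              ∀ x m, e (ρ x m) =
                tensorAction (𝕜 := 𝕜) β (TemperleyLieb 𝕜 n (δ - 1)) N (Ψ (Φ x)) (e m)) ∧
    IsMoritaEquivalent 𝕜 (PartialTL 𝕜 k δ)
      (Π n : Fin (k + 1), TemperleyLieb 𝕜 n (δ - 1)) := by
  refine ⟨PBAlgebra.toSubmodule_partialTL δ, fun n hn => ⟨toSubmodule_temperleyLieb n _,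
    PBAlgebra.barIdeal k n δ, rfl, fun x hx => PBAlgebra.barSpan_le_partialTL δ n hx,
    fun a ha x hx => ⟨PBAlgebra.partialTL_mul_barSpan δ n (Submodule.mul_mem_mul ha hx),
      PBAlgebra.barSpan_mul_partialTL δ n (Submodule.mul_mem_mul hx ha)⟩, ?_⟩,
    PBAlgebra.isMoritaEquivalent_partialTL δ⟩
  let β : {A : Finset (Fin k) // A.card = n} ≃ Fin (k.choose n) :=
    Fintype.equivFinOfCardEq (by simp)
  refine ⟨β, PBAlgebra.barIdealEquiv δ β, matrixTensorEquiv 𝕜 _ _,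
    PBAlgebra.barIdealEquiv_mul δ β, matrixTensorEquiv_single, ?_⟩
  intro M _ _ ρ hρ
  have : Nonempty (Fin (k.choose n)) := ⟨⟨0, Nat.choose_pos hn⟩⟩
  let Φ := PBAlgebra.barIdealEquiv δ β
  obtain ⟨N, i1, i2, i3, i4, e, he⟩ := exists_equiv_tensor β
    (AlgHom.ofLinearMap ((ρ : PBAlgebra.barIdeal k n δ →ₗ[𝕜] Module.End 𝕜 M) ∘ₗ Φ.symm.toLinearMap)
      hρ fun Y Z => by
        have h : Φ.symm (Y * Z) = Φ.symm Y * Φ.symm Z := by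
          apply Φ.injective
          rw [PBAlgebra.barIdealEquiv_mul]
          simp only [Φ, LinearEquiv.apply_symm_apply]
        change ρ (Φ.symm (Y * Z)) = ρ (Φ.symm Y) * ρ (Φ.symm Z)
        rw [h, map_mul])
  refine ⟨N, i1, i2, i3, i4, e, fun x m => ?_⟩
  rw [← he]
  change _ = e (ρ (Φ.symm (Φ x)) m)
  rw [LinearEquiv.symm_apply_apply]
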